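/- **Conventions.** For a real matrix $A$ let $\|A\|_\infty=\max_{i,j}|A_{i,j}|$. For $f:\mathbb R^{n\times d}\to\mathbb R$, $\frac{\mathrm df}{\mathrm dA}\in\mathbb R^{n\times d}$ is the matrix of partial derivatives, and for $\mathsf H:\mathbb R^{n\times d}\to\mathbb R^{n\times d}$ the vector–Jacobian product (VJP) of $G\in\mathbb R^{n\times d}$ is $\left(G\,\frac{\mathrm d\mathsf H(A)}{\mathrm dA}\right)_{j,k}=\sum_{a,b}G_{a,b}\,\frac{\partial \mathsf H(A)_{a,b}}{\partial A_{j,k}}$. An algorithm is one finite program (the same for all input sizes) for a random access machine with unit-cost exact real arithmetic and comparisons, which may in addition evaluate the functions of a fixed list of unary real functions at unit cost; time is the number of steps. A function $T$ is almost linear, $T(n)=n^{1+o(1)}$, if for every $\varepsilon>0$, $T(n)\le n^{1+\varepsilon}$ for all large $n$; $M(n)=n^{o(1)}$ means $M(n)\le n^{\varepsilon}$ for all large $n$, for every $\varepsilon>0$. The hidden dimension satisfies $d\le C\log n$ for a constant $C$. A loss is $L=\sum_{j\le n,k\le d}\ell_{j,k}$ with real functions $\ell_{j,k}$ on $\mathbb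 R^{n\times d}$. **Part 1 (one residual block).** Consider a family of residual blocks $Y_R=X_R+\mathsf H(X_R)\in\mathbb R^{n\times d}$, each followed by a loss $L$ that is a function of $Y_R$, with $\mathsf H$ differentiable at $X_R$ and the $\ell_{j,k}$ differentiable at $Y_R$. Let $\delta(n)\ge 0$. Assume that one algorithm computes, in almost linear time, from the description of the block and any $G$ with $\|G-\frac{\mathrm dL}{\mathrm dY_R}\|_\infty\le1$, the product $G\,\frac{\mathrm d\mathsf H(X_R)}{\mathrm dX_R}$ up to an entrywise error of $\delta(n)$ ($\delta=0$ is exact computation). Then there is an algorithm with an almost linear time bound such that: * from $\frac{\mathrm dL}{\mathrm dY_R}$ it computes $\frac{\mathrm dL}{\mathrm dX_R}$ up to an error of $\delta(n)$ in $\|\cdot\|_\infty$ (exactly, if $\delta=0$), where $L$ is differentiable as a function of $X_R$; * if the entries of the Jacobian of $\mathsf H$ at $X_R$ are at most $n^{c}$ in absolute value for a constant $c$, then there is a constant $K$ such that for every $k$, from any $\widetilde G$ with $\|\widetilde G-\frac{\mathrm dL}{\mathrm dY_R}\|_\infty\le n^{-(k+K)}$, it computes $\frac{\mathrm dL}{\mathrm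 dX_R}$ up to an error of $n^{-k}+\delta(n)$ in $\|\cdot\|_\infty$, within the same time bound. The algorithm depends only on the given one. **Part 2 (the multi-layer transformer).** Let $\mathsf{Attn}_i(A)=\mathsf{Softmax}(A W_{Q_i}W_{K_i}^\top A^\top/d)\,A W_{V_i}$ with row-wise softmax and $W_{Q_i},W_{K_i},W_{V_i}\in\mathbb R^{d\times d}$. An $m$-layer transformer with both residual connections is given by maps $g_0,\dots,g_m:\mathbb R^{n\times d}\to\mathbb R^{n\times d}$ and $$T_0=g_0(X),\qquad Z_i=T_{i-1}+\mathsf{Attn}_i(T_{i-1}),\qquad T_i=Z_i+g_i(Z_i)\quad(1\le i\le m),$$ and $L(X)=\sum_{j,k}\ell_{j,k}(T_m)$; put $Z_0=X$. Fix constants $C$, $c$, $m_0$, a function $R(n)=o(\sqrt{\log n})$ and a function $M(n)=n^{o(1)}$. Consider a family of such transformers with the following properties. * $d\le C\log n$ and $m\le M(n)$. * $g_i$ is differentiable at $Z_i$ ($0\le i\le m$), the $\ell_{j,k}$ are differentiable at $T_m$. * The entries of $W_{Q_i},W_{K_i},W_{V_i}$, of the Jacobians of $g_i$ at $Z_i$,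 and of $\frac{\mathrm dL}{\mathrm dT_m}$ are at most $n^{c}$ in absolute value; and $\|T_{i-1}\|_\infty\le R(n)$, $\|T_{i-1}W_{Q_i}W_{K_i}^\top\|_\infty\le R(n)$ for $1\le i\le m$. * One given algorithm computes, in almost linear time, the backward pass $(i,G)\mapsto G\,\frac{\mathrm dg_i(Z_i)}{\mathrm dZ_i}$, and one computes $\frac{\mathrm dL}{\mathrm dT_m}$ in almost linear time. * Either $m\le m_0$ (a bounded number of layers), or the Jacobians $\frac{\mathrm dT_j}{\mathrm dT_i}$, $0\le i\le j\le m$, have entries of absolute value at most $n^{c}$. Then for every $k$ there is an algorithm that, given the weights, the values $T_i$, $Z_i$ of the forward pass and whatever data describe the $g_i$ and $\ell_{j,k}$, computes in time $n^{1+o(1)}$, for all sufficiently large $n$, a matrix $\widetilde g_r$ with $$\left\|\widetilde g_r-\frac{\mathrm dL(X)}{\mathrm dX}\right\|_\infty\le \frac1{n^{k}},$$ where $L$ is differentiable at $X$. The algorithm depends only on $k,C,c,m_0$ and the two given algorithms, not on the family, $R$ or $M$. -/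

import Mathlib

open Filter

/- The norm of a real matrix is the largest absolute value of an entry. -/
attribute [local instance] Matrix.normedAddCommGroup Matrix.normedSpace

noncomputable section

namespace ResidualTransformer

/-! ### The machine: a random access machine over the reals with a step count

A machine has index registers (naturals), real registers, and writable arrays of naturals and of
reals, whose cells are addressed by a fixed array number and three index registers. It also has
read-only input arrays. Index registers can only be set to constants, copied, incremented,
decremented, loaded and compared, so that they never hold large numbers that were not in the input.
One instruction or one evaluation of a condition is one step. `prim` is the list of unary real
functions (say `exp`, an activation function or its derivative) that may be evaluated in one step;
it is arbitrary, possibly useless. -/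

/-- Arrays: cell `(a, i, j, k)` is the entry `(i, j, k)` of the array with number `a`. -/
abbrev Arrays (α : Type) : Type := ℕ × ℕ × ℕ × ℕ → α

/-- Read-only input arrays. -/
structure Input where
  int : Arrays ℕ
  real : Arrays ℝ

/-- The writable part of the machine. -/
structure Store where
  idx : ℕ → ℕ
  reg : ℕ → ℝ
  int : Arrays ℕ
  real : Arrays ℝ

/-- Instructions. Except for the numerals in `iconst`, `rconst` and for array numbers `A` and
function numbers `f`, the arguments are names of registers. -/
inductive Op where
  | iconst (a v : ℕ)
  | icopy (a b : ℕ)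
  | succ (a : ℕ)
  | pred (a : ℕ)
  | iload (a A i j k : ℕ)
  | istore (A i j k a : ℕ)
  | iinput (a A i j k : ℕ)
  | rconst (a v : ℕ)
  | rcopy (a b : ℕ)
  | ofIdx (a b : ℕ)
  | add (a b c : ℕ)
  | sub (a b c : ℕ)
  | mul (a b c : ℕ)
  | div (a b c : ℕ)
  | prim (a f b : ℕ)
  | rload (a A i j k : ℕ)
  | rstore (A i j k a : ℕ)
  | rinput (a A i j k : ℕ)

/-- The address of entry `(i, j, k)` of array `A`, the entry being given by index registers. -/
def Store.addr (σ : Store) (A i j k : ℕ) : ℕ × ℕ × ℕ × ℕ := (A, σ.idx i, σ.idx j, σ.idx k)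

def Store.setIdx (σ : Store) (a v : ℕ) : Store := { σ with idx := Function.update σ.idx a v }

def Store.setReg (σ : Store) (a : ℕ) (v : ℝ) : Store :=
  { σ with reg := Function.update σ.reg a v }

/-- The effect of one instruction. -/
def Op.run (prim : ℕ → ℝ → ℝ) (inp : Input) (σ : Store) : Op → Store
  | .iconst a v => σ.setIdx a v
  | .icopy a b => σ.setIdx a (σ.idx b)
  | .succ a => σ.setIdx a (σ.idx a + 1)
  | .pred a => σ.setIdx a (σ.idx a - 1)
  | .iload a A i j k => σ.setIdx a (σ.int (σ.addr A i j k))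
  | .istore A i j k a => { σ with int := Function.update σ.int (σ.addr A i j k) (σ.idx a) }
  | .iinput a A i j k => σ.setIdx a (inp.int (σ.addr A i j k))
  | .rconst a v => σ.setReg a (v : ℝ)
  | .rcopy a b => σ.setReg a (σ.reg b)
  | .ofIdx a b => σ.setReg a (σ.idx b : ℝ)
  | .add a b c => σ.setReg a (σ.reg b + σ.reg c)
  | .sub a b c => σ.setReg a (σ.reg b - σ.reg c)
  | .mul a b c => σ.setReg a (σ.reg b * σ.reg c)
  | .div a b c => σ.setReg a (σ.reg b / σ.reg c)
  | .prim a f b => σ.setReg a (prim f (σ.reg b))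
  | .rload a A i j k => σ.setReg a (σ.real (σ.addr A i j k))
  | .rstore A i j k a => { σ with real := Function.update σ.real (σ.addr A i j k) (σ.reg a) }
  | .rinput a A i j k => σ.setReg a (inp.real (σ.addr A i j k))

/-- Conditions: strict comparison of two index registers, or of two real registers. -/
inductive Cond where
  | ilt (a b : ℕ)
  | rlt (a b : ℕ)

def Cond.Holds (σ : Store) : Cond → Prop
  | .ilt a b => σ.idx a < σ.idx b
  | .rlt a b => σ.reg a < σ.reg b

/-- Programs. A program is a finite text that does not depend on the size of the input. -/
inductive Prog where
  | skip
  | op (o : Op)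
  | seq (P Q : Prog)
  | ite (b : Cond) (P Q : Prog)
  | while (b : Cond) (P : Prog)

/-- `Exec prim inp P σ σ' t`: on input `inp`, the program `P`, started in `σ`, halts in `σ'` after
`t` steps. -/
inductive Exec (prim : ℕ → ℝ → ℝ) (inp : Input) : Prog → Store → Store → ℕ → Prop
  | skip (σ : Store) : Exec prim inp .skip σ σ 0
  | op (o : Op) (σ : Store) : Exec prim inp (.op o) σ (o.run prim inp σ) 1
  | seq {P Q : Prog} {σ₁ σ₂ σ₃ : Store} {s t : ℕ} :
      Exec prim inp P σ₁ σ₂ s → Exec prim inp Q σ₂ σ₃ t →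
      Exec prim inp (.seq P Q) σ₁ σ₃ (s + t)
  | iteTrue {b : Cond} {P Q : Prog} {σ σ' : Store} {t : ℕ} :
      b.Holds σ → Exec prim inp P σ σ' t → Exec prim inp (.ite b P Q) σ σ' (t + 1)
  | iteFalse {b : Cond} {P Q : Prog} {σ σ' : Store} {t : ℕ} :
      ¬ b.Holds σ → Exec prim inp Q σ σ' t → Exec prim inp (.ite b P Q) σ σ' (t + 1)
  | whileTrue {b : Cond} {P : Prog} {σ₁ σ₂ σ₃ : Store} {s t : ℕ} :
      b.Holds σ₁ → Exec prim inp P σ₁ σ₂ s → Exec prim inp (.while b P) σ₂ σ₃ t →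
      Exec prim inp (.while b P) σ₁ σ₃ (s + t + 1)
  | whileFalse {b : Cond} {P : Prog} {σ : Store} :
      ¬ b.Holds σ → Exec prim inp (.while b P) σ σ 1

/-- Started in `σ` on input `inp`, the program halts within `τ` steps, in a store that satisfies
`post`. (Execution is deterministic.) -/
def RunsIn (prim : ℕ → ℝ → ℝ) (inp : Input) (P : Prog) (σ : Store) (τ : ℝ)
    (post : Store → Prop) : Prop :=
  ∃ (σ' : Store) (t : ℕ), Exec prim inp P σ σ' t ∧ (t : ℝ) ≤ τ ∧ post σ'

/-- `T(n) ≤ n^{1 + o(1)}`. -/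
def AlmostLinear (T : ℕ → ℝ) : Prop :=
  ∀ ε : ℝ, 0 < ε → ∀ᶠ n : ℕ in atTop, T n ≤ (n : ℝ) ^ (1 + ε)

/-- `M(n) ≤ n^{o(1)}`. -/
def SubPolynomial (M : ℕ → ℝ) : Prop :=
  ∀ ε : ℝ, 0 < ε → ∀ᶠ n : ℕ in atTop, M n ≤ (n : ℝ) ^ ε

/-! ### Gradients, losses, attention -/

abbrev Mat (n d : ℕ) : Type := Matrix (Fin n) (Fin d) ℝ

/-- Array number `a` holds the matrix `A` (in its layer `0`). -/
def Store.HoldsMat {n d : ℕ} (σ : Store) (a : ℕ) (A : Mat n d) : Prop :=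
  ∀ (j : Fin n) (k : Fin d), σ.real (a, 0, (j : ℕ), (k : ℕ)) = A j k

/-- The matrix of partial derivatives of a real function of a matrix. -/
def grad {n d : ℕ} (f : Mat n d → ℝ) (A : Mat n d) : Mat n d :=
  Matrix.of fun j k => fderiv ℝ f A (Matrix.single j k 1)

/-- The derivative of `H` at `A` in the direction of the entry `(j, k)`: the entries of these
matrices are the entries of the Jacobian of `H`. -/
def partialDeriv {n d : ℕ} (H : Mat n d → Mat n d) (A : Mat n d) (j : Fin n) (k : Fin d) :
    Mat n d :=
  fderiv ℝ H A (Matrix.single j k 1)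

/-- All entries of the Jacobian of `H` at `A` are at most `b` in absolute value. -/
def JacobianBound {n d : ℕ} (H : Mat n d → Mat n d) (A : Mat n d) (b : ℝ) : Prop :=
  ∀ j k, ‖partialDeriv H A j k‖ ≤ b

/-- The product of the cotangent `G` with the Jacobian of `H` at `A`. -/
def vjp {n d : ℕ} (H : Mat n d → Mat n d) (A G : Mat n d) : Mat n d :=
  Matrix.of fun j k => ∑ a, ∑ b, G a b * partialDeriv H A j k a b

/-- The overall loss `L = ∑_{j,k} ℓ_{j,k}`. -/
def overallLoss {n d : ℕ} (l : Fin n → Fin d → Mat n d → ℝ) (A : Mat n d) : ℝ :=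
  ∑ j, ∑ k, l j k A

/-- Softmax of each row. -/
def softmax {n : ℕ} (A : Mat n n) : Mat n n :=
  Matrix.of fun j k => Real.exp (A j k) / ∑ k', Real.exp (A j k')

/-- Self-attention `Softmax(X W_Q W_Kᵀ Xᵀ / d) X W_V`. -/
def attn {n d : ℕ} (WQ WK WV : Mat d d) (X : Mat n d) : Mat n d :=
  softmax ((1 / (d : ℝ)) • (X * (WQ * WK.transpose) * X.transpose)) * X * WV

/-- The residual connection around `H`. -/
def residual {n d : ℕ} (H : Mat n d → Mat n d) (A : Mat n d) : Mat n d := A + H A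

/-! ### One residual block -/

/-- A residual block `Y = X + H(X)` followed by a loss, which is a function of `Y`. The read-only
input of the machine describes the block (its weights, `X`, and so on) in a way that only
the program for `H` has to understand. -/
structure Block where
  n : ℕ
  d : ℕ
  H : Mat n d → Mat n d
  X : Mat n d
  loss : Fin n → Fin d → Mat n d → ℝ
  input : Input

namespace Block

/-- The output `Y` of the residual connection. -/
def Y (x : Block) : Mat x.n x.d := residual x.H x.X

/-- The gradient of the loss with respect to `Y`. -/
def gradY (x : Block) : Mat x.n x.d := grad (overallLoss x.loss) x.Y

/-- The loss as a function of the input `X` of the residual connection. -/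
def lossX (x : Block) : Mat x.n x.d → ℝ := fun A => overallLoss x.loss (residual x.H A)

/-- The gradient of the loss with respect to `X`. -/
def gradX (x : Block) : Mat x.n x.d := grad x.lossX x.X

/-- The sizes `n` and `d` are in the input, `d ≤ C log n`, and all maps are differentiable at the
points concerned. -/
structure Admissible (x : Block) (C : ℝ) : Prop where
  input_n : x.input.int (0, 0, 0, 0) = x.n
  input_d : x.input.int (0, 0, 0, 1) = x.d
  d_le : (x.d : ℝ) ≤ C * Real.log x.n
  diff_H : DifferentiableAt ℝ x.H x.X
  diff_loss : ∀ j k, DifferentiableAt ℝ (x.loss j k) x.Y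

/-- Whenever array `0` holds a matrix `G` that is equal or close to `dL/dY`, the program `P` leaves
`G · dH/dX` in array `1`, up to an error of `δ` in each entry (exactly, if `δ = 0`), and takes
at most `τ` steps. It may overwrite everything and makes no assumption on the other arrays. -/
def VJPRuns (x : Block) (prim : ℕ → ℝ → ℝ) (P : Prog) (τ δ : ℝ) : Prop :=
  ∀ (G : Mat x.n x.d) (σ : Store), ‖G - x.gradY‖ ≤ 1 → σ.HoldsMat 0 G →
    RunsIn prim x.input P σ τ fun σ' =>
      ∃ O : Mat x.n x.d, σ'.HoldsMat 1 O ∧ ‖O - vjp x.H x.X G‖ ≤ δ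

end Block

/-! ### The multi-layer transformer with both residual connections -/

/-- An `m`-layer transformer with sequence length `n` and hidden dimension `d`, with a loss, an
argument `X`, and a machine input. Layer `i` has the weights `WQ i`, `WK i`, `WV i`,
for `1 ≤ i ≤ m`, and `g i`, for `0 ≤ i ≤ m`, are the components other than attention. -/
structure Transformer where
  n : ℕ
  d : ℕ
  m : ℕ
  WQ : ℕ → Mat d d
  WK : ℕ → Mat d d
  WV : ℕ → Mat d d
  g : ℕ → Mat n d → Mat n d
  loss : Fin n → Fin d → Mat n d → ℝ
  X : Mat n d
  input : Input

namespace Transformer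

/-- Attention of layer `i` with its residual connection. -/
def attnBlock (x : Transformer) (i : ℕ) : Mat x.n x.d → Mat x.n x.d :=
  residual (attn (x.WQ i) (x.WK i) (x.WV i))

/-- Layer `i`: `A ↦ Z + g_i(Z)` with `Z = A + Attn_i(A)`. -/
def layer (x : Transformer) (i : ℕ) (A : Mat x.n x.d) : Mat x.n x.d :=
  residual (x.g i) (x.attnBlock i A)

/-- The composition of the layers `i + 1, …, i + s`. -/
def layers (x : Transformer) (i : ℕ) : ℕ → Mat x.n x.d → Mat x.n x.d
  | 0 => fun A => A
  | s + 1 => fun A => x.layer (i + s + 1) (x.layers i s A)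

/-- The whole model: `g_0`, then the layers `1, …, m`. -/
def model (x : Transformer) (A : Mat x.n x.d) : Mat x.n x.d := x.layers 0 x.m (x.g 0 A)

/-- The loss as a function of the argument of the model. -/
def totalLoss (x : Transformer) (A : Mat x.n x.d) : ℝ := overallLoss x.loss (x.model A)

/-- `T_i`, the output of layer `i`; `T_0 = g_0(X)`. -/
def T (x : Transformer) (i : ℕ) : Mat x.n x.d := x.layers 0 i (x.g 0 x.X)

/-- The point at which `g_i` is applied: `X` for `i = 0`, and
`Z_i = T_{i-1} + Attn_i(T_{i-1})` for `i ≥ 1`. -/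
def Z (x : Transformer) : ℕ → Mat x.n x.d
  | 0 => x.X
  | i + 1 => x.attnBlock (i + 1) (x.T i)

/-- The input of the machine holds the sizes, the weights, and the values from
the forward pass. All other input arrays may hold any data on `g_i` and on the loss. -/
structure Encoded (x : Transformer) : Prop where
  input_n : x.input.int (0, 0, 0, 0) = x.n
  input_d : x.input.int (0, 0, 0, 1) = x.d
  input_m : x.input.int (0, 0, 0, 2) = x.m
  input_T : ∀ i ≤ x.m, ∀ j k, x.input.real (0, i, (j : Fin x.n), (k : Fin x.d)) = x.T i j k
  input_Z : ∀ i ≤ x.m, ∀ j k, x.input.real (1, i, (j : Fin x.n), (k : Fin x.d)) = x.Z i j k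
  input_WQ : ∀ i, 1 ≤ i → i ≤ x.m →
    ∀ j k, x.input.real (2, i, (j : Fin x.d), (k : Fin x.d)) = x.WQ i j k
  input_WK : ∀ i, 1 ≤ i → i ≤ x.m →
    ∀ j k, x.input.real (3, i, (j : Fin x.d), (k : Fin x.d)) = x.WK i j k
  input_WV : ∀ i, 1 ≤ i → i ≤ x.m →
    ∀ j k, x.input.real (4, i, (j : Fin x.d), (k : Fin x.d)) = x.WV i j k

/-- Numerical assumptions, with `b` a polynomial bound for the entries of the matrices and `R` the
bound for the entries that enter the attention scores. -/
structure Bounded (x : Transformer) (b R : ℝ) : Prop where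
  WQ_le : ∀ i, 1 ≤ i → i ≤ x.m → ‖x.WQ i‖ ≤ b
  WK_le : ∀ i, 1 ≤ i → i ≤ x.m → ‖x.WK i‖ ≤ b
  WV_le : ∀ i, 1 ≤ i → i ≤ x.m → ‖x.WV i‖ ≤ b
  T_le : ∀ i < x.m, ‖x.T i‖ ≤ R
  TW_le : ∀ i < x.m, ‖x.T i * (x.WQ (i + 1) * (x.WK (i + 1)).transpose)‖ ≤ R
  jacobian_g : ∀ i ≤ x.m, JacobianBound (x.g i) (x.Z i) b
  grad_loss : ‖grad (overallLoss x.loss) (x.T x.m)‖ ≤ b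

/-- All maps are differentiable at the points concerned. -/
structure Smooth (x : Transformer) : Prop where
  diff_g : ∀ i ≤ x.m, DifferentiableAt ℝ (x.g i) (x.Z i)
  diff_loss : ∀ j k, DifferentiableAt ℝ (x.loss j k) (x.T x.m)

/-- The program `P` does the backward computation through `g_i`, for all `0 ≤ i ≤ m`: if index
register `0` holds `i` and array `0` holds `G`, then it leaves the product of `G` with the Jacobian
of `g_i` at its argument in array `1`, within `τ` steps. -/
def BackwardRuns (x : Transformer) (prim : ℕ → ℝ → ℝ) (P : Prog) (τ : ℝ) : Prop :=
  ∀ i ≤ x.m, ∀ (G : Mat x.n x.d) (σ : Store), σ.idx 0 = i → σ.HoldsMat 0 G →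
    RunsIn prim x.input P σ τ fun σ' => σ'.HoldsMat 1 (vjp (x.g i) (x.Z i) G)

/-- The program `P` leaves the gradient of the loss with respect to the last output `T_m`
in array `1`, within `τ` steps. -/
def LossGradientRuns (x : Transformer) (prim : ℕ → ℝ → ℝ) (P : Prog) (τ : ℝ) : Prop :=
  ∀ σ : Store, RunsIn prim x.input P σ τ fun σ' =>
    σ'.HoldsMat 1 (grad (overallLoss x.loss) (x.T x.m))

/-- The Jacobians between any two layers, `dT_{i+s} / dT_i`, have entries at most `b`. -/
def CrossLayerBound (x : Transformer) (b : ℝ) : Prop :=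
  ∀ i s, i + s ≤ x.m → JacobianBound (x.layers i s) (x.T i) b

end Transformer

end ResidualTransformer

end

/-! The chain rule is applied backwards. The derivative of `A ↦ A + H(A)` is the identity plus the
derivative of `H`, so its VJP sends `G` to `G` plus the VJP of `H` (`vjp_residual`). For one block
this is the whole algorithm: save `G`, run the given program, add. The additional time is
proportional to `(n + 1)(d + 1)`, and an error in `G` is amplified by at most `1 + n d n ^ c`, which
is below `n ^ K`.

In the transformer, only the VJP of attention is not supplied, and its direct evaluation takes
quadratic time. `vjp_attn` expresses it by the softmax matrix `f` and matrices with `d` columns. All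
scores are at most `r ≤ R ^ 2 = o(log n)`, so truncating the exponential series at a degree `g =
o(log n)` leaves a relative error `n ^ (1 - K)` with any prescribed constant `K`
(`Choice.abs_truncatedAttn_sub_le`, `IsDegree.le_log`). A truncated series of scalar products of
`d`-vectors is a sum over the monomials of degree at most `g` in `d = O(log n)` variables
(`Node.sum_list_mul`). A generating function shows that there are `n ^ o(1)` of them
(`Node.length_list_le`, `eventually_degree_length_le`). Hence the approximate attention matrix has
rank `n ^ o(1)` up to a scaling of its rows, and all sums can be reassociated so that no `n × n`
matrix is formed (`factored_backward`). The program computes `r` and searches for `g` itself, so it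
depends on neither `R` nor `M`.

An error `θ` of softmax causes an error of order `n ^ (11 c + 19) θ ‖G‖` in one layer. Bounding the
later propagation layer by layer would give a power growing with `m`. Instead every new error is
carried down by the exact Jacobian of the composition of the remaining layers, so that the errors of
different layers add up (`SmallError.step`). These Jacobians are polynomially bounded by assumption,
or because the number of layers is bounded (`Bounded.vjpBound`). Thus a constant `K`, depending on
`c`, `m₀` and `k`, suffices.

On the machine, the given programs are black boxes that may overwrite anything they name. But a
program names only finitely many registers and arrays (`Exec.agreeFrom`), and all data to be
preserved are placed above that bound. The remaining code is written in a small language of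
expressions and loops, whose compilation is verified once, together with a bound for the number of
steps (`Stmt.correct`); afterwards only functions on views are considered. -/

noncomputable section

namespace ResidualTransformer

/-! ### Rules for programs -/

/-- Started in `σ`, the program halts after at most `u` steps in a store that satisfies `post`. -/
def RunsWithin (prim : ℕ → ℝ → ℝ) (inp : Input) (P : Prog) (σ : Store) (u : ℕ)
    (post : Store → Prop) : Prop :=
  ∃ (σ' : Store) (t : ℕ), Exec prim inp P σ σ' t ∧ t ≤ u ∧ post σ'

section Rules

variable {prim : ℕ → ℝ → ℝ} {inp : Input}

theorem RunsWithin.mono {P : Prog} {σ : Store} {u w : ℕ} {p q : Store → Prop}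
    (h : RunsWithin prim inp P σ u p) (huw : u ≤ w) (hpq : ∀ σ', p σ' → q σ') :
    RunsWithin prim inp P σ w q := by
  obtain ⟨σ', t, he, ht, hp⟩ := h
  exact ⟨σ', t, he, ht.trans huw, hpq _ hp⟩

theorem RunsWithin.op {o : Op} {σ : Store} {q : Store → Prop} (h : q (o.run prim inp σ)) :
    RunsWithin prim inp (.op o) σ 1 q :=
  ⟨_, _, .op o σ, le_rfl, h⟩

theorem RunsWithin.skip {σ : Store} {q : Store → Prop} (h : q σ) :
    RunsWithin prim inp .skip σ 0 q :=
  ⟨_, _, .skip σ, le_rfl, h⟩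

theorem RunsWithin.seq {P Q : Prog} {σ : Store} {u w : ℕ} {p q : Store → Prop}
    (hP : RunsWithin prim inp P σ u p) (hQ : ∀ σ', p σ' → RunsWithin prim inp Q σ' w q) :
    RunsWithin prim inp (.seq P Q) σ (u + w) q := by
  obtain ⟨σ', t, he, ht, hp⟩ := hP
  obtain ⟨σ'', t', he', ht', hq⟩ := hQ σ' hp
  exact ⟨σ'', t + t', .seq he he', add_le_add ht ht', hq⟩

theorem RunsWithin.ite {b : Cond} {P Q : Prog} {σ : Store} {u : ℕ} {q : Store → Prop}
    (hP : b.Holds σ → RunsWithin prim inp P σ u q)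
    (hQ : ¬ b.Holds σ → RunsWithin prim inp Q σ u q) :
    RunsWithin prim inp (.ite b P Q) σ (u + 1) q := by
  by_cases hb : b.Holds σ
  · obtain ⟨σ', t, he, ht, hp⟩ := hP hb
    exact ⟨σ', t + 1, .iteTrue hb he, by omega, hp⟩
  · obtain ⟨σ', t, he, ht, hp⟩ := hQ hb
    exact ⟨σ', t + 1, .iteFalse hb he, by omega, hp⟩

/-- Induction on the number `r` of remaining rounds, for all starting points `t`, so that the
hypothesis applies to the store after the next round. The final `+ 1` pays for the test that fails.
-/
theorem RunsWithin.while_from {b : Cond} {P : Prog} {N : ℕ} {I : ℕ → Store → Prop} {u : ℕ → ℕ}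
    (hcond : ∀ t σ, I t σ → (b.Holds σ ↔ t < N))
    (hstep : ∀ t < N, ∀ σ, I t σ → RunsWithin prim inp P σ (u t) (I (t + 1))) :
    ∀ r t σ, t + r = N → I t σ →
      RunsWithin prim inp (.while b P) σ (∑ s ∈ Finset.range r, (u (t + s) + 1) + 1) (I N) := by
  intro r
  induction r with
  | zero =>
    intro t σ ht hI
    obtain rfl : t = N := by omega
    exact ⟨σ, 1, .whileFalse (by simp [hcond t σ hI]), by simp, hI⟩
  | succ r ih =>
    intro t σ ht hI
    obtain ⟨σ', t', he, ht', hI'⟩ := hstep t (by omega) σ hI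
    obtain ⟨σ'', t'', he', ht'', hI''⟩ := ih (t + 1) σ' (by omega) hI'
    refine ⟨σ'', t' + t'' + 1, .whileTrue ((hcond t σ hI).2 (by omega)) he he', ?_, hI''⟩
    -- The first round is split off, which shifts the summation index of the others by one.
    rw [Finset.sum_range_succ']
    have : ∀ s, t + 1 + s = t + (s + 1) := fun s => by omega
    simp only [this] at ht''
    simp only [add_zero]
    omega

/-- A loop that runs through `t = 0, …, N - 1` and has the invariant `I t`. -/
theorem RunsWithin.while {b : Cond} {P : Prog} {N : ℕ} {I : ℕ → Store → Prop} {u : ℕ → ℕ}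
    {σ : Store} (hcond : ∀ t σ, I t σ → (b.Holds σ ↔ t < N))
    (hstep : ∀ t < N, ∀ σ, I t σ → RunsWithin prim inp P σ (u t) (I (t + 1))) (h0 : I 0 σ) :
    RunsWithin prim inp (.while b P) σ (∑ s ∈ Finset.range N, (u s + 1) + 1) (I N) := by
  simpa using RunsWithin.while_from hcond hstep N 0 σ (by omega) h0

theorem RunsWithin.runsIn {P : Prog} {σ : Store} {u : ℕ} {τ : ℝ} {p q : Store → Prop}
    (h : RunsWithin prim inp P σ u p) (hu : (u : ℝ) ≤ τ) (hpq : ∀ σ', p σ' → q σ') :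
    RunsIn prim inp P σ τ q := by
  obtain ⟨σ', t, he, ht, hp⟩ := h
  exact ⟨σ', t, he, le_trans (by exact_mod_cast ht) hu, hpq _ hp⟩

theorem RunsIn.runsWithin {P : Prog} {σ : Store} {τ : ℝ} {p : Store → Prop}
    (h : RunsIn prim inp P σ τ p) : RunsWithin prim inp P σ ⌊τ⌋₊ p := by
  obtain ⟨σ', t, he, ht, hp⟩ := h
  exact ⟨σ', t, he, Nat.le_floor ht, hp⟩

end Rules

/-! ### A program does not touch registers and arrays with large numbers -/

/-- A bound for the numbers of the registers and arrays that an instruction may change. -/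
def Op.bound : Op → ℕ
  | .iconst a _ | .icopy a _ | .succ a | .pred a | .iload a _ _ _ _ | .istore a _ _ _ _
  | .iinput a _ _ _ _ | .rconst a _ | .rcopy a _ | .ofIdx a _ | .add a _ _ | .sub a _ _
  | .mul a _ _ | .div a _ _ | .prim a _ _ | .rload a _ _ _ _ | .rstore a _ _ _ _
  | .rinput a _ _ _ _ => a + 1

def Prog.bound : Prog → ℕ
  | .skip => 0
  | .op o => o.bound
  | .seq P Q => max P.bound Q.bound
  | .ite _ P Q => max P.bound Q.bound
  | .while _ P => P.bound

/-- The stores agree on the index registers and real arrays with numbers `≥ b`. -/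
def AgreeFrom (b : ℕ) (σ σ' : Store) : Prop :=
  (∀ r, b ≤ r → σ'.idx r = σ.idx r) ∧
    ∀ A, b ≤ A → ∀ i j k, σ'.real (A, i, j, k) = σ.real (A, i, j, k)

theorem Op.agreeFrom (prim : ℕ → ℝ → ℝ) (inp : Input) (o : Op) (σ : Store) {b : ℕ}
    (hb : o.bound ≤ b) : AgreeFrom b σ (o.run prim inp σ) := by
  cases o <;> simp only [Op.bound] at hb <;>
    refine ⟨fun r hr => ?_, fun A hA i j k => ?_⟩ <;>
    simp only [Op.run, Store.setIdx, Store.setReg, Store.addr, Function.update_apply,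
      Prod.mk.injEq] <;>
    rw [if_neg (by omega)]

/-- Array numbers and register numbers are part of the program text; only the position inside an
array is computed. So the writes of a program stay below a bound visible in the text, however often
a loop runs. Real registers and arrays of naturals are left out, as nothing is kept there across a
call of foreign code. -/
theorem Exec.agreeFrom {prim : ℕ → ℝ → ℝ} {inp : Input} {P : Prog} {σ σ' : Store} {t b : ℕ}
    (h : Exec prim inp P σ σ' t) (hb : P.bound ≤ b) : AgreeFrom b σ σ' := by
  induction h with
  | skip σ => exact ⟨fun _ _ => rfl, fun _ _ _ _ _ => rfl⟩
  | op o σ => exact o.agreeFrom prim inp σ hb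
  | seq _ _ ih₁ ih₂ =>
    simp only [Prog.bound, max_le_iff] at hb
    have h1 := ih₁ hb.1
    have h2 := ih₂ hb.2
    exact ⟨fun r hr => (h2.1 r hr).trans (h1.1 r hr),
      fun A hA i j k => (h2.2 A hA i j k).trans (h1.2 A hA i j k)⟩
  | iteTrue _ _ ih =>
    simp only [Prog.bound, max_le_iff] at hb
    exact ih hb.1
  | iteFalse _ _ ih =>
    simp only [Prog.bound, max_le_iff] at hb
    exact ih hb.2
  | whileTrue _ _ _ ih₁ ih₂ =>
    have h1 := ih₁ hb
    have h2 := ih₂ hb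
    exact ⟨fun r hr => (h2.1 r hr).trans (h1.1 r hr),
      fun A hA i j k => (h2.2 A hA i j k).trans (h1.2 A hA i j k)⟩
  | whileFalse _ => exact ⟨fun _ _ => rfl, fun _ _ _ _ _ => rfl⟩

theorem RunsWithin.agreeFrom {prim : ℕ → ℝ → ℝ} {inp : Input} {P : Prog} {σ : Store} {u b : ℕ}
    {p : Store → Prop} (h : RunsWithin prim inp P σ u p) (hb : P.bound ≤ b) :
    RunsWithin prim inp P σ u fun σ' => p σ' ∧ AgreeFrom b σ σ' := by
  obtain ⟨σ', t, he, ht, hp⟩ := h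
  exact ⟨σ', t, he, ht, hp, he.agreeFrom hb⟩

/-! ### A small language with loops and array assignments -/

/-- The part of a store that the statements of the language work on. -/
structure View where
  idx : ℕ → ℕ
  real : Arrays ℝ

def View.setIdx (s : View) (v t : ℕ) : View := { s with idx := Function.update s.idx v t }

@[simp] theorem View.setIdx_real (s : View) (v t : ℕ) : (s.setIdx v t).real = s.real := rfl

theorem View.setIdx_idx (s : View) (v t w : ℕ) :
    (s.setIdx v t).idx w = if w = v then t else s.idx w := by
  simp [View.setIdx, Function.update_apply]

/-- The largest absolute value of `f 0, …, f (N - 1)`. -/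
def supAbs (f : ℕ → ℝ) : ℕ → ℝ
  | 0 => 0
  | N + 1 => max (supAbs f N) |f N|

/-- Real expressions. Array indices and the bounds of `sum` and `sup` are variables. -/
inductive Expr where
  | const (v : ℕ)
  | ofIdx (v : ℕ)
  | arr (A i j k : ℕ)
  | inp (A i j k : ℕ)
  | add (e f : Expr)
  | sub (e f : Expr)
  | mul (e f : Expr)
  | div (e f : Expr)
  | sum (v N : ℕ) (e : Expr)
  | sup (v N : ℕ) (e : Expr)

namespace Expr

def eval (inp : Input) : Expr → View → ℝ
  | const v, _ => v
  | ofIdx v, s => s.idx v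
  | arr A i j k, s => s.real (A, s.idx i, s.idx j, s.idx k)
  | .inp A i j k, s => inp.real (A, s.idx i, s.idx j, s.idx k)
  | add e f, s => e.eval inp s + f.eval inp s
  | sub e f, s => e.eval inp s - f.eval inp s
  | mul e f, s => e.eval inp s * f.eval inp s
  | div e f, s => e.eval inp s / f.eval inp s
  | sum v N e, s => ∑ t ∈ Finset.range (s.idx N), e.eval inp (s.setIdx v t)
  | sup v N e, s => supAbs (fun t => e.eval inp (s.setIdx v t)) (s.idx N)

/-- The number of steps for the evaluation of an expression. -/
def cost : Expr → View → ℕ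
  | const _, _ | ofIdx _, _ | arr _ _ _ _, _ | .inp _ _ _ _, _ => 1
  | add e f, s | sub e f, s | mul e f, s | div e f, s => e.cost s + f.cost s + 1
  | sum v N e, s => ∑ t ∈ Finset.range (s.idx N), (e.cost (s.setIdx v t) + 10) + 10
  | sup v N e, s => ∑ t ∈ Finset.range (s.idx N), (e.cost (s.setIdx v t) + 10) + 10

end Expr

/-- The number of the array of the machine that represents array `a`, if the arrays with numbers in
`[2, b)` are not available. -/
def arrNo (b a : ℕ) : ℕ := if a < 2 then a else b + a

theorem arrNo_inj {b a a' : ℕ} : arrNo b a = arrNo b a' ↔ a = a' := by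
  unfold arrNo
  split_ifs <;> omega

/-- The program `c := 0; while c < B do v := c; P; c := c + 1`. -/
def forProg (c B v : ℕ) (P : Prog) : Prog :=
  .seq (.op (.iconst c 0)) (.while (.ilt c B)
    (.seq (.op (.icopy v c)) (.seq P (.op (.succ c)))))

/-- The program that evaluates an expression into register `p`. It uses the registers `≥ p`, and
for its own purposes only odd multiples of index registers above `b`. -/
def Expr.compile (b : ℕ) : Expr → ℕ → Prog
  | .const v, p => .op (.rconst p v)
  | .ofIdx v, p => .op (.ofIdx p (b + 2 * v))
  | .arr A i j k, p => .op (.rload p (arrNo b A) (b + 2 * i) (b + 2 * j) (b + 2 * k))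
  | .inp A i j k, p => .op (.rinput p A (b + 2 * i) (b + 2 * j) (b + 2 * k))
  | .add e f, p => .seq (e.compile b p) (.seq (f.compile b (p + 1)) (.op (.add p p (p + 1))))
  | .sub e f, p => .seq (e.compile b p) (.seq (f.compile b (p + 1)) (.op (.sub p p (p + 1))))
  | .mul e f, p => .seq (e.compile b p) (.seq (f.compile b (p + 1)) (.op (.mul p p (p + 1))))
  | .div e f, p => .seq (e.compile b p) (.seq (f.compile b (p + 1)) (.op (.div p p (p + 1))))
  | .sum v N e, p =>
    -- The private index registers with scratch numbers `p`, `p + 1`, `p + 2` hold the counter, the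
    -- bound of the loop and the old value of `v`. The body therefore starts at `p + 3`, while the
    -- real register `p` accumulates.
    .seq (.op (.icopy (b + 2 * (p + 2) + 1) (b + 2 * v)))
    (.seq (.op (.icopy (b + 2 * (p + 1) + 1) (b + 2 * N)))
    (.seq (.op (.rconst p 0))
    (.seq (forProg (b + 2 * p + 1) (b + 2 * (p + 1) + 1) (b + 2 * v)
      (.seq (e.compile b (p + 3)) (.op (.add p p (p + 3)))))
    (.op (.icopy (b + 2 * v) (b + 2 * (p + 2) + 1))))))
  | .sup v N e, p =>
    .seq (.op (.icopy (b + 2 * (p + 2) + 1) (b + 2 * v)))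
    (.seq (.op (.icopy (b + 2 * (p + 1) + 1) (b + 2 * N)))
    (.seq (.op (.rconst p 0))
    (.seq (forProg (b + 2 * p + 1) (b + 2 * (p + 1) + 1) (b + 2 * v)
      (.seq (e.compile b (p + 3))
      -- Absolute values are obtained by comparing the maximum so far with the new value and with
      -- its negative.
      (.seq (.ite (.rlt p (p + 3)) (.op (.rcopy p (p + 3))) .skip)
      (.seq (.op (.rconst (p + 4) 0))
      (.seq (.op (.sub (p + 4) (p + 4) (p + 3)))
      (.ite (.rlt p (p + 4)) (.op (.rcopy p (p + 4))) .skip))))))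
    (.op (.icopy (b + 2 * v) (b + 2 * (p + 2) + 1))))))

/-- The store `σ` represents the view `s`. -/
structure Rep (b : ℕ) (σ : Store) (s : View) : Prop where
  idx : ∀ v, σ.idx (b + 2 * v) = s.idx v
  real : ∀ A i j k, σ.real (arrNo b A, i, j, k) = s.real (A, i, j, k)

/-- Nothing is changed that belongs to the scratch registers below `p`. -/
def Keeps (b p : ℕ) (σ σ' : Store) : Prop :=
  ∀ q < p, σ'.reg q = σ.reg q ∧ σ'.idx (b + 2 * q + 1) = σ.idx (b + 2 * q + 1)

theorem Keeps.trans {b p q : ℕ} {σ σ' σ'' : Store} (h : Keeps b p σ σ') (h' : Keeps b q σ' σ'')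
    (hpq : p ≤ q) : Keeps b p σ σ'' := fun r hr =>
  ⟨((h' r (hr.trans_le hpq)).1).trans (h r hr).1, ((h' r (hr.trans_le hpq)).2).trans (h r hr).2⟩

theorem Rep.setIdx {b : ℕ} {σ : Store} {s : View} (h : Rep b σ s) (v t : ℕ) :
    Rep b (σ.setIdx (b + 2 * v) t) (s.setIdx v t) := by
  refine ⟨fun w => ?_, fun A i j k => h.real A i j k⟩
  simp only [Store.setIdx, View.setIdx, Function.update_apply, h.idx]
  by_cases hw : w = v
  · simp [hw]
  · rw [if_neg (by omega), if_neg hw]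

theorem Rep.setIdx_odd {b : ℕ} {σ : Store} {s : View} (h : Rep b σ s) (q t : ℕ) :
    Rep b (σ.setIdx (b + 2 * q + 1) t) s := by
  refine ⟨fun w => ?_, fun A i j k => h.real A i j k⟩
  simp only [Store.setIdx, Function.update_apply, h.idx]
  rw [if_neg (by omega)]

theorem Rep.setReg {b : ℕ} {σ : Store} {s : View} (h : Rep b σ s) (q : ℕ) (t : ℝ) :
    Rep b (σ.setReg q t) s :=
  ⟨fun w => h.idx w, fun A i j k => h.real A i j k⟩

theorem Keeps.setIdx {b p v t : ℕ} {σ σ' : Store} (h : Keeps b p σ σ') :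
    Keeps b p σ (σ'.setIdx (b + 2 * v) t) := by
  intro q hq
  refine ⟨(h q hq).1, ?_⟩
  simp only [Store.setIdx, Function.update_apply]
  rw [if_neg (by omega), (h q hq).2]

theorem Keeps.setIdx_odd {b p v t : ℕ} {σ σ' : Store} (h : Keeps b p σ σ') (hv : p ≤ v) :
    Keeps b p σ (σ'.setIdx (b + 2 * v + 1) t) := by
  intro q hq
  refine ⟨(h q hq).1, ?_⟩
  simp only [Store.setIdx, Function.update_apply]
  rw [if_neg (by omega), (h q hq).2]

theorem Keeps.setReg {b p v : ℕ} {t : ℝ} {σ σ' : Store} (h : Keeps b p σ σ') (hv : p ≤ v) :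
    Keeps b p σ (σ'.setReg v t) := by
  intro q hq
  refine ⟨?_, (h q hq).2⟩
  simp only [Store.setReg, Function.update_apply]
  rw [if_neg (by omega), (h q hq).1]

theorem Keeps.refl (b p : ℕ) (σ : Store) : Keeps b p σ σ := fun _ _ => ⟨rfl, rfl⟩

@[simp] theorem Store.setIdx_reg (σ : Store) (a v : ℕ) : (σ.setIdx a v).reg = σ.reg := rfl
@[simp] theorem Store.setReg_idx (σ : Store) (a : ℕ) (v : ℝ) : (σ.setReg a v).idx = σ.idx := rfl

theorem Store.setIdx_idx (σ : Store) (a v w : ℕ) :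
    (σ.setIdx a v).idx w = if w = a then v else σ.idx w := by
  simp [Store.setIdx, Function.update_apply]

theorem Store.setReg_reg (σ : Store) (a : ℕ) (v : ℝ) (w : ℕ) :
    (σ.setReg a v).reg w = if w = a then v else σ.reg w := by
  simp [Store.setReg, Function.update_apply]

@[simp] theorem View.setIdx_setIdx (s : View) (v t t' : ℕ) :
    (s.setIdx v t).setIdx v t' = s.setIdx v t' := by
  simp [View.setIdx]

@[simp] theorem View.setIdx_self (s : View) (v : ℕ) : s.setIdx v (s.idx v) = s := by
  simp [View.setIdx]

/-- The rule for the loops of compiled programs. The body `P` starts with the value `t` of the loop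
variable and turns a store that represents `f t` into one that represents `f (t + 1)`, while
`I t` holds for the registers. -/
theorem RunsWithin.forProg {prim : ℕ → ℝ → ℝ} {inp : Input} {b p v N : ℕ} {P : Prog}
    {f : ℕ → View} {I : ℕ → Store → Prop} {u : ℕ → ℕ} {σ : Store}
    (hI : ∀ t σ q w, I t σ → I t (σ.setIdx q w))
    (hP : ∀ t < N, ∀ σ, Rep b σ ((f t).setIdx v t) → I t σ →
      RunsWithin prim inp P σ (u t) fun σ' =>
        (∃ w, Rep b σ' ((f (t + 1)).setIdx v w)) ∧ I (t + 1) σ' ∧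
          (∀ q < p + 3, σ'.idx (b + 2 * q + 1) = σ.idx (b + 2 * q + 1)) ∧
          ∀ q < p, σ'.reg q = σ.reg q)
    (hB : σ.idx (b + 2 * (p + 1) + 1) = N) (h0 : Rep b σ (f 0)) (hI0 : I 0 σ) :
    RunsWithin prim inp (forProg (b + 2 * p + 1) (b + 2 * (p + 1) + 1) (b + 2 * v) P) σ
      (∑ t ∈ Finset.range N, (u t + 3) + 2)
      fun σ' => (∃ w, Rep b σ' ((f N).setIdx v w)) ∧ I N σ' ∧
        σ'.idx (b + 2 * (p + 2) + 1) = σ.idx (b + 2 * (p + 2) + 1) ∧ Keeps b p σ σ' := by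
  have key : RunsWithin prim inp (.while (.ilt (b + 2 * p + 1) (b + 2 * (p + 1) + 1))
      (.seq (.op (.icopy (b + 2 * v) (b + 2 * p + 1))) (.seq P (.op (.succ (b + 2 * p + 1))))))
      (σ.setIdx (b + 2 * p + 1) 0) (∑ t ∈ Finset.range N, ((1 + (u t + 1)) + 1) + 1)
      (fun σ' => (∃ w, Rep b σ' ((f N).setIdx v w)) ∧ I N σ' ∧
        σ'.idx (b + 2 * (p + 2) + 1) = σ.idx (b + 2 * (p + 2) + 1) ∧
        σ'.idx (b + 2 * (p + 1) + 1) = N ∧ σ'.idx (b + 2 * p + 1) = N ∧ Keeps b p σ σ') := by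
    -- The body may leave any value `w` in the loop variable, because each round sets it again from
    -- the private counter. So between rounds the view is determined only up to the variable `v`.
    refine RunsWithin.while (I := fun t σ' => (∃ w, Rep b σ' ((f t).setIdx v w)) ∧ I t σ' ∧
        σ'.idx (b + 2 * (p + 2) + 1) = σ.idx (b + 2 * (p + 2) + 1) ∧
        σ'.idx (b + 2 * (p + 1) + 1) = N ∧ σ'.idx (b + 2 * p + 1) = t ∧ Keeps b p σ σ') ?_ ?_ ?_
    · rintro t σ' ⟨-, -, -, h1, h2, -⟩
      simp only [Cond.Holds, h1, h2]
    · rintro t ht σ' ⟨⟨w, hrep⟩, hIt, hS, hB', hc, hk⟩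
      refine RunsWithin.seq (p := fun τ => τ = σ'.setIdx (b + 2 * v) t) (RunsWithin.op ?_) ?_
      · simp [Op.run, hc]
      rintro τ rfl
      have hrep' := hrep.setIdx v t
      rw [View.setIdx_setIdx] at hrep'
      refine RunsWithin.seq (hP t ht _ hrep' (hI _ _ _ _ hIt)) ?_
      rintro τ ⟨⟨w', hw'⟩, hIτ, hidx, hreg⟩
      have hidx' : ∀ q < p + 3, τ.idx (b + 2 * q + 1) = σ'.idx (b + 2 * q + 1) := by
        intro q hq
        rw [hidx q hq, Store.setIdx_idx, if_neg (by omega)]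
      refine RunsWithin.op ?_
      simp only [Op.run]
      refine ⟨⟨w', hw'.setIdx_odd _ _⟩, hI _ _ _ _ hIτ, ?_, ?_, ?_, Keeps.setIdx_odd ?_ le_rfl⟩
      · rw [Store.setIdx_idx, if_neg (by omega), hidx' _ (by omega), hS]
      · rw [Store.setIdx_idx, if_neg (by omega), hidx' _ (by omega), hB']
      · rw [Store.setIdx_idx, if_pos rfl, hidx' _ (by omega), hc]
      · intro q hq
        exact ⟨(hreg q hq).trans (hk q hq).1, (hidx' q (by omega)).trans (hk q hq).2⟩
    · refine ⟨⟨(f 0).idx v, ?_⟩, hI _ _ _ _ hI0, ?_, ?_, ?_, ?_⟩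
      · rw [View.setIdx_self]; exact h0.setIdx_odd _ _
      · rw [Store.setIdx_idx, if_neg (by omega)]
      · rw [Store.setIdx_idx, if_neg (by omega), hB]
      · rw [Store.setIdx_idx, if_pos rfl]
      · exact (Keeps.refl b p σ).setIdx_odd le_rfl
  refine (RunsWithin.seq (p := fun τ => τ = σ.setIdx (b + 2 * p + 1) 0)
    (RunsWithin.op (by simp [Op.run])) (by rintro τ rfl; exact key)).mono ?_ ?_
  · have : ∀ t, 1 + (u t + 1) + 1 = u t + 3 := fun t => by omega
    simp only [this]; omega
  · rintro σ' ⟨h1, h2, h3, -, -, h4⟩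
    exact ⟨h1, h2, h3, h4⟩

theorem View.setIdx_restore (s : View) (v t : ℕ) : (s.setIdx v t).setIdx v (s.idx v) = s := by
  simp

/-- The specification of a compiled expression. -/
def Expr.Correct (prim : ℕ → ℝ → ℝ) (inp : Input) (b : ℕ) (e : Expr) : Prop :=
  ∀ (p : ℕ) (σ : Store) (s : View), Rep b σ s →
    RunsWithin prim inp (e.compile b p) σ (e.cost s) fun σ' =>
      Rep b σ' s ∧ σ'.reg p = e.eval inp s ∧ Keeps b p σ σ'

/-- The first operand survives in register `p` because the evaluation of the second one uses scratch
numbers from `p + 1` on. -/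
theorem Expr.correct_binop {prim : ℕ → ℝ → ℝ} {inp : Input} {b p : ℕ} {e f : Expr} {o : Op}
    {g : ℝ → ℝ → ℝ} (he : e.Correct prim inp b) (hf : f.Correct prim inp b)
    (ho : ∀ σ, o.run prim inp σ = σ.setReg p (g (σ.reg p) (σ.reg (p + 1)))) {σ : Store} {s : View}
    (hσ : Rep b σ s) :
    RunsWithin prim inp (.seq (e.compile b p) (.seq (f.compile b (p + 1)) (.op o))) σ
      (e.cost s + f.cost s + 1) fun σ' =>
      Rep b σ' s ∧ σ'.reg p = g (e.eval inp s) (f.eval inp s) ∧ Keeps b p σ σ' := by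
  refine (RunsWithin.seq (he p σ s hσ) fun σ₁ h₁ => RunsWithin.seq (hf (p + 1) σ₁ s h₁.1)
    fun σ₂ h₂ => RunsWithin.op (q := fun σ' => Rep b σ' s ∧
      σ'.reg p = g (e.eval inp s) (f.eval inp s) ∧ Keeps b p σ σ') ?_).mono (by omega)
    fun _ h => h
  rw [ho]
  refine ⟨h₂.1.setReg _ _, ?_, (h₁.2.2.trans h₂.2.2 (by omega)).setReg le_rfl⟩
  rw [Store.setReg_reg, if_pos rfl, h₂.2.1, (h₂.2.2 p (by omega)).1, h₁.2.1]

/-- The specification of the loops in compiled expressions. -/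
theorem Expr.correct_loop {prim : ℕ → ℝ → ℝ} {inp : Input} {b p v N : ℕ} {e : Expr} {P : Prog}
    {acc : ℕ → ℝ} {s : View} (he : e.Correct prim inp b)
    (h0 : acc 0 = 0)
    (hP : ∀ t σ, σ.reg p = acc t → σ.reg (p + 3) = e.eval inp (s.setIdx v t) →
      RunsWithin prim inp P σ 6 fun σ' => σ'.idx = σ.idx ∧ σ'.real = σ.real ∧
        σ'.reg p = acc (t + 1) ∧ ∀ q < p, σ'.reg q = σ.reg q) {σ : Store}
    (hσ : Rep b σ s) :
    RunsWithin prim inp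
      (.seq (.op (.icopy (b + 2 * (p + 2) + 1) (b + 2 * v)))
      (.seq (.op (.icopy (b + 2 * (p + 1) + 1) (b + 2 * N)))
      (.seq (.op (.rconst p 0))
      (.seq (_root_.ResidualTransformer.forProg (b + 2 * p + 1) (b + 2 * (p + 1) + 1) (b + 2 * v)
        (.seq (e.compile b (p + 3)) P))
      (.op (.icopy (b + 2 * v) (b + 2 * (p + 2) + 1))))))) σ
      (∑ t ∈ Finset.range (s.idx N), (e.cost (s.setIdx v t) + 10) + 10) fun σ' =>
      Rep b σ' s ∧ σ'.reg p = acc (s.idx N) ∧ Keeps b p σ σ' := by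
  set σ₀ : Store := ((σ.setIdx (b + 2 * (p + 2) + 1) (s.idx v)).setIdx (b + 2 * (p + 1) + 1)
    (s.idx N)).setReg p 0 with hσ₀
  have hrep : Rep b σ₀ s := ((hσ.setIdx_odd _ _).setIdx_odd _ _).setReg _ _
  have hkeep : Keeps b p σ σ₀ :=
    (((Keeps.refl b p σ).setIdx_odd (by omega)).setIdx_odd (by omega)).setReg le_rfl
  have hloop := RunsWithin.forProg (prim := prim) (inp := inp) (b := b) (p := p) (v := v)
    (N := s.idx N) (P := .seq (e.compile b (p + 3)) P) (f := fun _ => s)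
    (I := fun t σ => σ.reg p = acc t) (u := fun t => e.cost (s.setIdx v t) + 6) (σ := σ₀)
    (fun t σ q w h => by simpa using h)
    (fun t ht σ hr hacc => by
      refine RunsWithin.seq (he (p + 3) σ _ hr) ?_
      rintro σ₁ ⟨h1, h2, h3⟩
      refine (hP t σ₁ ((h3 p (by omega)).1.trans hacc) h2).mono le_rfl ?_
      rintro σ₂ ⟨g1, g2, g3, g4⟩
      refine ⟨⟨t, ⟨fun w => by rw [g1, h1.idx], fun A i j k => by rw [g2, h1.real]⟩⟩, g3,
        fun q hq => by rw [g1, (h3 q hq).2], fun q hq => by rw [g4 q hq, (h3 q (by omega)).1]⟩)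
    (by simp [hσ₀, Store.setIdx_idx]) hrep (by simp [hσ₀, Store.setReg_reg, h0])
  refine (RunsWithin.seq (p := fun τ => τ = σ.setIdx (b + 2 * (p + 2) + 1) (s.idx v))
    (RunsWithin.op (by simp [Op.run, hσ.idx])) ?_).mono (u := 1 + (1 + (1 +
      (∑ t ∈ Finset.range (s.idx N), (e.cost (s.setIdx v t) + 6 + 3) + 2 + 1)))) ?_
    fun σ' h => h
  · rintro τ rfl
    refine RunsWithin.seq (p := fun τ => τ = (σ.setIdx (b + 2 * (p + 2) + 1) (s.idx v)).setIdx
      (b + 2 * (p + 1) + 1) (s.idx N)) (RunsWithin.op ?_) ?_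
    · simp only [Op.run]
      rw [(hσ.setIdx_odd _ _).idx]
    rintro τ rfl
    refine RunsWithin.seq (p := fun τ => τ = σ₀) (RunsWithin.op ?_) ?_
    · simp [Op.run, hσ₀]
    rintro τ rfl
    refine RunsWithin.seq hloop ?_
    rintro τ ⟨⟨w, hw⟩, h2, h3, h4⟩
    refine RunsWithin.op ?_
    have hS : τ.idx (b + 2 * (p + 2) + 1) = s.idx v := by
      rw [h3, hσ₀]; simp [Store.setIdx_idx]
    simp only [Op.run, hS]
    refine ⟨?_, h2, (hkeep.trans h4 le_rfl).setIdx⟩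
    have := hw.setIdx v (s.idx v)
    rwa [View.setIdx_restore] at this
  -- Besides the evaluation, a round takes at most six steps for the accumulation and three for
  -- copying the counter, incrementing it and the test; `cost` allows ten.
  · have : ∀ t, e.cost (s.setIdx v t) + 6 + 3 = e.cost (s.setIdx v t) + 9 := fun t => by omega
    simp only [this]
    have h2 := Finset.sum_le_sum (s := Finset.range (s.idx N))
      (f := fun t => e.cost (s.setIdx v t) + 9) (g := fun t => e.cost (s.setIdx v t) + 10)
      (fun t _ => by simp)
    omega

/-- Structural induction. Sums and suprema are the same loop with different accumulators: partial
sums, and running maxima of absolute values. -/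
theorem Expr.correct (prim : ℕ → ℝ → ℝ) (inp : Input) (b : ℕ) (e : Expr) :
    e.Correct prim inp b := by
  induction e with
  | const v =>
    intro p σ s h
    refine RunsWithin.op ?_
    exact ⟨h.setReg _ _, by simp [Op.run, Store.setReg_reg, eval],
      (Keeps.refl b p σ).setReg le_rfl⟩
  | ofIdx v =>
    intro p σ s h
    refine RunsWithin.op ?_
    exact ⟨h.setReg _ _, by simp [Op.run, Store.setReg_reg, eval, h.idx],
      (Keeps.refl b p σ).setReg le_rfl⟩
  | arr A i j k =>
    intro p σ s h
    refine RunsWithin.op ?_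
    exact ⟨h.setReg _ _, by simp [Op.run, Store.setReg_reg, eval, Store.addr, h.idx, h.real],
      (Keeps.refl b p σ).setReg le_rfl⟩
  | inp A i j k =>
    intro p σ s h
    refine RunsWithin.op ?_
    exact ⟨h.setReg _ _, by simp [Op.run, Store.setReg_reg, eval, Store.addr, h.idx],
      (Keeps.refl b p σ).setReg le_rfl⟩
  | add e f he hf =>
    intro p σ s h
    exact correct_binop (g := fun x y => x + y) he hf (fun σ => rfl) h
  | sub e f he hf =>
    intro p σ s h
    exact correct_binop (g := fun x y => x - y) he hf (fun σ => rfl) h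
  | mul e f he hf =>
    intro p σ s h
    exact correct_binop (g := fun x y => x * y) he hf (fun σ => rfl) h
  | div e f he hf =>
    intro p σ s h
    exact correct_binop (g := fun x y => x / y) he hf (fun σ => rfl) h
  | sum v N e he =>
    intro p σ s h
    refine correct_loop (acc := fun t => ∑ t' ∈ Finset.range t, e.eval inp (s.setIdx v t'))
      he (by simp) ?_ h
    intro t σ h1 h2
    refine (RunsWithin.op ?_).mono (by norm_num) fun σ' h => h
    refine ⟨rfl, rfl, ?_, fun q hq => ?_⟩
    · simp [Op.run, Store.setReg_reg, h1, h2, Finset.sum_range_succ]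
    · simp only [Op.run, Store.setReg_reg]
      rw [if_neg (by omega)]
  | sup v N e he =>
    intro p σ s h
    refine correct_loop (acc := supAbs fun t' => e.eval inp (s.setIdx v t')) he rfl ?_ h
    intro t σ h1 h2
    have hm : ∀ (q : ℕ) (σ : Store), q ≠ p → RunsWithin prim inp
        (.ite (.rlt p q) (.op (.rcopy p q)) .skip) σ 2
        (fun σ' => σ' = σ.setReg p (max (σ.reg p) (σ.reg q))) := by
      intro q σ hq
      refine RunsWithin.ite (u := 1) (fun h => RunsWithin.op ?_)
        (fun h => (RunsWithin.skip ?_).mono (by norm_num) fun _ h => h)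
      · simp only [Cond.Holds] at h
        rw [max_eq_right h.le]; rfl
      · simp only [Cond.Holds, not_lt] at h
        rw [max_eq_left h]; simp [Store.setReg]
    refine (RunsWithin.seq (hm (p + 3) σ (by omega)) ?_).mono (u := 2 + (1 + (1 + 2))) le_rfl
      fun σ' h => h
    rintro τ rfl
    refine RunsWithin.seq (p := fun τ => τ = (σ.setReg p (max (σ.reg p) (σ.reg (p + 3)))).setReg
      (p + 4) 0) (RunsWithin.op (by simp [Op.run])) ?_
    rintro τ rfl
    refine RunsWithin.seq (p := fun τ => τ = (σ.setReg p (max (σ.reg p) (σ.reg (p + 3)))).setReg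
      (p + 4) (-σ.reg (p + 3))) (RunsWithin.op ?_) ?_
    · simp [Op.run, Store.setReg]
    rintro τ rfl
    refine (hm (p + 4) _ (by omega)).mono le_rfl ?_
    rintro τ rfl
    refine ⟨rfl, rfl, ?_, fun q hq => ?_⟩
    · simp only [Store.setReg_reg, h1, h2, supAbs]
      simp [abs, max_assoc]
    · simp only [Store.setReg_reg]
      rw [if_neg (by omega), if_neg (by omega), if_neg (by omega)]

/-! ### Statements -/

def View.setReal (s : View) (x : ℕ × ℕ × ℕ × ℕ) (y : ℝ) : View :=
  { s with real := Function.update s.real x y }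

/-- Statements. The loop `for v N S` runs `S` for the values `0, …, N - 1` of the variable `v` and
restores the old value of `v` in the end. -/
inductive Stmt where
  | asn (A i j k : ℕ) (e : Expr)
  | iconst (v c : ℕ)
  | icopy (v w : ℕ)
  | isucc (v : ℕ)
  | ipred (v : ℕ)
  | iinp (v A i j k : ℕ)
  | seq (S T : Stmt)
  | ifLt (e f : Expr) (S : Stmt)
  | loop (v N : ℕ) (S : Stmt)

namespace Stmt

def run (inp : Input) : Stmt → View → View
  | asn A i j k e, s => s.setReal (A, s.idx i, s.idx j, s.idx k) (e.eval inp s)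
  | iconst v c, s => s.setIdx v c
  | icopy v w, s => s.setIdx v (s.idx w)
  | isucc v, s => s.setIdx v (s.idx v + 1)
  | ipred v, s => s.setIdx v (s.idx v - 1)
  | iinp v A i j k, s => s.setIdx v (inp.int (A, s.idx i, s.idx j, s.idx k))
  | seq S T, s => T.run inp (S.run inp s)
  | ifLt e f S, s => open Classical in if e.eval inp s < f.eval inp s then S.run inp s else s
  | .loop v N S, s =>
    View.setIdx (Nat.rec s (fun t s' => S.run inp (s'.setIdx v t)) (s.idx N)) v (s.idx v)

/-- The state after `t` rounds of a loop. -/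
def rounds (inp : Input) (S : Stmt) (v : ℕ) (s : View) : ℕ → View
  | 0 => s
  | t + 1 => S.run inp ((rounds inp S v s t).setIdx v t)

/-- `run` must use a recursor inside its own structural recursion; `rounds` gives the intermediate
views a name for which invariants can be stated. -/
theorem run_for (inp : Input) (v N : ℕ) (S : Stmt) (s : View) :
    (Stmt.loop v N S).run inp s = (rounds inp S v s (s.idx N)).setIdx v (s.idx v) := by
  have h : ∀ t, (Nat.rec s (fun t s' => S.run inp (s'.setIdx v t)) t : View) =
      rounds inp S v s t := by
    intro t
    induction t with
    | zero => rfl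
    | succ t ih => simp only [rounds, ← ih]
  simp only [run, h]

/-- The number of steps of a statement. -/
def cost (inp : Input) : Stmt → View → ℕ
  | asn _ _ _ _ e, s => e.cost s + 1
  | iconst _ _, _ | icopy _ _, _ | isucc _, _ | ipred _, _ | iinp _ _ _ _ _, _ => 1
  | seq S T, s => S.cost inp s + T.cost inp (S.run inp s)
  | ifLt e f S, s =>
    e.cost s + f.cost s + 1 + open Classical in if e.eval inp s < f.eval inp s then S.cost inp s else 0
  | .loop v N S, s =>
    ∑ t ∈ Finset.range (s.idx N), (S.cost inp ((rounds inp S v s t).setIdx v t) + 10) + 10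

def compile (b : ℕ) : Stmt → ℕ → Prog
  | asn A i j k e, p =>
    .seq (e.compile b p) (.op (.rstore (arrNo b A) (b + 2 * i) (b + 2 * j) (b + 2 * k) p))
  | iconst v c, _ => .op (.iconst (b + 2 * v) c)
  | icopy v w, _ => .op (.icopy (b + 2 * v) (b + 2 * w))
  | isucc v, _ => .op (.succ (b + 2 * v))
  | ipred v, _ => .op (.pred (b + 2 * v))
  | iinp v A i j k, _ => .op (.iinput (b + 2 * v) A (b + 2 * i) (b + 2 * j) (b + 2 * k))
  | seq S T, p => .seq (S.compile b p) (T.compile b p)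
  | ifLt e f S, p =>
    .seq (e.compile b p) (.seq (f.compile b (p + 1)) (.ite (.rlt p (p + 1)) (S.compile b p) .skip))
  | .loop v N S, p =>
    .seq (.op (.icopy (b + 2 * (p + 2) + 1) (b + 2 * v)))
    (.seq (.op (.icopy (b + 2 * (p + 1) + 1) (b + 2 * N)))
    (.seq (forProg (b + 2 * p + 1) (b + 2 * (p + 1) + 1) (b + 2 * v) (S.compile b (p + 3)))
    (.op (.icopy (b + 2 * v) (b + 2 * (p + 2) + 1)))))

/-- The compiled statement does what the statement says. -/
theorem correct (prim : ℕ → ℝ → ℝ) (inp : Input) (b : ℕ) (S : Stmt) :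
    ∀ (p : ℕ) (σ : Store) (s : View), Rep b σ s →
      RunsWithin prim inp (S.compile b p) σ (S.cost inp s) fun σ' =>
        Rep b σ' (S.run inp s) ∧ Keeps b p σ σ' := by
  induction S with
  | asn A i j k e =>
    intro p σ s h
    refine RunsWithin.seq (Expr.correct prim inp b e p σ s h) ?_
    rintro τ ⟨h1, h2, h3⟩
    refine RunsWithin.op ?_
    refine ⟨⟨fun v => h1.idx v, fun A' i' j' k' => ?_⟩, fun q hq => h3 q hq⟩
    simp only [Op.run, Store.addr, run, View.setReal, Function.update_apply, h1.idx, h1.real, h2,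
      Prod.mk.injEq, arrNo_inj]
  | iconst v c =>
    intro p σ s h
    exact RunsWithin.op ⟨h.setIdx _ _, (Keeps.refl b p σ).setIdx⟩
  | icopy v w =>
    intro p σ s h
    refine RunsWithin.op ?_
    simp only [Op.run, h.idx]
    exact ⟨h.setIdx _ _, (Keeps.refl b p σ).setIdx⟩
  | isucc v =>
    intro p σ s h
    refine RunsWithin.op ?_
    simp only [Op.run, h.idx]
    exact ⟨h.setIdx _ _, (Keeps.refl b p σ).setIdx⟩
  | ipred v =>
    intro p σ s h
    refine RunsWithin.op ?_
    simp only [Op.run, h.idx]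
    exact ⟨h.setIdx _ _, (Keeps.refl b p σ).setIdx⟩
  | iinp v A i j k =>
    intro p σ s h
    refine RunsWithin.op ?_
    simp only [Op.run, h.idx, Store.addr]
    exact ⟨h.setIdx _ _, (Keeps.refl b p σ).setIdx⟩
  | seq S T hS hT =>
    intro p σ s h
    refine RunsWithin.seq (hS p σ s h) ?_
    rintro τ ⟨h1, h2⟩
    exact (hT p τ _ h1).mono le_rfl fun σ' h' => ⟨h'.1, h2.trans h'.2 le_rfl⟩
  | ifLt e f S hS =>
    intro p σ s h
    refine (RunsWithin.seq (Expr.correct prim inp b e p σ s h) ?_).mono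
      (u := e.cost s + (f.cost s + ((open Classical in if e.eval inp s < f.eval inp s then
        S.cost inp s else 0) + 1))) (by simp only [cost]; omega) fun σ' h' => h'
    rintro σ₁ ⟨h1, h2, h3⟩
    refine RunsWithin.seq (Expr.correct prim inp b f (p + 1) σ₁ s h1) ?_
    rintro σ₂ ⟨g1, g2, g3⟩
    have hp : σ₂.reg p = e.eval inp s := (g3 p (by omega)).1.trans h2
    have hk : Keeps b p σ σ₂ := h3.trans g3 (by omega)
    refine RunsWithin.ite (fun hc => ?_) (fun hc => ?_)
    · simp only [Cond.Holds, hp, g2] at hc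
      simp only [run, if_pos hc]
      exact (hS p σ₂ s g1).mono le_rfl fun σ' h' => ⟨h'.1, hk.trans h'.2 le_rfl⟩
    · simp only [Cond.Holds, hp, g2] at hc
      simp only [run, if_neg hc]
      exact RunsWithin.skip ⟨g1, hk⟩
  | loop v N S hS =>
    intro p σ s hσ
    set σ₀ : Store := (σ.setIdx (b + 2 * (p + 2) + 1) (s.idx v)).setIdx (b + 2 * (p + 1) + 1)
      (s.idx N) with hσ₀
    have hrep : Rep b σ₀ s := (hσ.setIdx_odd _ _).setIdx_odd _ _
    have hkeep : Keeps b p σ σ₀ :=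
      ((Keeps.refl b p σ).setIdx_odd (by omega)).setIdx_odd (by omega)
    -- Statements carry no value from round to round in a real register, so the invariant for
    -- registers is trivial and `rounds` describes everything.
    have hloop := RunsWithin.forProg (prim := prim) (inp := inp) (b := b) (p := p) (v := v)
      (N := s.idx N) (P := S.compile b (p + 3)) (f := rounds inp S v s)
      (I := fun _ _ => True) (u := fun t => S.cost inp ((rounds inp S v s t).setIdx v t))
      (σ := σ₀) (fun _ _ _ _ _ => trivial)
      (fun t ht σ hr _ => (hS (p + 3) σ _ hr).mono le_rfl fun σ' h' =>
        ⟨⟨(rounds inp S v s (t + 1)).idx v, by rw [View.setIdx_self]; exact h'.1⟩, trivial,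
          fun q hq => (h'.2 q hq).2, fun q hq => (h'.2 q (by omega)).1⟩)
      (by simp [hσ₀, Store.setIdx_idx]) hrep trivial
    refine (RunsWithin.seq (p := fun τ => τ = σ.setIdx (b + 2 * (p + 2) + 1) (s.idx v))
      (RunsWithin.op (by simp [Op.run, hσ.idx])) ?_).mono (u := 1 + (1 +
        (∑ t ∈ Finset.range (s.idx N), (S.cost inp ((rounds inp S v s t).setIdx v t) + 3) + 2
          + 1))) ?_ fun σ' h => h
    · rintro τ rfl
      refine RunsWithin.seq (p := fun τ => τ = σ₀) (RunsWithin.op ?_) ?_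
      · simp only [Op.run]
        rw [(hσ.setIdx_odd _ _).idx]
      rintro τ rfl
      refine RunsWithin.seq hloop ?_
      rintro τ ⟨⟨w, hw⟩, -, h3, h4⟩
      refine RunsWithin.op ?_
      have hS' : τ.idx (b + 2 * (p + 2) + 1) = s.idx v := by
        rw [h3, hσ₀]; simp [Store.setIdx_idx]
      simp only [Op.run, hS', run_for]
      refine ⟨?_, (hkeep.trans h4 le_rfl).setIdx⟩
      have := hw.setIdx v (s.idx v)
      rwa [View.setIdx_setIdx] at this
    · have h2 := Finset.sum_le_sum (s := Finset.range (s.idx N))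
        (f := fun t => S.cost inp ((rounds inp S v s t).setIdx v t) + 3)
        (g := fun t => S.cost inp ((rounds inp S v s t).setIdx v t) + 10)
        (fun t _ => by simp)
      simp only [cost]
      omega

/-- Assignment of `e` to the cells `(A, i, j, k)`, `i < N₁`, `j < N₂`, `k < N₃`, where the variables
`1`, `2`, `3` have the values `i`, `j`, `k`. -/
def tab (A N₁ N₂ N₃ : ℕ) (e : Expr) : Stmt :=
  .loop 1 N₁ (.loop 2 N₂ (.loop 3 N₃ (asn A 1 2 3 e)))

end Stmt

/-- The expression does not read the array `A`. -/
def Expr.Avoids (A : ℕ) : Expr → Prop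
  | arr A' _ _ _ => A' ≠ A
  | const _ | ofIdx _ | .inp _ _ _ _ => True
  | add e f | sub e f | mul e f | div e f => e.Avoids A ∧ f.Avoids A
  | sum _ _ e | sup _ _ e => e.Avoids A

theorem supAbs_congr {f g : ℕ → ℝ} (h : ∀ t, f t = g t) (N : ℕ) : supAbs f N = supAbs g N := by
  rw [funext h]

/-- This is what makes tabulation well behaved: while an array is being filled, an expression that
does not read it has the same value as before the first assignment. -/
theorem Expr.eval_congr {inp : Input} {A : ℕ} {e : Expr} (he : e.Avoids A) :
    ∀ {s s' : View}, s'.idx = s.idx →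
      (∀ a i j k, a ≠ A → s'.real (a, i, j, k) = s.real (a, i, j, k)) →
      e.eval inp s' = e.eval inp s := by
  induction e with
  | const v => intro s s' _ _; rfl
  | ofIdx v => intro s s' h _; simp [eval, h]
  | arr A' i j k => intro s s' h h'; simp only [eval, h]; exact h' _ _ _ _ he
  | inp A' i j k => intro s s' h _; simp [eval, h]
  | add e f h1 h2 => intro s s' h h'; simp only [eval, h1 he.1 h h', h2 he.2 h h']
  | sub e f h1 h2 => intro s s' h h'; simp only [eval, h1 he.1 h h', h2 he.2 h h']
  | mul e f h1 h2 => intro s s' h h'; simp only [eval, h1 he.1 h h', h2 he.2 h h']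
  | div e f h1 h2 => intro s s' h h'; simp only [eval, h1 he.1 h h', h2 he.2 h h']
  | sum v N e h1 =>
    intro s s' h h'
    simp only [eval, h]
    refine Finset.sum_congr rfl fun t _ => h1 he ?_ ?_
    · simp [View.setIdx, h]
    · simpa using h'
  | sup v N e h1 =>
    intro s s' h h'
    simp only [eval, h]
    refine supAbs_congr (fun t => h1 he ?_ ?_) _
    · simp [View.setIdx, h]
    · simpa using h'

/-! ### Loops of statements: invariants, filling of arrays, numbers of steps -/

namespace Stmt

/-- An invariant of a loop. -/
theorem rounds_induction {inp : Input} {S : Stmt} {v N : ℕ} {s : View} {I : ℕ → View → Prop}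
    (h0 : I 0 s) (hstep : ∀ t < N, ∀ s', I t s' → I (t + 1) (S.run inp (s'.setIdx v t))) :
    ∀ t ≤ N, I t (rounds inp S v s t) := by
  intro t
  induction t with
  | zero => intro _; exact h0
  | succ t ih => intro ht; exact hstep t ht _ (ih (by omega))

/-- A loop whose body changes only the array `A`, and the cells of a set that depends on the values
of the loop variable. -/
theorem run_for_fill {inp : Input} {S : Stmt} {v N A : ℕ} {s : View}
    {D : ℕ → ℕ → ℕ → ℕ → Prop} {f : ℕ → ℕ → ℕ → ℝ}
    (hS : ∀ t < s.idx N, ∀ s' : View, (∀ w ≠ v, s'.idx w = s.idx w) → s'.idx v = t →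
      (∀ a i j k, a ≠ A → s'.real (a, i, j, k) = s.real (a, i, j, k)) →
      (∀ i j k, (¬ ∃ t' < t, D t' i j k) → s'.real (A, i, j, k) = s.real (A, i, j, k)) →
      (S.run inp s').idx = s'.idx ∧
      (∀ a i j k, a ≠ A → (S.run inp s').real (a, i, j, k) = s'.real (a, i, j, k)) ∧
      (∀ i j k, D t i j k → (S.run inp s').real (A, i, j, k) = f i j k) ∧
      (∀ i j k, ¬ D t i j k → (S.run inp s').real (A, i, j, k) = s'.real (A, i, j, k))) :
    ((Stmt.loop v N S).run inp s).idx = s.idx ∧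
      (∀ a i j k, a ≠ A →
        ((Stmt.loop v N S).run inp s).real (a, i, j, k) = s.real (a, i, j, k)) ∧
      (∀ i j k, (∃ t < s.idx N, D t i j k) →
        ((Stmt.loop v N S).run inp s).real (A, i, j, k) = f i j k) ∧
      (∀ i j k, (¬ ∃ t < s.idx N, D t i j k) →
        ((Stmt.loop v N S).run inp s).real (A, i, j, k) = s.real (A, i, j, k)) := by
  have key := rounds_induction (inp := inp) (S := S) (v := v) (N := s.idx N) (s := s)
    (I := fun t s' => (∀ w ≠ v, s'.idx w = s.idx w) ∧
      (∀ a i j k, a ≠ A → s'.real (a, i, j, k) = s.real (a, i, j, k)) ∧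
      (∀ i j k, (∃ t' < t, D t' i j k) → s'.real (A, i, j, k) = f i j k) ∧
      (∀ i j k, (¬ ∃ t' < t, D t' i j k) → s'.real (A, i, j, k) = s.real (A, i, j, k)))
    ⟨fun _ _ => rfl, fun _ _ _ _ _ => rfl, by simp, fun _ _ _ _ => rfl⟩
    (by
      rintro t ht s' ⟨h1, h2, h3, h4⟩
      have hidx : ∀ w ≠ v, (s'.setIdx v t).idx w = s.idx w := by
        intro w hw
        rw [View.setIdx_idx, if_neg hw, h1 w hw]
      obtain ⟨g1, g2, g3, g4⟩ := hS t ht (s'.setIdx v t) hidx (by simp [View.setIdx])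
        (by simpa using h2) (by simpa using h4)
      refine ⟨fun w hw => by rw [g1, hidx w hw],
        fun a i j k ha => by rw [g2 a i j k ha, View.setIdx_real, h2 a i j k ha], ?_, ?_⟩
      · rintro i j k ⟨t', ht', hDt⟩
        -- The sets `D t` need not be disjoint: a cell that is written again receives the same
        -- value, since `f` does not depend on the round.
        by_cases hD' : D t i j k
        · exact g3 i j k hD'
        · rw [g4 i j k hD', View.setIdx_real]
          refine h3 i j k ⟨t', ?_, hDt⟩
          rcases Nat.lt_succ_iff_lt_or_eq.1 ht' with h | rfl
          · exact h
          · exact absurd hDt hD'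
      · intro i j k hn
        rw [g4 i j k fun h => hn ⟨t, by omega, h⟩, View.setIdx_real]
        exact h4 i j k fun ⟨t', ht', h⟩ => hn ⟨t', by omega, h⟩)
    (s.idx N) le_rfl
  obtain ⟨h1, h2, h3, h4⟩ := key
  rw [run_for]
  refine ⟨funext fun w => ?_, h2, h3, h4⟩
  rw [View.setIdx_idx]
  split_ifs with hw
  · rw [hw]
  · exact h1 w hw

/-- The fill rule is applied at three depths, where one round fills a slab, a row or a single cell.
The inequalities keep the bounds of the inner loops from being loop variables of the outer ones. -/
theorem tab_spec (inp : Input) {A N₁ N₂ N₃ : ℕ} {e : Expr} (he : e.Avoids A) (h2 : N₂ ≠ 1)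
    (h3 : N₃ ≠ 1) (h3' : N₃ ≠ 2) (s : View) :
    ((tab A N₁ N₂ N₃ e).run inp s).idx = s.idx ∧
      (∀ a i j k, a ≠ A → ((tab A N₁ N₂ N₃ e).run inp s).real (a, i, j, k) = s.real (a, i, j, k)) ∧
      ∀ i < s.idx N₁, ∀ j < s.idx N₂, ∀ k < s.idx N₃,
        ((tab A N₁ N₂ N₃ e).run inp s).real (A, i, j, k) =
          e.eval inp (((s.setIdx 1 i).setIdx 2 j).setIdx 3 k) := by
  have h := run_for_fill (inp := inp) (v := 1) (N := N₁) (A := A) (s := s)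
    (S := .loop 2 N₂ (.loop 3 N₃ (asn A 1 2 3 e)))
    (D := fun t i j k => i = t ∧ j < s.idx N₂ ∧ k < s.idx N₃)
    (f := fun i j k => e.eval inp (((s.setIdx 1 i).setIdx 2 j).setIdx 3 k))
    ?_
  · exact ⟨h.1, h.2.1, fun i hi j hj k hk => h.2.2.1 i j k ⟨i, hi, rfl, hj, hk⟩⟩
  intro t _ s₁ a1 a2 a3 _
  have b2 : s₁.idx N₂ = s.idx N₂ := a1 _ h2
  have b3 : s₁.idx N₃ = s.idx N₃ := a1 _ h3
  have h' := run_for_fill (inp := inp) (v := 2) (N := N₂) (A := A) (s := s₁)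
    (S := .loop 3 N₃ (asn A 1 2 3 e))
    (D := fun t' i j k => i = t ∧ j = t' ∧ k < s.idx N₃)
    (f := fun i j k => e.eval inp (((s.setIdx 1 i).setIdx 2 j).setIdx 3 k))
    ?_
  · refine ⟨h'.1, h'.2.1, ?_, ?_⟩
    · rintro i j k ⟨rfl, hj, hk⟩
      exact h'.2.2.1 i j k ⟨j, by omega, rfl, rfl, hk⟩
    · intro i j k hn
      refine h'.2.2.2 i j k ?_
      rintro ⟨t', ht', hi, hj, hk⟩
      exact hn ⟨hi, by omega, hk⟩
  intro t' _ s₂ c1 c2 c3 _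
  have d3 : s₂.idx N₃ = s.idx N₃ := (c1 _ h3').trans b3
  have h'' := run_for_fill (inp := inp) (v := 3) (N := N₃) (A := A) (s := s₂)
    (S := asn A 1 2 3 e)
    (D := fun t'' i j k => i = t ∧ j = t' ∧ k = t'')
    (f := fun i j k => e.eval inp (((s.setIdx 1 i).setIdx 2 j).setIdx 3 k))
    ?_
  · refine ⟨h''.1, h''.2.1, ?_, ?_⟩
    · rintro i j k ⟨rfl, rfl, hk⟩
      exact h''.2.2.1 i j k ⟨k, by omega, rfl, rfl, rfl⟩
    · intro i j k hn
      refine h''.2.2.2 i j k ?_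
      rintro ⟨t'', ht'', hi, hj, hk⟩
      exact hn ⟨hi, hj, by omega⟩
  intro t'' _ s₃ e1 e2 e3 _
  have i1 : s₃.idx 1 = t := by rw [e1 _ (by norm_num), c1 _ (by norm_num), a2]
  have i2 : s₃.idx 2 = t' := by rw [e1 _ (by norm_num), c2]
  have hev : e.eval inp s₃ = e.eval inp (((s.setIdx 1 t).setIdx 2 t').setIdx 3 t'') := by
    refine Expr.eval_congr he ?_ ?_
    · funext w
      simp only [View.setIdx_idx]
      split_ifs with w3 w2 w1
      · rw [w3, e2]
      · rw [w2, i2]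
      · rw [w1, i1]
      · rw [e1 _ w3, c1 _ w2, a1 _ w1]
    · intro a i j k ha
      simp only [View.setIdx_real]
      rw [e3 _ _ _ _ ha, c3 _ _ _ _ ha, a3 _ _ _ _ ha]
  refine ⟨rfl, fun a i j k ha => ?_, ?_, ?_⟩
  · simp [run, View.setReal, ha]
  · rintro i j k ⟨rfl, rfl, rfl⟩
    simp [run, View.setReal, i1, i2, e2, hev]
  · intro i j k hn
    simp only [run, View.setReal, Function.update_apply, i1, i2, e2, Prod.mk.injEq, true_and]
    rw [if_neg hn]

theorem rounds_idx {inp : Input} {S : Stmt} {v : ℕ} {s : View}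
    (h : ∀ s', (S.run inp s').idx = s'.idx) (t : ℕ) :
    ∀ w ≠ v, (rounds inp S v s t).idx w = s.idx w := by
  induction t with
  | zero => intro w _; rfl
  | succ t ih => intro w hw; simp only [rounds]; rw [h, View.setIdx_idx, if_neg hw, ih w hw]

theorem cost_for_le {inp : Input} {S : Stmt} {v N M B : ℕ} {s : View} (hN : s.idx N ≤ M)
    (h : ∀ t < s.idx N, S.cost inp ((rounds inp S v s t).setIdx v t) ≤ B) :
    (Stmt.loop v N S).cost inp s ≤ M * (B + 10) + 10 := by
  simp only [cost]
  have := Finset.sum_le_card_nsmul (Finset.range (s.idx N))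
    (fun t => S.cost inp ((rounds inp S v s t).setIdx v t) + 10) (B + 10)
    (fun t ht => by have := h t (Finset.mem_range.1 ht); simpa using this)
  simp only [Finset.card_range, smul_eq_mul] at this
  have h2 := Nat.mul_le_mul_right (B + 10) hN
  omega

theorem run_for_idx {inp : Input} {S : Stmt} (v N : ℕ) (s : View)
    (h : ∀ s', (S.run inp s').idx = s'.idx) : ((Stmt.loop v N S).run inp s).idx = s.idx := by
  rw [run_for]
  funext w
  rw [View.setIdx_idx]
  split_ifs with hw
  · rw [hw]
  · exact rounds_idx h _ w hw

/-- A bound for the number of steps of `tab`. -/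
theorem tab_cost_le (inp : Input) {A N₁ N₂ N₃ : ℕ} {e : Expr} (h2 : N₂ ≠ 1) (h3 : N₃ ≠ 1)
    (h3' : N₃ ≠ 2) {s : View} {M₁ M₂ M₃ B : ℕ} (m1 : s.idx N₁ ≤ M₁) (m2 : s.idx N₂ ≤ M₂)
    (m3 : s.idx N₃ ≤ M₃)
    (hB : ∀ s' : View, (∀ w, w ≠ 1 → w ≠ 2 → w ≠ 3 → s'.idx w = s.idx w) → e.cost s' ≤ B) :
    (tab A N₁ N₂ N₃ e).cost inp s ≤
      M₁ * (M₂ * (M₃ * (B + 11) + 20) + 20) + 10 := by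
  have i3 : ∀ s', ((asn A 1 2 3 e).run inp s').idx = s'.idx := fun _ => rfl
  have i2 : ∀ s', ((Stmt.loop 3 N₃ (asn A 1 2 3 e)).run inp s').idx = s'.idx :=
    fun s' => run_for_idx _ _ s' i3
  have i1 : ∀ s', ((Stmt.loop 2 N₂ (.loop 3 N₃ (asn A 1 2 3 e))).run inp s').idx = s'.idx :=
    fun s' => run_for_idx _ _ s' i2
  have l3 : ∀ s' : View, (∀ w, w ≠ 1 → w ≠ 2 → s'.idx w = s.idx w) →
      (Stmt.loop 3 N₃ (asn A 1 2 3 e)).cost inp s' ≤ M₃ * (B + 1 + 10) + 10 := by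
    intro s' hs'
    refine cost_for_le (by rw [hs' _ h3 h3']; exact m3) fun t _ => ?_
    simp only [cost]
    refine Nat.add_le_add_right (hB _ fun w w1 w2 w3 => ?_) 1
    rw [View.setIdx_idx, if_neg w3, rounds_idx i3 _ _ w3, hs' w w1 w2]
  have l2 : ∀ s' : View, (∀ w, w ≠ 1 → s'.idx w = s.idx w) →
      (Stmt.loop 2 N₂ (.loop 3 N₃ (asn A 1 2 3 e))).cost inp s' ≤
        M₂ * (M₃ * (B + 1 + 10) + 10 + 10) + 10 := by
    intro s' hs'
    refine cost_for_le (by rw [hs' _ h2]; exact m2) fun t _ => ?_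
    refine l3 _ fun w w1 w2 => ?_
    rw [View.setIdx_idx, if_neg w2, rounds_idx i2 _ _ w2, hs' w w1]
  refine (cost_for_le m1 fun t _ => l2 _ fun w w1 => ?_).trans (le_of_eq ?_)
  · rw [View.setIdx_idx, if_neg w1, rounds_idx i1 _ _ w1]
  · ring

/-- A loop with an invariant, and a bound for the number of steps. -/
theorem for_spec {inp : Input} {S : Stmt} {v N B : ℕ} {s : View} {I : ℕ → View → Prop}
    (h0 : I 0 s) (hstep : ∀ t < s.idx N, ∀ s', I t s' →
      S.cost inp (s'.setIdx v t) ≤ B ∧ I (t + 1) (S.run inp (s'.setIdx v t))) :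
    (Stmt.loop v N S).cost inp s ≤ s.idx N * (B + 10) + 10 ∧
      ∃ s', I (s.idx N) s' ∧ (Stmt.loop v N S).run inp s = s'.setIdx v (s.idx v) := by
  have key := rounds_induction (inp := inp) (S := S) (v := v) (N := s.idx N) (s := s) (I := I) h0
    (fun t ht s' hs' => (hstep t ht s' hs').2)
  exact ⟨cost_for_le le_rfl fun t ht => (hstep t ht _ (key t ht.le)).1,
    _, key _ le_rfl, run_for inp v N S s⟩

end Stmt

/-! ### Gradients and vector-Jacobian products -/

section Calculus

variable {n d : ℕ}

theorem abs_entry_le_norm (A : Mat n d) (j : Fin n) (k : Fin d) : |A j k| ≤ ‖A‖ := by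
  simpa using Matrix.norm_entry_le_entrywise_sup_norm A (i := j) (j := k)

theorem mat_norm_le {A : Mat n d} {r : ℝ} (hr : 0 ≤ r) (h : ∀ j k, |A j k| ≤ r) : ‖A‖ ≤ r :=
  (Matrix.norm_le_iff hr).2 fun j k => by simpa using h j k

/-- The sum of the products of the entries. -/
def pairing (G V : Mat n d) : ℝ := ∑ a, ∑ b, G a b * V a b

theorem pairing_single (G : Mat n d) (j : Fin n) (k : Fin d) :
    pairing G (Matrix.single j k 1) = G j k := by
  unfold pairing
  rw [Finset.sum_eq_single j, Finset.sum_eq_single k]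
  · simp
  · intro b _ hb; simp [Matrix.single_apply_of_col_ne _ _ hb.symm]
  · simp
  · intro a _ ha
    exact Finset.sum_eq_zero fun b _ => by simp [Matrix.single_apply_of_row_ne ha.symm]
  · simp

/-- The matrix units recover the entries. Identities between gradients or VJPs are proved through
this lemma, as identities of linear forms in a direction `V`. -/
theorem eq_of_pairing_eq {G G' : Mat n d} (h : ∀ V, pairing G V = pairing G' V) : G = G' := by
  ext j k
  simpa [pairing_single] using h (Matrix.single j k 1)

theorem map_eq_pairing (f : Mat n d →L[ℝ] ℝ) (V : Mat n d) :
    f V = pairing (Matrix.of fun j k => f (Matrix.single j k 1)) V := by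
  conv_lhs => rw [Matrix.matrix_eq_sum_single V]
  simp only [map_sum, pairing, Matrix.of_apply]
  refine Finset.sum_congr rfl fun j _ => Finset.sum_congr rfl fun k _ => ?_
  have : Matrix.single j k (V j k) = (V j k) • (Matrix.single j k (1 : ℝ) : Mat n d) := by
    rw [Matrix.smul_single, smul_eq_mul, mul_one]
  rw [this, map_smul, smul_eq_mul, mul_comm]

/-- Pairing with `G` as a continuous linear form. -/
def pairingCLM (G : Mat n d) : Mat n d →L[ℝ] ℝ :=
  LinearMap.toContinuousLinearMap
    { toFun := pairing G
      map_add' := fun x y => by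
        simp [pairing, mul_add, Finset.sum_add_distrib]
      map_smul' := fun c x => by
        simp [pairing, Finset.mul_sum, mul_left_comm] }

@[simp] theorem pairingCLM_apply (G V : Mat n d) : pairingCLM G V = pairing G V := rfl

theorem fderiv_eq_pairing_grad (f : Mat n d → ℝ) (A V : Mat n d) :
    fderiv ℝ f A V = pairing (grad f A) V :=
  map_eq_pairing (fderiv ℝ f A) V

/-- The VJP is the adjoint of the Fréchet derivative with respect to the pairing; chain rules for it
are chain rules for `fderiv` in reverse order. -/
theorem pairing_vjp (H : Mat n d → Mat n d) (A G V : Mat n d) :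
    pairing (vjp H A G) V = pairing G (fderiv ℝ H A V) := by
  have h := map_eq_pairing ((pairingCLM G).comp (fderiv ℝ H A)) V
  rw [ContinuousLinearMap.comp_apply, pairingCLM_apply] at h
  rw [h]
  rfl

theorem grad_comp {f : Mat n d → ℝ} {H : Mat n d → Mat n d} {A : Mat n d}
    (hf : DifferentiableAt ℝ f (H A)) (hH : DifferentiableAt ℝ H A) :
    grad (fun B => f (H B)) A = vjp H A (grad f (H A)) := by
  refine eq_of_pairing_eq fun V => ?_
  rw [← fderiv_eq_pairing_grad, pairing_vjp, ← fderiv_eq_pairing_grad]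
  have : fderiv ℝ (fun B => f (H B)) A = (fderiv ℝ f (H A)).comp (fderiv ℝ H A) :=
    fderiv_comp A hf hH
  rw [this]; rfl

theorem vjp_comp {H₂ H₁ : Mat n d → Mat n d} {A : Mat n d}
    (h₂ : DifferentiableAt ℝ H₂ (H₁ A)) (h₁ : DifferentiableAt ℝ H₁ A) (G : Mat n d) :
    vjp (fun B => H₂ (H₁ B)) A G = vjp H₁ A (vjp H₂ (H₁ A) G) := by
  refine eq_of_pairing_eq fun V => ?_
  rw [pairing_vjp, pairing_vjp, pairing_vjp]
  have : fderiv ℝ (fun B => H₂ (H₁ B)) A = (fderiv ℝ H₂ (H₁ A)).comp (fderiv ℝ H₁ A) :=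
    fderiv_comp A h₂ h₁
  rw [this]; rfl

theorem pairing_add (G V W : Mat n d) : pairing G (V + W) = pairing G V + pairing G W :=
  map_add (pairingCLM G) V W

theorem pairing_add_left (G G' V : Mat n d) :
    pairing (G + G') V = pairing G V + pairing G' V := by
  simp [pairing, add_mul, Finset.sum_add_distrib]

theorem differentiableAt_residual {H : Mat n d → Mat n d} {A : Mat n d}
    (hH : DifferentiableAt ℝ H A) : DifferentiableAt ℝ (residual H) A :=
  differentiableAt_id.add hH

theorem vjp_residual {H : Mat n d → Mat n d} {A : Mat n d} (hH : DifferentiableAt ℝ H A)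
    (G : Mat n d) : vjp (residual H) A G = G + vjp H A G := by
  refine eq_of_pairing_eq fun V => ?_
  rw [pairing_vjp, pairing_add_left, pairing_vjp, ← pairing_add]
  have : fderiv ℝ (residual H) A = ContinuousLinearMap.id ℝ _ + fderiv ℝ H A := by
    have := (hasFDerivAt_id (𝕜 := ℝ) A).add hH.hasFDerivAt
    exact this.fderiv
  rw [this]; rfl

theorem vjp_id (A G : Mat n d) : vjp (fun B => B) A G = G := by
  refine eq_of_pairing_eq fun V => ?_
  rw [pairing_vjp, fderiv_fun_id]; rfl

theorem vjp_add (H : Mat n d → Mat n d) (A G G' : Mat n d) :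
    vjp H A (G + G') = vjp H A G + vjp H A G' := by
  refine eq_of_pairing_eq fun V => ?_
  rw [pairing_vjp, pairing_add_left, pairing_add_left, pairing_vjp, pairing_vjp]

theorem vjp_sub (H : Mat n d → Mat n d) (A G G' : Mat n d) :
    vjp H A (G - G') = vjp H A G - vjp H A G' := by
  rw [eq_sub_iff_add_eq, ← vjp_add, sub_add_cancel]

theorem differentiableAt_overallLoss {l : Fin n → Fin d → Mat n d → ℝ} {A : Mat n d}
    (h : ∀ j k, DifferentiableAt ℝ (l j k) A) : DifferentiableAt ℝ (overallLoss l) A := by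
  have : overallLoss l = fun B => ∑ j, ∑ k, l j k B := rfl
  rw [this]
  exact DifferentiableAt.fun_sum fun j _ => DifferentiableAt.fun_sum fun k _ => h j k

theorem norm_vjp_le {H : Mat n d → Mat n d} {A : Mat n d} {b : ℝ} (h : JacobianBound H A b)
    (G : Mat n d) : ‖vjp H A G‖ ≤ n * d * b * ‖G‖ := by
  -- For empty matrices the hypothesis is void and `b` could be negative; otherwise any entry of the
  -- Jacobian shows `0 ≤ b`.
  rcases n.eq_zero_or_pos with rfl | hn
  · have : ‖vjp H A G‖ ≤ 0 := mat_norm_le le_rfl fun j => j.elim0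
    simpa using this
  rcases d.eq_zero_or_pos with rfl | hd
  · have : ‖vjp H A G‖ ≤ 0 := mat_norm_le le_rfl fun _ k => k.elim0
    simpa using this
  have hb : 0 ≤ b := (norm_nonneg _).trans (h ⟨0, hn⟩ ⟨0, hd⟩)
  refine mat_norm_le (by positivity) fun j k => ?_
  simp only [vjp, Matrix.of_apply]
  calc |∑ a, ∑ c, G a c * partialDeriv H A j k a c|
      ≤ ∑ a, ∑ c, |G a c * partialDeriv H A j k a c| :=
        (Finset.abs_sum_le_sum_abs _ _).trans
          (Finset.sum_le_sum fun a _ => Finset.abs_sum_le_sum_abs _ _)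
    _ ≤ ∑ _a : Fin n, ∑ _c : Fin d, ‖G‖ * b := by
        refine Finset.sum_le_sum fun a _ => Finset.sum_le_sum fun c _ => ?_
        rw [abs_mul]
        exact mul_le_mul (abs_entry_le_norm G a c)
          ((abs_entry_le_norm _ a c).trans (h j k)) (abs_nonneg _) (norm_nonneg _)
    _ = n * d * b * ‖G‖ := by simp; ring

end Calculus

/-! ### Growth rates -/

theorem eventually_const_le_rpow (A : ℝ) {ε : ℝ} (hε : 0 < ε) :
    ∀ᶠ n : ℕ in atTop, A ≤ (n : ℝ) ^ ε :=
  ((tendsto_rpow_atTop hε).comp tendsto_natCast_atTop_atTop).eventually_ge_atTop A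

theorem eventually_log_le_rpow (A : ℝ) {ε : ℝ} (hε : 0 < ε) :
    ∀ᶠ n : ℕ in atTop, A * Real.log n ≤ (n : ℝ) ^ ε := by
  have h := ((isLittleO_log_rpow_atTop hε).const_mul_left A).comp_tendsto
    tendsto_natCast_atTop_atTop
  have h1 := h.bound (c := 1) one_pos
  filter_upwards [h1] with n hn
  simp only [Function.comp, Real.norm_eq_abs, one_mul] at hn
  rw [abs_of_nonneg (a := (n : ℝ) ^ ε) (by positivity)] at hn
  exact (le_abs_self _).trans hn

theorem SubPolynomial.of_le {f g : ℕ → ℝ} (hg : SubPolynomial g)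
    (h : ∀ᶠ n in atTop, f n ≤ g n) : SubPolynomial f := fun ε hε => by
  filter_upwards [hg ε hε, h] with n h1 h2 using h2.trans h1

theorem SubPolynomial.const (A : ℝ) : SubPolynomial fun _ => A := fun _ hε =>
  eventually_const_le_rpow A hε

theorem SubPolynomial.log (A : ℝ) : SubPolynomial fun n => A * Real.log n := fun _ hε =>
  eventually_log_le_rpow A hε

theorem SubPolynomial.add {f g : ℕ → ℝ} (hf : SubPolynomial f) (hg : SubPolynomial g) :
    SubPolynomial fun n => f n + g n := fun ε hε => by
  filter_upwards [hf (ε / 2) (half_pos hε), hg (ε / 2) (half_pos hε),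
    eventually_const_le_rpow 2 (half_pos hε), eventually_ge_atTop 1] with n h1 h2 h3 hn
  have hn : (0 : ℝ) < n := by exact_mod_cast hn
  calc f n + g n ≤ 2 * (n : ℝ) ^ (ε / 2) := by linarith
    _ ≤ (n : ℝ) ^ (ε / 2) * (n : ℝ) ^ (ε / 2) := by gcongr
    _ = (n : ℝ) ^ ε := by rw [← Real.rpow_add hn, add_halves]

theorem SubPolynomial.almostLinear_mul {f S : ℕ → ℝ} (hf : AlmostLinear f) (hS : SubPolynomial S)
    (h0 : ∀ᶠ n in atTop, 0 ≤ S n) : AlmostLinear fun n => f n * S n := fun ε hε => by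
  filter_upwards [hf (ε / 2) (half_pos hε), hS (ε / 2) (half_pos hε), h0, eventually_ge_atTop 1]
    with n h1 h2 h3 hn
  have hn : (0 : ℝ) < n := by exact_mod_cast hn
  calc f n * S n ≤ (n : ℝ) ^ (1 + ε / 2) * (n : ℝ) ^ (ε / 2) :=
        mul_le_mul h1 h2 h3 (by positivity)
    _ = (n : ℝ) ^ (1 + ε) := by rw [← Real.rpow_add hn, add_assoc, add_halves]

theorem AlmostLinear.add {f g : ℕ → ℝ} (hf : AlmostLinear f) (hg : AlmostLinear g) :
    AlmostLinear fun n => f n + g n := fun ε hε => by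
  filter_upwards [hf (ε / 2) (half_pos hε), hg (ε / 2) (half_pos hε),
    eventually_const_le_rpow 2 (half_pos hε), eventually_ge_atTop 1] with n h1 h2 h3 hn
  have hn : (0 : ℝ) < n := by exact_mod_cast hn
  calc f n + g n ≤ (n : ℝ) ^ (1 + ε / 2) * 2 := by linarith
    _ ≤ (n : ℝ) ^ (1 + ε / 2) * (n : ℝ) ^ (ε / 2) := by gcongr
    _ = (n : ℝ) ^ (1 + ε) := by rw [← Real.rpow_add hn, add_assoc, add_halves]

theorem AlmostLinear.natCast_add_one : AlmostLinear fun n => (n : ℝ) + 1 := fun ε hε => by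
  filter_upwards [eventually_const_le_rpow 2 hε, eventually_ge_atTop 1] with n h hn
  have hn' : (1 : ℝ) ≤ n := by exact_mod_cast hn
  rw [Real.rpow_add (by linarith), Real.rpow_one]
  nlinarith

/-- A time bound `n ^ (1 + ε)` for every `ε` gives an almost linear time bound. -/
theorem exists_almostLinear {Q : ℕ → ℝ → Prop}
    (h : ∀ ε : ℝ, 0 < ε → ∀ᶠ n : ℕ in atTop, Q n ((n : ℝ) ^ (1 + ε))) :
    ∃ (T : ℕ → ℝ) (N : ℕ), AlmostLinear T ∧ ∀ n, N ≤ n → Q n (T n) := by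
  have h' : ∀ q : ℕ, ∃ N : ℕ, ∀ n ≥ N, Q n ((n : ℝ) ^ (1 + 1 / ((q : ℝ) + 1))) := fun q =>
    eventually_atTop.1 (h (1 / ((q : ℝ) + 1)) (by positivity))
  choose N hN using h'
  classical
  -- Diagonal choice: at size `n` the exponent is the best one whose threshold `N q` has been
  -- passed, among `q ≤ n`. For `n ≥ N 0` there is such a `q`, and the largest one tends to
  -- infinity.
  refine ⟨fun n => (n : ℝ) ^ (1 + 1 / ((Nat.findGreatest (fun q => N q ≤ n) n : ℝ) + 1)), N 0,
    ?_, ?_⟩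
  · intro ε hε
    obtain ⟨q, hq⟩ := exists_nat_one_div_lt hε
    filter_upwards [eventually_ge_atTop q, eventually_ge_atTop (N q), eventually_ge_atTop 1]
      with n h1 h2 h3
    have h4 : q ≤ Nat.findGreatest (fun q => N q ≤ n) n := Nat.le_findGreatest h1 h2
    have h5 : (q : ℝ) ≤ (Nat.findGreatest (fun q => N q ≤ n) n : ℝ) := by exact_mod_cast h4
    refine Real.rpow_le_rpow_of_exponent_le (by exact_mod_cast h3) ?_
    have : 1 / ((Nat.findGreatest (fun q => N q ≤ n) n : ℝ) + 1) ≤ 1 / ((q : ℝ) + 1) := by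
      gcongr
    linarith
  · intro n hn
    exact hN _ n (Nat.findGreatest_spec (P := fun q => N q ≤ n) (Nat.zero_le n) hn)

/-! ### The residual block -/

/-- The view of a store. -/
def Store.view (b : ℕ) (σ : Store) : View where
  idx v := σ.idx (b + 2 * v)
  real x := σ.real (arrNo b x.1, x.2.1, x.2.2.1, x.2.2.2)

theorem Store.rep_view (b : ℕ) (σ : Store) : Rep b σ (σ.view b) :=
  ⟨fun _ => rfl, fun _ _ _ _ => rfl⟩

/-- Array number `a` of a view holds the matrix `A`. -/
def View.HoldsMat {n d : ℕ} (s : View) (a : ℕ) (A : Mat n d) : Prop :=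
  ∀ (j : Fin n) (k : Fin d), s.real (a, 0, (j : ℕ), (k : ℕ)) = A j k

theorem Rep.holdsMat_zero {n d b : ℕ} {σ : Store} {s : View} (h : Rep b σ s) {A : Mat n d} :
    σ.HoldsMat 0 A ↔ s.HoldsMat 0 A := by
  have : ∀ j k, σ.real (0, 0, j, k) = s.real (0, 0, j, k) := fun j k => h.real 0 0 j k
  simp [Store.HoldsMat, View.HoldsMat, this]

theorem Rep.holdsMat_one {n d b : ℕ} {σ : Store} {s : View} (h : Rep b σ s) {A : Mat n d} :
    σ.HoldsMat 1 A ↔ s.HoldsMat 1 A := by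
  have : ∀ j k, σ.real (1, 0, j, k) = s.real (1, 0, j, k) := fun j k => h.real 1 0 j k
  simp [Store.HoldsMat, View.HoldsMat, this]

/-- Foreign code changes only the arrays `0` and `1` of the view. -/
theorem Rep.of_agreeFrom {b : ℕ} {σ σ' : Store} {s : View} (h : Rep b σ s)
    (ha : AgreeFrom b σ σ') :
    ∃ s' : View, Rep b σ' s' ∧ s'.idx = s.idx ∧
      ∀ A, 2 ≤ A → ∀ i j k, s'.real (A, i, j, k) = s.real (A, i, j, k) := by
  refine ⟨σ'.view b, σ'.rep_view b, funext fun v => ?_, fun A hA i j k => ?_⟩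
  · rw [← (σ'.rep_view b).idx, ha.1 _ (by omega), h.idx]
  · rw [← (σ'.rep_view b).real, ← h.real, arrNo, if_neg (by omega), ha.2 _ (by omega)]

/-! ### Copies and sums of matrices -/

namespace Stmt

/-- Array `A` becomes a copy of array `B`, as matrices of the size that is given by the variables
`8` and `9`. -/
def copyMat (A B : ℕ) : Stmt := tab A 7 8 9 (.arr B 0 2 3)

/-- Array `A` becomes the sum of the arrays `B` and `C`. -/
def addMat (A B C : ℕ) : Stmt := tab A 7 8 9 (.add (.arr B 0 2 3) (.arr C 0 2 3))

/-- Sets variable `0` to `0`, variable `7` to `1` and the variables `8` and `9` to the sizes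
`n` and `d`. -/
def initSizes : Stmt :=
  .seq (.iconst 0 0) (.seq (.iconst 7 1) (.seq (.iinp 8 0 0 0 0) (.iinp 9 0 0 0 7)))

end Stmt

/-- The variables `0`, `7`, `8`, `9` have the values `0`, `1`, `n`, `d`. -/
structure View.Sizes (s : View) (n d : ℕ) : Prop where
  zero : s.idx 0 = 0
  one : s.idx 7 = 1
  idx_n : s.idx 8 = n
  idx_d : s.idx 9 = d

theorem View.Sizes.congr {s s' : View} {n d : ℕ} (h : s.Sizes n d)
    (h0 : s'.idx 0 = s.idx 0) (h7 : s'.idx 7 = s.idx 7) (h8 : s'.idx 8 = s.idx 8)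
    (h9 : s'.idx 9 = s.idx 9) : s'.Sizes n d :=
  ⟨h0.trans h.zero, h7.trans h.one, h8.trans h.idx_n, h9.trans h.idx_d⟩

namespace Stmt

theorem initSizes_spec {inp : Input} {n d : ℕ} (hn : inp.int (0, 0, 0, 0) = n)
    (hd : inp.int (0, 0, 0, 1) = d) (s : View) :
    (initSizes.run inp s).Sizes n d ∧ (initSizes.run inp s).real = s.real := by
  refine ⟨⟨?_, ?_, ?_, ?_⟩, rfl⟩ <;> simp [initSizes, run, View.setIdx_idx, hn, hd]

theorem initSizes_cost (inp : Input) (s : View) : initSizes.cost inp s = 4 := rfl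

theorem copyMat_spec {inp : Input} {n d A B : ℕ} (hAB : B ≠ A) {s : View} (hs : s.Sizes n d)
    {M : Mat n d} (hM : s.HoldsMat B M) :
    ((copyMat A B).run inp s).idx = s.idx ∧
      (∀ a i j k, a ≠ A → ((copyMat A B).run inp s).real (a, i, j, k) = s.real (a, i, j, k)) ∧
      ((copyMat A B).run inp s).HoldsMat A M := by
  obtain ⟨h1, h2, h3⟩ := tab_spec inp (A := A) (N₁ := 7) (N₂ := 8) (N₃ := 9)
    (e := .arr B 0 2 3) hAB (by norm_num) (by norm_num) (by norm_num) s
  refine ⟨h1, h2, fun j k => ?_⟩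
  have := h3 0 (by rw [hs.one]; norm_num) j (by rw [hs.idx_n]; exact j.2) k
    (by rw [hs.idx_d]; exact k.2)
  rw [copyMat, this]
  simp only [Expr.eval, View.setIdx_real, View.setIdx_idx]
  simpa [hs.zero] using hM j k

theorem addMat_spec {inp : Input} {n d A B C : ℕ} (hAB : B ≠ A) (hAC : C ≠ A) {s : View}
    (hs : s.Sizes n d) {M N : Mat n d} (hM : s.HoldsMat B M) (hN : s.HoldsMat C N) :
    ((addMat A B C).run inp s).idx = s.idx ∧
      (∀ a i j k, a ≠ A → ((addMat A B C).run inp s).real (a, i, j, k) = s.real (a, i, j, k)) ∧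
      ((addMat A B C).run inp s).HoldsMat A (M + N) := by
  obtain ⟨h1, h2, h3⟩ := tab_spec inp (A := A) (N₁ := 7) (N₂ := 8) (N₃ := 9)
    (e := .add (.arr B 0 2 3) (.arr C 0 2 3)) ⟨hAB, hAC⟩ (by norm_num) (by norm_num)
    (by norm_num) s
  refine ⟨h1, h2, fun j k => ?_⟩
  have := h3 0 (by rw [hs.one]; norm_num) j (by rw [hs.idx_n]; exact j.2) k
    (by rw [hs.idx_d]; exact k.2)
  rw [addMat, this]
  simp only [Expr.eval, View.setIdx_real, View.setIdx_idx]
  simp [hs.zero, hM j k, hN j k]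

theorem copyMat_cost_le (inp : Input) {n d A B : ℕ} {s : View} (hs : s.Sizes n d) :
    (copyMat A B).cost inp s ≤ 50 * ((n + 1) * (d + 1)) := by
  have := tab_cost_le inp (A := A) (N₁ := 7) (N₂ := 8) (N₃ := 9) (e := .arr B 0 2 3)
    (by norm_num) (by norm_num) (by norm_num) (s := s) (B := 1) hs.one.le hs.idx_n.le hs.idx_d.le
    (fun s' _ => le_rfl)
  refine this.trans ?_
  ring_nf
  nlinarith

theorem addMat_cost_le (inp : Input) {n d A B C : ℕ} {s : View} (hs : s.Sizes n d) :
    (addMat A B C).cost inp s ≤ 50 * ((n + 1) * (d + 1)) := by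
  have := tab_cost_le inp (A := A) (N₁ := 7) (N₂ := 8) (N₃ := 9)
    (e := .add (.arr B 0 2 3) (.arr C 0 2 3))
    (by norm_num) (by norm_num) (by norm_num) (s := s) (B := 3) hs.one.le hs.idx_n.le hs.idx_d.le
    (fun s' _ => le_rfl)
  refine this.trans ?_
  ring_nf
  nlinarith

end Stmt

/-- The backward pass through a residual connection, if `PH` does the backward pass
through `H`. -/
def residualProg (PH : Prog) : Prog :=
  -- Array `2` of the view is array `PH.bound + 2` of the machine, out of reach of `PH`, so the
  -- saved cotangent survives. The later sum goes through array `3`, because an assignment may not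
  -- read the array that it fills.
  .seq ((Stmt.seq .initSizes (.copyMat 2 0)).compile PH.bound 0)
    (.seq PH ((Stmt.seq (.addMat 3 1 2) (.copyMat 1 3)).compile PH.bound 0))

namespace Block

theorem residualProg_runs {x : Block} {prim : ℕ → ℝ → ℝ} {PH : Prog} {τ δ : ℝ}
    (hn : x.input.int (0, 0, 0, 0) = x.n) (hd : x.input.int (0, 0, 0, 1) = x.d)
    (h : x.VJPRuns prim PH τ δ) {G : Mat x.n x.d} (hG : ‖G - x.gradY‖ ≤ 1) {σ : Store}
    (hσ : σ.HoldsMat 0 G) :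
    RunsIn prim x.input (residualProg PH) σ (τ + 200 * ((x.n + 1) * (x.d + 1))) fun σ' =>
      ∃ O : Mat x.n x.d, σ'.HoldsMat 1 (G + O) ∧ ‖O - vjp x.H x.X G‖ ≤ δ := by
  -- The existence of a run within `τ` steps already forces `τ` to be nonnegative.
  have hτ : 0 ≤ τ := by
    obtain ⟨σ', t, -, ht, -⟩ := h G σ hG hσ
    exact le_trans (by positivity) ht
  set b := PH.bound
  set s₀ := σ.view b
  have r0 : Rep b σ s₀ := σ.rep_view b
  obtain ⟨z1, e1⟩ := Stmt.initSizes_spec (inp := x.input) hn hd s₀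
  set s₁ := Stmt.initSizes.run x.input s₀
  have m1 : s₁.HoldsMat 0 G := by
    intro j k
    rw [e1]
    exact r0.holdsMat_zero.1 hσ j k
  obtain ⟨i2, a2, m2⟩ := Stmt.copyMat_spec (inp := x.input) (A := 2) (by norm_num) z1 m1
  set s₂ := (Stmt.copyMat 2 0).run x.input s₁
  have z2 : s₂.Sizes x.n x.d := z1.congr (by rw [i2]) (by rw [i2]) (by rw [i2]) (by rw [i2])
  have m2' : s₂.HoldsMat 0 G := fun j k => by rw [a2 _ _ _ _ (by norm_num), m1 j k]
  have c1 := Stmt.copyMat_cost_le x.input (A := 2) (B := 0) z1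
  have run := RunsWithin.seq (w := ⌊τ⌋₊ + 100 * ((x.n + 1) * (x.d + 1)))
    (q := fun σ' => ∃ O : Mat x.n x.d, σ'.HoldsMat 1 (G + O) ∧ ‖O - vjp x.H x.X G‖ ≤ δ)
    (Stmt.correct prim x.input b (.seq .initSizes (.copyMat 2 0)) 0 σ s₀ r0) (Q := .seq PH
      ((Stmt.seq (.addMat 3 1 2) (.copyMat 1 3)).compile PH.bound 0)) (by
    rintro σ₂ ⟨r2 : Rep b σ₂ s₂, -⟩
    refine RunsWithin.seq ((h G σ₂ hG (r2.holdsMat_zero.2 m2')).runsWithin.agreeFrom le_rfl) ?_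
    rintro σ₃ ⟨⟨O, hO, hδ⟩, ha⟩
    obtain ⟨s₃, r3, i3, a3⟩ := r2.of_agreeFrom ha
    have z3 : s₃.Sizes x.n x.d := z2.congr (by rw [i3]) (by rw [i3]) (by rw [i3]) (by rw [i3])
    have m3 : s₃.HoldsMat 2 G := fun j k => by rw [a3 _ le_rfl, m2 j k]
    obtain ⟨i4, -, m4⟩ := Stmt.addMat_spec (inp := x.input) (A := 3) (B := 1) (C := 2)
      (by norm_num) (by norm_num) z3 (r3.holdsMat_one.1 hO) m3
    have z4 : ((Stmt.addMat 3 1 2).run x.input s₃).Sizes x.n x.d :=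
      z3.congr (by rw [i4]) (by rw [i4]) (by rw [i4]) (by rw [i4])
    obtain ⟨-, -, m5⟩ := Stmt.copyMat_spec (inp := x.input) (A := 1) (B := 3) (by norm_num) z4 m4
    have c3 := Stmt.addMat_cost_le x.input (A := 3) (B := 1) (C := 2) z3
    have c4 := Stmt.copyMat_cost_le x.input (A := 1) (B := 3) z4
    refine (Stmt.correct prim x.input b (.seq (.addMat 3 1 2) (.copyMat 1 3)) 0 σ₃ s₃ r3).mono
      (by simp only [Stmt.cost]; omega) ?_
    rintro σ' ⟨r5, -⟩
    refine ⟨O, r5.holdsMat_one.2 ?_, hδ⟩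
    rw [add_comm]
    exact m5)
  refine run.runsIn ?_ fun σ' h => h
  have hc : (Stmt.seq .initSizes (.copyMat 2 0)).cost x.input s₀ ≤
      100 * ((x.n + 1) * (x.d + 1)) := by
    simp only [Stmt.cost, Stmt.initSizes_cost]
    nlinarith
  have hc' : (Stmt.seq .initSizes (.copyMat 2 0)).cost x.input s₀ +
      (⌊τ⌋₊ + 100 * ((x.n + 1) * (x.d + 1))) ≤ ⌊τ⌋₊ + 200 * ((x.n + 1) * (x.d + 1)) := by omega
  calc (((Stmt.seq .initSizes (.copyMat 2 0)).cost x.input s₀ +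
      (⌊τ⌋₊ + 100 * ((x.n + 1) * (x.d + 1))) : ℕ) : ℝ)
      ≤ ((⌊τ⌋₊ + 200 * ((x.n + 1) * (x.d + 1)) : ℕ) : ℝ) := by exact_mod_cast hc'
    _ ≤ τ + 200 * ((x.n + 1) * (x.d + 1)) := by
      push_cast
      have := Nat.floor_le hτ
      linarith

theorem differentiableAt_lossX {x : Block} {C : ℝ} (h : x.Admissible C) :
    DifferentiableAt ℝ x.lossX x.X :=
  (differentiableAt_overallLoss h.diff_loss).comp x.X (differentiableAt_residual h.diff_H)

theorem gradX_eq {x : Block} {C : ℝ} (h : x.Admissible C) :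
    x.gradX = x.gradY + vjp x.H x.X x.gradY := by
  rw [gradX, ← vjp_residual h.diff_H]
  exact grad_comp (differentiableAt_overallLoss h.diff_loss) (differentiableAt_residual h.diff_H)

/-- `1 + n d n^c ≤ n^K`, unless the matrices are empty. -/
theorem exists_pow_bound (C : ℝ) (c : ℕ) :
    ∃ K : ℕ, ∀ n d : ℕ, 2 ≤ n → (d : ℝ) ≤ C * Real.log n →
      1 + n * d * (n : ℝ) ^ c ≤ (n : ℝ) ^ K := by
  -- The constant becomes a power: `C < 2 ^ q ≤ n ^ q`. With `log n ≤ n` this gives `d ≤ n ^ (q +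
  -- 1)`; the last factor `n` in `n ^ K` absorbs the summand `1`.
  obtain ⟨q, hq⟩ := pow_unbounded_of_one_lt (max C 1) (one_lt_two (α := ℝ))
  refine ⟨1 + 1 + q + c + 1, fun n d hn hd => ?_⟩
  have hn' : (2 : ℝ) ≤ n := by exact_mod_cast hn
  have h1 : (d : ℝ) ≤ (n : ℝ) ^ q * n := by
    calc (d : ℝ) ≤ C * Real.log n := hd
      _ ≤ (n : ℝ) ^ q * n := by
        have hlog : 0 ≤ Real.log n := Real.log_nonneg (by linarith)
        have hlog' : Real.log n ≤ n := (Real.log_le_sub_one_of_pos (by linarith)).trans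
          (by linarith)
        have : C ≤ (n : ℝ) ^ q :=
          (le_max_left C 1).trans (hq.le.trans (pow_le_pow_left₀ (by norm_num) hn' q))
        exact mul_le_mul this hlog' hlog (by positivity)
  have h2 : (1 : ℝ) ≤ (n : ℝ) ^ (1 + 1 + q + c) := one_le_pow₀ (by linarith)
  calc 1 + n * d * (n : ℝ) ^ c ≤ 1 + n * ((n : ℝ) ^ q * n) * (n : ℝ) ^ c := by gcongr
    _ = 1 + (n : ℝ) ^ (1 + 1 + q + c) := by ring
    _ ≤ (n : ℝ) ^ (1 + 1 + q + c) * 2 := by linarith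
    _ ≤ (n : ℝ) ^ (1 + 1 + q + c) * n := by gcongr
    _ = _ := by ring

end Block

/-- The same program serves exact and approximate cotangents, since the given one tolerates any `G`
at distance at most `1` from the gradient. By linearity of the VJP, the input error only contributes
itself and its own VJP. -/
theorem residual_block (prim : ℕ → ℝ → ℝ) (PH : Prog) : ∃ PR : Prog,
      ∀ (C : ℝ) (F : Set Block) (TH δ : ℕ → ℝ),
        AlmostLinear TH →
        (∀ x ∈ F, x.Admissible C ∧ x.VJPRuns prim PH (TH x.n) (δ x.n)) →
        ∃ T : ℕ → ℝ, AlmostLinear T ∧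
          (∀ x ∈ F, DifferentiableAt ℝ x.lossX x.X ∧
            ∀ σ : Store, σ.HoldsMat 0 x.gradY →
              RunsIn prim x.input PR σ (T x.n) fun σ' =>
                ∃ O : Mat x.n x.d,
                  σ'.HoldsMat 1 O ∧ ‖O - x.gradX‖ ≤ δ x.n) ∧
          (∀ c : ℕ, (∀ x ∈ F, JacobianBound x.H x.X ((x.n : ℝ) ^ c)) →
            ∃ K : ℕ, ∀ k : ℕ, ∀ x ∈ F, ∀ (G : Mat x.n x.d)
              (σ : Store),
              ‖G - x.gradY‖ ≤ 1 / (x.n : ℝ) ^ (k + K) → σ.HoldsMat 0 G →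
              RunsIn prim x.input PR σ (T x.n) fun σ' =>
                ∃ O : Mat x.n x.d,
                  σ'.HoldsMat 1 O ∧ ‖O - x.gradX‖ ≤ 1 / (x.n : ℝ) ^ k + δ x.n) := by
  refine ⟨residualProg PH, fun C F TH δ hTH hF =>
    ⟨fun n => TH n + (n + 1) * (200 * (C * Real.log n + 1)), ?_, ?_, ?_⟩⟩
  -- The maximum with `0` provides the nonnegative factor that the product rule for growth rates
  -- requires, as `C` may be negative.
  · have hS : SubPolynomial fun n => max 0 (200 * (C * Real.log n + 1)) := by
      have h : SubPolynomial fun n => 200 * |C| * Real.log n + 200 :=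
        (SubPolynomial.log _).add (.const _)
      refine h.of_le ?_
      filter_upwards [eventually_ge_atTop 1] with n hn
      have hl : 0 ≤ Real.log n := Real.log_nonneg (by exact_mod_cast hn)
      have h2 : C * Real.log n ≤ |C| * Real.log n := by gcongr; exact le_abs_self C
      exact max_le (by positivity) (by linarith)
    have h2 := SubPolynomial.almostLinear_mul AlmostLinear.natCast_add_one hS
      (Eventually.of_forall fun n => le_max_left _ _)
    refine fun ε hε => ((hTH.add h2) ε hε).mono fun n hn => le_trans ?_ hn
    have := mul_le_mul_of_nonneg_left (le_max_right 0 (200 * (C * Real.log n + 1)))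
      (by positivity : (0 : ℝ) ≤ n + 1)
    linarith
  · intro x hx
    obtain ⟨hA, hV⟩ := hF x hx
    refine ⟨Block.differentiableAt_lossX hA, fun σ hσ => ?_⟩
    obtain ⟨σ', t, he, ht, O, hO, hδ⟩ := Block.residualProg_runs hA.input_n hA.input_d hV
      (G := x.gradY) (by simp) hσ
    refine ⟨σ', t, he, ht.trans ?_, _, hO, ?_⟩
    · have := mul_le_mul_of_nonneg_left hA.d_le (by positivity : (0 : ℝ) ≤ (x.n : ℝ) + 1)
      linarith
    · rw [Block.gradX_eq hA]
      simpa using hδ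
  · intro c hc
    obtain ⟨K, hK⟩ := Block.exists_pow_bound C c
    refine ⟨K, fun k x hx G σ hG hσ => ?_⟩
    obtain ⟨hA, hV⟩ := hF x hx
    -- Powers of `n` give no decay for `n < 2`. But `log 1 = 0` forces `d = 0` when `n = 1`, so in
    -- these cases the matrices are empty and there is no error.
    have hcases : 2 ≤ x.n ∨ (x.n = 1 ∧ x.d = 0) ∨ x.n = 0 := by
      rcases Nat.lt_or_ge x.n 2 with h | h
      · have h' : x.n = 1 ∨ x.n = 0 := by omega
        rcases h' with h1 | h0
        · have := hA.d_le
          rw [h1] at this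
          simp only [Nat.cast_one, Real.log_one, mul_zero] at this
          exact Or.inr (Or.inl ⟨h1, by exact_mod_cast le_antisymm this (Nat.cast_nonneg _)⟩)
        · exact Or.inr (Or.inr h0)
      · exact Or.inl h
    have hsmall : ‖G - x.gradY‖ ≤ 1 ∧
        ‖G - x.gradY‖ * (1 + x.n * x.d * (x.n : ℝ) ^ c) ≤ 1 / (x.n : ℝ) ^ k := by
      rcases hcases with h2 | h0 | h0
      · have hn : (2 : ℝ) ≤ x.n := by exact_mod_cast h2
        refine ⟨hG.trans ?_, ?_⟩
        · rw [div_le_one (by positivity)]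
          exact one_le_pow₀ (by linarith)
        · calc _ ≤ 1 / (x.n : ℝ) ^ (k + K) * (x.n : ℝ) ^ K :=
              mul_le_mul hG (hK _ _ h2 hA.d_le) (by positivity) (by positivity)
            _ = _ := by
              rw [pow_add]; field_simp
      all_goals
        have : ‖G - x.gradY‖ = 0 := le_antisymm (mat_norm_le le_rfl fun j k => by
          have hj := j.2; have hk := k.2; omega) (norm_nonneg _)
        rw [this]
        refine ⟨by norm_num, by rw [zero_mul]; positivity⟩
    obtain ⟨σ', t, he, ht, O, hO, hδ⟩ := Block.residualProg_runs hA.input_n hA.input_d hV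
      hsmall.1 hσ
    refine ⟨σ', t, he, ht.trans ?_, _, hO, ?_⟩
    · have := mul_le_mul_of_nonneg_left hA.d_le (by positivity : (0 : ℝ) ≤ (x.n : ℝ) + 1)
      linarith
    · rw [Block.gradX_eq hA]
      -- The three sources of error: the input error, its image under the VJP, and the error of the
      -- given program.
      have e : G + O - (x.gradY + vjp x.H x.X x.gradY) =
          (G - x.gradY) + vjp x.H x.X (G - x.gradY) + (O - vjp x.H x.X G) := by
        rw [vjp_sub]; abel
      rw [e]
      have h1 := norm_vjp_le (hc x hx) (G - x.gradY)
      calc _ ≤ ‖G - x.gradY‖ + ‖vjp x.H x.X (G - x.gradY)‖ + ‖O - vjp x.H x.X G‖ :=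
            norm_add₃_le
        _ ≤ ‖G - x.gradY‖ + x.n * x.d * (x.n : ℝ) ^ c * ‖G - x.gradY‖ + δ x.n := by gcongr
        _ = ‖G - x.gradY‖ * (1 + x.n * x.d * (x.n : ℝ) ^ c) + δ x.n := by ring
        _ ≤ _ := by linarith [hsmall.2]

/-! ### The backward pass through attention -/

section Attention

variable {n d : ℕ}

/-- The matrix of attention scores. -/
def scores (W : Mat d d) (A B : Mat n d) : Mat n n := (1 / (d : ℝ)) • (A * W * B.transpose)

/-- The cotangent of the attention scores, if `f` is the attention matrix, `H` the matrix of values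
and `G` the cotangent of the output. -/
def scoreCotangent (f : Mat n n) (H G : Mat n d) : Mat n n :=
  Matrix.of fun j k => f j k * ((∑ a, G j a * H k a) - ∑ a, G j a * ∑ k', f j k' * H k' a)

/-- The backward pass through attention, in terms of the attention matrix `f`, the matrices
`X = A W / d`, `Y = A Wᵀ / d`, the matrix of values `H`, the value weights `V` and
the cotangent `G`. -/
def attnBackward (f : Mat n n) (X Y H : Mat n d) (V : Mat d d) (G : Mat n d) : Mat n d :=
  Matrix.of fun k b => (∑ j, f j k * ∑ a, G j a * V b a) +
    ((∑ j, scoreCotangent f H G j k * X j b) + ∑ k', scoreCotangent f H G k k' * Y k' b)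

theorem attn_apply (WQ WK WV : Mat d d) (A : Mat n d) (j : Fin n) (b : Fin d) :
    attn WQ WK WV A j b =
      ∑ k, (Real.exp (scores (WQ * WK.transpose) A A j k) /
        ∑ k', Real.exp (scores (WQ * WK.transpose) A A j k')) * (A * WV) k b := by
  rw [attn, Matrix.mul_assoc, Matrix.mul_apply]
  rfl

theorem scores_apply (W : Mat d d) (A B : Mat n d) (j k : Fin n) :
    scores W A B j k = 1 / (d : ℝ) * ∑ b, (∑ a, A j a * W a b) * B k b := by
  simp [scores, Matrix.mul_apply]

theorem sum_exp_pos {n : ℕ} (S : Mat n n) (j : Fin n) : 0 < ∑ k, Real.exp (S j k) :=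
  Finset.sum_pos (fun _ _ => Real.exp_pos _) ⟨j, Finset.mem_univ j⟩

theorem differentiable_entry (j : Fin n) (k : Fin d) :
    Differentiable ℝ fun A : Mat n d => A j k := by
  have h' : (fun A : Mat n d => A j k) =
      ((ContinuousLinearMap.proj (R := ℝ) (φ := fun _ : Fin d => ℝ) k).comp
        (ContinuousLinearMap.proj (R := ℝ) (φ := fun _ : Fin n => Fin d → ℝ) j)) := rfl
  exact h' ▸ ContinuousLinearMap.differentiable _

theorem differentiableAt_of_entries {E : Type*} [NormedAddCommGroup E] [NormedSpace ℝ E]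
    {f : E → Mat n d} {x : E} (h : ∀ j k, DifferentiableAt ℝ (fun A => f A j k) x) :
    DifferentiableAt ℝ f x := by
  refine differentiableAt_pi.2 fun j => ?_
  exact differentiableAt_pi.2 fun k => h j k

/-- Entrywise, attention is built from polynomials and exponentials with division by sums of
exponentials, which are positive. -/
theorem differentiable_attn (WQ WK WV : Mat d d) :
    Differentiable ℝ (attn (n := n) WQ WK WV) := by
  intro A
  refine differentiableAt_of_entries fun j b => ?_
  have hs : ∀ j k, DifferentiableAt ℝ
      (fun A : Mat n d => scores (WQ * WK.transpose) A A j k) A := by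
    intro j k
    simp only [scores_apply]
    refine (DifferentiableAt.fun_sum fun b _ => DifferentiableAt.mul
      (DifferentiableAt.fun_sum fun a _ => ?_) (differentiable_entry k b A)).const_mul _
    exact (differentiable_entry j a A).mul_const _
  have hv : ∀ k b, DifferentiableAt ℝ (fun A : Mat n d => (A * WV) k b) A := by
    intro k b
    simp only [Matrix.mul_apply]
    exact DifferentiableAt.fun_sum fun a _ => (differentiable_entry k a A).mul_const _
  simp only [attn_apply]
  refine DifferentiableAt.fun_sum fun k _ => DifferentiableAt.mul ?_ (hv k b)
  have h1 := (hs j k).exp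
  have h2 : DifferentiableAt ℝ (fun A : Mat n d => ∑ k',
      Real.exp (scores (WQ * WK.transpose) A A j k')) A :=
    DifferentiableAt.fun_sum fun k' _ => (hs j k').exp
  simp only [div_eq_mul_inv]
  exact h1.fun_mul (h2.fun_inv (sum_exp_pos _ j).ne')

/-- The derivative of a function on matrices, along a line, entry by entry. -/
theorem fderiv_entry_eq {H : Mat n d → Mat n d} {A V : Mat n d} (hH : DifferentiableAt ℝ H A)
    {j : Fin n} {k : Fin d} {y : ℝ} (h : HasDerivAt (fun t : ℝ => H (A + t • V) j k) y 0) :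
    fderiv ℝ H A V j k = y := by
  have h1 : HasDerivAt (fun t : ℝ => A + t • V) V 0 := by
    have := ((hasDerivAt_id (0 : ℝ)).smul_const V).const_add A
    rw [one_smul] at this
    exact this
  have h2 : HasFDerivAt H (fderiv ℝ H A) (A + (0 : ℝ) • V) := by
    simpa using hH.hasFDerivAt
  have h3 : HasDerivAt (fun t : ℝ => H (A + t • V)) (fderiv ℝ H A V) 0 :=
    h2.comp_hasDerivAt (0 : ℝ) h1
  have h4 : HasDerivAt (fun t : ℝ => H (A + t • V) j) (fderiv ℝ H A V j) 0 :=
    hasDerivAt_pi.1 h3 j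
  have h5 : HasDerivAt (fun t : ℝ => H (A + t • V) j k) (fderiv ℝ H A V j k) 0 :=
    hasDerivAt_pi.1 h4 k
  exact h5.unique h

/-- The derivative of the attention scores in the direction `V`. -/
theorem hasDerivAt_scores (W : Mat d d) (A V : Mat n d) (j k : Fin n) :
    HasDerivAt (fun t : ℝ => scores W (A + t • V) (A + t • V) j k)
      (scores W V A j k + scores W A V j k) 0 := by
  have he : ∀ (i : Fin n) (a : Fin d), HasDerivAt (fun t : ℝ => (A + t • V) i a) (V i a) 0 := by
    intro i a
    have := ((hasDerivAt_id (0 : ℝ)).mul_const (V i a)).const_add (A i a)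
    rw [one_mul] at this
    exact this
  have h1 : ∀ b, HasDerivAt (fun t : ℝ => ∑ a, (A + t • V) j a * W a b) (∑ a, V j a * W a b) 0 :=
    fun b => HasDerivAt.fun_sum fun a _ => (he j a).mul_const _
  simp only [scores_apply]
  have h2 := (HasDerivAt.fun_sum (u := Finset.univ) fun b _ => (h1 b).fun_mul (he k b)).const_mul
    (1 / (d : ℝ))
  refine h2.congr_deriv ?_
  simp only [zero_smul, add_zero, Finset.sum_add_distrib, mul_add]

/-- The logarithmic derivative of a softmax entry is the derivative of its score minus the average
of these derivatives under the softmax weights. -/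
theorem hasDerivAt_div_sum_exp {S : ℝ → Fin n → ℝ} {S' : Fin n → ℝ}
    (hS : ∀ k, HasDerivAt (fun t => S t k) (S' k) 0) (k : Fin n) :
    HasDerivAt (fun t => Real.exp (S t k) / ∑ k', Real.exp (S t k'))
      (Real.exp (S 0 k) / (∑ k', Real.exp (S 0 k')) *
        (S' k - ∑ k', Real.exp (S 0 k') / (∑ k'', Real.exp (S 0 k'')) * S' k')) 0 := by
  have hpos : 0 < ∑ k', Real.exp (S 0 k') :=
    Finset.sum_pos (fun _ _ => Real.exp_pos _) ⟨k, Finset.mem_univ k⟩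
  have h := (hS k).exp.fun_div (HasDerivAt.fun_sum (u := Finset.univ) fun k' _ => (hS k').exp)
    hpos.ne'
  refine h.congr_deriv ?_
  have : ∑ k', Real.exp (S 0 k') / (∑ k'', Real.exp (S 0 k'')) * S' k' =
      (∑ k', Real.exp (S 0 k') * S' k') / ∑ k'', Real.exp (S 0 k'') := by
    rw [Finset.sum_div]
    exact Finset.sum_congr rfl fun _ _ => by ring
  rw [this]
  field_simp

/-- The derivative of attention in the direction `V`. -/
theorem fderiv_attn (WQ WK WV : Mat d d) (A V : Mat n d) (j : Fin n) (b : Fin d) :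
    fderiv ℝ (attn WQ WK WV) A V j b =
      ∑ k, (softmax (scores (WQ * WK.transpose) A A) j k *
        ((scores (WQ * WK.transpose) V A j k + scores (WQ * WK.transpose) A V j k) -
          ∑ k', softmax (scores (WQ * WK.transpose) A A) j k' *
            (scores (WQ * WK.transpose) V A j k' + scores (WQ * WK.transpose) A V j k')) *
          (A * WV) k b + softmax (scores (WQ * WK.transpose) A A) j k * (V * WV) k b) := by
  refine fderiv_entry_eq (differentiable_attn WQ WK WV A) ?_
  simp only [attn_apply]
  have hv : ∀ k, HasDerivAt (fun t : ℝ => ((A + t • V) * WV) k b) ((V * WV) k b) 0 := by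
    intro k
    have := ((hasDerivAt_id (0 : ℝ)).mul_const ((V * WV) k b)).const_add ((A * WV) k b)
    rw [one_mul] at this
    simp only [Matrix.add_mul, Matrix.smul_mul]
    exact this
  have h := HasDerivAt.fun_sum (u := Finset.univ) fun k _ => (hasDerivAt_div_sum_exp
    (S := fun t k => scores (WQ * WK.transpose) (A + t • V) (A + t • V) j k)
    (fun k => hasDerivAt_scores (WQ * WK.transpose) A V j k) k).fun_mul (hv k)
  simp only [zero_smul, add_zero] at h
  exact h

/-- The scores are bilinear in the two places where the argument occurs. Isolating the direction `V`
in the left place produces the matrix `Y`; in the right place (`scores_right`) it produces `X`. -/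
theorem scores_left (W : Mat d d) (A V : Mat n d) (j k : Fin n) :
    scores W V A j k = ∑ b, V j b * ((1 / (d : ℝ)) • (A * W.transpose)) k b := by
  simp only [scores, Matrix.smul_apply, Matrix.mul_assoc, smul_eq_mul]
  rw [Matrix.mul_apply, Finset.mul_sum]
  refine Finset.sum_congr rfl fun b _ => ?_
  rw [← Matrix.transpose_apply (A * W.transpose), Matrix.transpose_mul, Matrix.transpose_transpose]
  ring

theorem scores_right (W : Mat d d) (A V : Mat n d) (j k : Fin n) :
    scores W A V j k = ∑ b, ((1 / (d : ℝ)) • (A * W)) j b * V k b := by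
  simp only [scores, Matrix.smul_apply, smul_eq_mul]
  rw [Matrix.mul_apply, Finset.mul_sum]
  exact Finset.sum_congr rfl fun b _ => by rw [Matrix.transpose_apply]; ring

/-- The argument enters through the values and twice through the scores, which gives the three sums
of `attnBackward`. Each contribution to the derivative, paired with `G`, is rearranged into a
pairing with `V`. -/
theorem vjp_attn (WQ WK WV : Mat d d) (A G : Mat n d) :
    vjp (attn WQ WK WV) A G =
      attnBackward (softmax (scores (WQ * WK.transpose) A A))
        ((1 / (d : ℝ)) • (A * (WQ * WK.transpose)))
        ((1 / (d : ℝ)) • (A * (WQ * WK.transpose).transpose)) (A * WV) WV G := by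
  set W := WQ * WK.transpose
  set f := softmax (scores W A A) with hf
  set X := (1 / (d : ℝ)) • (A * W) with hX
  set Y := (1 / (d : ℝ)) • (A * W.transpose) with hY
  set H := A * WV with hH
  refine eq_of_pairing_eq fun V => ?_
  rw [pairing_vjp]
  set S' : Mat n n := Matrix.of fun j k => scores W V A j k + scores W A V j k with hS'
  set P := scoreCotangent f H G with hP
  have hfd : ∀ j b, fderiv ℝ (attn WQ WK WV) A V j b =
      ∑ k, (f j k * (S' j k - ∑ k', f j k' * S' j k') * H k b + f j k * (V * WV) k b) :=
    fun j b => fderiv_attn WQ WK WV A V j b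
  -- The Jacobian of softmax on row `j` is `diag(f_j) - f_j f_jᵀ`. It is symmetric, so it can be
  -- moved from the derivative `S'` of the scores to the cotangent, where it produces `P`.
  have hSP : ∀ j, ∑ b, G j b * ∑ k, f j k * (S' j k - ∑ k', f j k' * S' j k') * H k b =
      ∑ k, P j k * S' j k := by
    intro j
    have e1 : ∑ b, G j b * ∑ k, f j k * (S' j k - ∑ k', f j k' * S' j k') * H k b =
        ∑ k, f j k * (S' j k - ∑ k', f j k' * S' j k') * ∑ b, G j b * H k b := by
      generalize ∑ k', f j k' * S' j k' = σ
      simp only [Finset.mul_sum]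
      rw [Finset.sum_comm]
      exact Finset.sum_congr rfl fun _ _ => Finset.sum_congr rfl fun _ _ => by ring
    rw [e1]
    have e2 : ∑ a, G j a * ∑ k', f j k' * H k' a = ∑ k, (∑ b, G j b * H k b) * f j k := by
      simp only [Finset.mul_sum, Finset.sum_mul]
      rw [Finset.sum_comm]
      exact Finset.sum_congr rfl fun _ _ => Finset.sum_congr rfl fun _ _ => by ring
    simp only [hP, scoreCotangent, Matrix.of_apply, e2]
    set c : Fin n → ℝ := fun k => ∑ b, G j b * H k b
    have e3 : (∑ k, c k * f j k) * ∑ k, f j k * S' j k = (∑ k, f j k * S' j k) *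
      ∑ k, f j k * c k := by
      rw [mul_comm]
      simp only [mul_comm]
    calc ∑ k, f j k * (S' j k - ∑ k', f j k' * S' j k') * c k
        = ∑ k, f j k * S' j k * c k - (∑ k, f j k * S' j k) * ∑ k, f j k * c k := by
          rw [Finset.mul_sum, ← Finset.sum_sub_distrib]
          exact Finset.sum_congr rfl fun _ _ => by ring
      _ = ∑ k, f j k * (c k - ∑ k, c k * f j k) * S' j k := by
          rw [← e3, Finset.mul_sum, ← Finset.sum_sub_distrib]
          exact Finset.sum_congr rfl fun _ _ => by ring
  have hV : ∑ j, ∑ b, G j b * ∑ k, f j k * (V * WV) k b =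
      ∑ k, ∑ b, (∑ j, f j k * ∑ a, G j a * WV b a) * V k b := by
    simp only [Matrix.mul_apply, Finset.mul_sum, Finset.sum_mul]
    calc _ = ∑ j, ∑ k, ∑ a, ∑ b, G j a * (f j k * (V k b * WV b a)) := by
          refine Finset.sum_congr rfl fun j _ => ?_
          rw [Finset.sum_comm]
      _ = ∑ k, ∑ j, ∑ b, ∑ a, G j a * (f j k * (V k b * WV b a)) := by
          rw [Finset.sum_comm]
          exact Finset.sum_congr rfl fun k _ => Finset.sum_congr rfl fun j _ => Finset.sum_comm
      _ = _ := by
          refine Finset.sum_congr rfl fun k _ => ?_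
          rw [Finset.sum_comm]
          exact Finset.sum_congr rfl fun _ _ => Finset.sum_congr rfl fun _ _ =>
            Finset.sum_congr rfl fun _ _ => by ring
  -- The direction in the left place is indexed by the row of the score, the one in the right place
  -- by its column; hence the rows of `P` meet `Y` and its columns meet `X`.
  have hPS : ∑ j, ∑ k, P j k * S' j k =
      ∑ k, ∑ b, ((∑ j, P j k * X j b) + ∑ k', P k k' * Y k' b) * V k b := by
    have e1 : ∑ j, ∑ k, P j k * scores W V A j k = ∑ k, ∑ b, (∑ k', P k k' * Y k' b) * V k b := by
      refine Finset.sum_congr rfl fun j _ => ?_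
      simp only [scores_left, ← hY, Finset.mul_sum, Finset.sum_mul]
      rw [Finset.sum_comm]
      exact Finset.sum_congr rfl fun _ _ => Finset.sum_congr rfl fun _ _ => by ring
    have e2 : ∑ j, ∑ k, P j k * scores W A V j k = ∑ k, ∑ b, (∑ j, P j k * X j b) * V k b := by
      rw [Finset.sum_comm]
      refine Finset.sum_congr rfl fun k _ => ?_
      simp only [scores_right, ← hX, Finset.mul_sum, Finset.sum_mul]
      rw [Finset.sum_comm]
      exact Finset.sum_congr rfl fun _ _ => Finset.sum_congr rfl fun _ _ => by ring
    simp only [hS', Matrix.of_apply, mul_add, add_mul, Finset.sum_add_distrib, e1, e2]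
    rw [add_comm]
  calc pairing G (fderiv ℝ (attn WQ WK WV) A V)
      = ∑ j, ∑ k, P j k * S' j k + ∑ j, ∑ b, G j b * ∑ k, f j k * (V * WV) k b := by
        simp only [pairing, hfd, Finset.sum_add_distrib, mul_add, hSP]
    _ = pairing (attnBackward f X Y H WV G) V := by
        rw [hV, hPS, add_comm]
        simp only [pairing, attnBackward, Matrix.of_apply, add_mul, Finset.sum_add_distrib]
        rfl

end Attention

/-! ### Perturbation of the attention matrix -/

section Perturbation

variable {n d : ℕ}

theorem abs_sum_fin_le {m : ℕ} {u : Fin m → ℝ} {β B : ℝ} (hm : (m : ℝ) ≤ β) (hB : 0 ≤ B)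
    (h : ∀ a, |u a| ≤ B) : |∑ a, u a| ≤ β * B := by
  calc |∑ a, u a| ≤ ∑ a, |u a| := Finset.abs_sum_le_sum_abs _ _
    _ ≤ ∑ _a : Fin m, B := Finset.sum_le_sum fun a _ => h a
    _ = m * B := by simp
    _ ≤ β * B := by gcongr

theorem abs_mul_le_of_le {x y a b : ℝ} (hx : |x| ≤ a) (hy : |y| ≤ b) : |x * y| ≤ a * b := by
  rw [abs_mul]
  exact mul_le_mul hx hy (abs_nonneg _) ((abs_nonneg _).trans hx)

/-- All data of the backward pass through attention are at most `β`, apart from the cotangent. -/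
structure AttnData (X Y H : Mat n d) (V : Mat d d) (β : ℝ) : Prop where
  one_le : 1 ≤ β
  n_le : (n : ℝ) ≤ β
  d_le : (d : ℝ) ≤ β
  X_le : ‖X‖ ≤ β
  Y_le : ‖Y‖ ≤ β
  H_le : ‖H‖ ≤ β
  V_le : ‖V‖ ≤ β

variable {X Y H : Mat n d} {V : Mat d d} {β : ℝ}

theorem AttnData.abs_rowDot_le (h : AttnData X Y H V β) (G : Mat n d) (j k : Fin n) :
    |∑ a, G j a * H k a| ≤ β * (‖G‖ * β) :=
  have := h.one_le
  abs_sum_fin_le h.d_le (by positivity) fun a =>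
    abs_mul_le_of_le (abs_entry_le_norm G j a) ((abs_entry_le_norm H k a).trans h.H_le)

theorem AttnData.abs_rho_le (h : AttnData X Y H V β) {f : Mat n n} {η : ℝ} (hη : 0 ≤ η)
    (hf : ∀ j k, |f j k| ≤ η) (G : Mat n d) (j : Fin n) :
    |∑ a, G j a * ∑ k, f j k * H k a| ≤ β * (‖G‖ * (β * (η * β))) :=
  have := h.one_le
  abs_sum_fin_le h.d_le (by positivity) fun a =>
    abs_mul_le_of_le (abs_entry_le_norm G j a) (abs_sum_fin_le h.n_le (by positivity) fun k =>
      abs_mul_le_of_le (hf j k) ((abs_entry_le_norm H k a).trans h.H_le))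

theorem AttnData.abs_rho_sub_le (h : AttnData X Y H V β) {f f' : Mat n n} {η : ℝ} (hη : 0 ≤ η)
    (hf : ∀ j k, |f' j k - f j k| ≤ η) (G : Mat n d) (j : Fin n) :
    |(∑ a, G j a * ∑ k, f' j k * H k a) - ∑ a, G j a * ∑ k, f j k * H k a| ≤
      β * (‖G‖ * (β * (η * β))) := by
  have := h.abs_rho_le (f := f' - f) hη hf G j
  simpa only [Matrix.sub_apply, sub_mul, Finset.sum_sub_distrib, mul_sub] using this

theorem AttnData.abs_scoreCotangent_le (h : AttnData X Y H V β) {f : Mat n n}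
    (hf : ∀ j k, |f j k| ≤ 1) (G : Mat n d) (j k : Fin n) :
    |scoreCotangent f H G j k| ≤ 2 * (‖G‖ * β ^ 3) := by
  have h1 := h.one_le
  have h2 := h.abs_rowDot_le G j k
  have h3 := h.abs_rho_le zero_le_one hf G j
  have h4 : β ^ 2 ≤ β ^ 3 := pow_le_pow_right₀ h1 (by norm_num)
  have h5 := mul_le_mul_of_nonneg_left h4 (norm_nonneg G)
  have h6 := abs_mul_le_of_le (hf j k) ((abs_sub _ _).trans (add_le_add h2 h3))
  simp only [scoreCotangent, Matrix.of_apply]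
  refine h6.trans ?_
  calc _ = ‖G‖ * β ^ 2 + ‖G‖ * β ^ 3 := by ring
    _ ≤ _ := by linarith

/-- The score cotangent is quadratic in `f`: besides the outer factor, the mean `ρ` depends on it.
The difference is split by changing one factor at a time. -/
theorem AttnData.abs_scoreCotangent_sub_le (h : AttnData X Y H V β) {f f' : Mat n n} {η : ℝ}
    (hη : 0 ≤ η) (hη1 : η ≤ 1) (hf1 : ∀ j k, |f j k| ≤ 1) (hf : ∀ j k, |f' j k - f j k| ≤ η)
    (G : Mat n d) (j k : Fin n) :
    |scoreCotangent f' H G j k - scoreCotangent f H G j k| ≤ 4 * (η * (‖G‖ * β ^ 3)) := by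
  have h1 := h.one_le
  have h2 := h.abs_rowDot_le G j k
  have h3 := h.abs_rho_le zero_le_one hf1 G j
  have h4 : β ^ 2 ≤ β ^ 3 := pow_le_pow_right₀ h1 (by norm_num)
  have h5 := mul_le_mul_of_nonneg_left h4 (norm_nonneg G)
  have h6 := h.abs_rho_sub_le hη hf G j
  -- The perturbed matrix need not have entries at most `1`; it is within `η ≤ 1` of one that has.
  have h7 : |f' j k| ≤ 2 := by
    have := abs_add_le (f' j k - f j k) (f j k)
    rw [sub_add_cancel] at this
    linarith [hf j k, hf1 j k]
  simp only [scoreCotangent, Matrix.of_apply]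
  set c := ∑ a, G j a * H k a
  set ρ := ∑ a, G j a * ∑ k', f j k' * H k' a
  set ρ' := ∑ a, G j a * ∑ k', f' j k' * H k' a
  have e : f' j k * (c - ρ') - f j k * (c - ρ) =
      (f' j k - f j k) * (c - ρ) - f' j k * (ρ' - ρ) := by ring
  rw [e]
  have h8 := abs_mul_le_of_le (hf j k) ((abs_sub c ρ).trans (add_le_add h2 h3))
  have h9 := abs_mul_le_of_le h7 h6
  refine (abs_sub _ _).trans ((add_le_add h8 h9).trans ?_)
  calc _ = η * (‖G‖ * β ^ 2) + 3 * (η * (‖G‖ * β ^ 3)) := by ring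
    _ ≤ _ := by linarith [mul_le_mul_of_nonneg_left h5 hη]

/-- The three sums of the backward pass through attention, for general coefficients. -/
theorem AttnData.norm_le (h : AttnData X Y H V β) {f P : Mat n n} {G : Mat n d} {p q : ℝ}
    (hp : 0 ≤ p) (hq : 0 ≤ q) (hf : ∀ j k, |f j k| ≤ p) (hP : ∀ j k, |P j k| ≤ q) :
    ‖(Matrix.of fun k b => (∑ j, f j k * ∑ a, G j a * V b a) +
      ((∑ j, P j k * X j b) + ∑ k', P k k' * Y k' b) : Mat n d)‖ ≤
      p * (‖G‖ * β ^ 3) + 2 * (q * β ^ 2) := by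
  have h1 := h.one_le
  refine mat_norm_le (by positivity) fun k b => ?_
  simp only [Matrix.of_apply]
  have s1 : |∑ j, f j k * ∑ a, G j a * V b a| ≤ β * (p * (β * (‖G‖ * β))) :=
    abs_sum_fin_le h.n_le (by positivity) fun j => abs_mul_le_of_le (hf j k)
      (abs_sum_fin_le h.d_le (by positivity) fun a => abs_mul_le_of_le (abs_entry_le_norm G j a)
        ((abs_entry_le_norm V b a).trans h.V_le))
  have s2 : |∑ j, P j k * X j b| ≤ β * (q * β) :=
    abs_sum_fin_le h.n_le (by positivity) fun j => abs_mul_le_of_le (hP j k)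
      ((abs_entry_le_norm X j b).trans h.X_le)
  have s3 : |∑ k', P k k' * Y k' b| ≤ β * (q * β) :=
    abs_sum_fin_le h.n_le (by positivity) fun j => abs_mul_le_of_le (hP k j)
      ((abs_entry_le_norm Y j b).trans h.Y_le)
  refine (abs_add_three _ _ _ |>.trans' (le_of_eq (by rw [add_assoc]))).trans ?_
  refine (add_le_add (add_le_add s1 s2) s3).trans (le_of_eq (by ring))

theorem AttnData.norm_attnBackward_le (h : AttnData X Y H V β) {f : Mat n n}
    (hf : ∀ j k, |f j k| ≤ 1) (G : Mat n d) : ‖attnBackward f X Y H V G‖ ≤ 5 * β ^ 5 * ‖G‖ := by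
  have h1 := h.one_le
  refine (h.norm_le zero_le_one (by positivity) hf (h.abs_scoreCotangent_le hf G)).trans ?_
  have h4 : β ^ 3 ≤ β ^ 5 := pow_le_pow_right₀ h1 (by norm_num)
  have h5 := mul_le_mul_of_nonneg_left h4 (norm_nonneg G)
  calc _ = ‖G‖ * β ^ 3 + 4 * (‖G‖ * β ^ 5) := by ring
    _ ≤ _ := by linarith

/-- The outer sums are linear in the pair of the attention matrix and the score cotangent, so the
general estimate applies to the differences of both: `1 + 2 · 4 = 9`. -/
theorem AttnData.norm_attnBackward_sub_le (h : AttnData X Y H V β) {f f' : Mat n n} {η : ℝ}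
    (hη : 0 ≤ η) (hη1 : η ≤ 1) (hf1 : ∀ j k, |f j k| ≤ 1) (hf : ∀ j k, |f' j k - f j k| ≤ η)
    (G : Mat n d) :
    ‖attnBackward f' X Y H V G - attnBackward f X Y H V G‖ ≤ 9 * β ^ 5 * (η * ‖G‖) := by
  have h1 := h.one_le
  have h2 := h.norm_le (G := G) (f := f' - f)
    (P := scoreCotangent f' H G - scoreCotangent f H G) hη
    (by positivity) hf (h.abs_scoreCotangent_sub_le hη hη1 hf1 hf G)
  have e : attnBackward f' X Y H V G - attnBackward f X Y H V G =
      Matrix.of fun k b => (∑ j, (f' - f) j k * ∑ a, G j a * V b a) +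
      ((∑ j, (scoreCotangent f' H G - scoreCotangent f H G) j k * X j b) +
        ∑ k', (scoreCotangent f' H G - scoreCotangent f H G) k k' * Y k' b) := by
    ext k b
    simp only [attnBackward, Matrix.sub_apply, Matrix.of_apply, sub_mul, Finset.sum_sub_distrib]
    ring
  rw [e]
  refine h2.trans ?_
  have h4 : β ^ 3 ≤ β ^ 5 := pow_le_pow_right₀ h1 (by norm_num)
  have h5 := mul_le_mul_of_nonneg_left (mul_le_mul_of_nonneg_left h4 (norm_nonneg G)) hη
  calc _ = η * (‖G‖ * β ^ 3) + 8 * (η * (‖G‖ * β ^ 5)) := by ring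
    _ ≤ _ := by linarith

theorem abs_softmax_le_one (S : Mat n n) (j k : Fin n) : |softmax S j k| ≤ 1 := by
  have h := sum_exp_pos S j
  simp only [softmax, Matrix.of_apply]
  rw [abs_of_nonneg (by positivity), div_le_one h]
  exact Finset.single_le_sum (f := fun k => Real.exp (S j k)) (fun _ _ => (Real.exp_pos _).le)
    (Finset.mem_univ k)

/-- A relative error of the exponentials gives an error of softmax. -/
theorem abs_softmax_sub_le {S E : Mat n n} {θ : ℝ} (hθ : θ ≤ 1 / 2)
    (hE : ∀ j k, |E j k - Real.exp (S j k)| ≤ θ * Real.exp (S j k)) (j k : Fin n) :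
    |E j k / (∑ k', E j k') - softmax S j k| ≤ 4 * θ := by
  have hD := sum_exp_pos S j
  have h0 : 0 ≤ θ := by
    have := (abs_nonneg _).trans (hE j k)
    exact nonneg_of_mul_nonneg_left this (Real.exp_pos _)
  set D := ∑ k', Real.exp (S j k') with hDdef
  have hD' : |(∑ k', E j k') - D| ≤ θ * D := by
    rw [hDdef, ← Finset.sum_sub_distrib, Finset.mul_sum]
    exact (Finset.abs_sum_le_sum_abs _ _).trans (Finset.sum_le_sum fun k' _ => hE j k')
  set D' := ∑ k', E j k'
  -- Since `θ ≤ 1 / 2`, the perturbed denominator keeps at least half of its size; this turns the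
  -- constant `2` into `4`.
  have hDpos : D / 2 ≤ D' := by
    have := (abs_le.1 hD').1
    nlinarith
  have hD'pos : 0 < D' := by linarith
  have hs : Real.exp (S j k) ≤ D :=
    Finset.single_le_sum (f := fun k => Real.exp (S j k)) (fun _ _ => (Real.exp_pos _).le)
      (Finset.mem_univ k)
  have hx := Real.exp_pos (S j k)
  have he := hE j k
  simp only [softmax, Matrix.of_apply]
  change |E j k / D' - Real.exp (S j k) / D| ≤ 4 * θ
  set x := Real.exp (S j k)
  have e : E j k / D' - x / D = ((E j k - x) * D - x * (D' - D)) / (D' * D) := by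
    field_simp
    ring
  rw [e, abs_div, abs_of_pos (mul_pos hD'pos hD), div_le_iff₀ (mul_pos hD'pos hD)]
  calc |(E j k - x) * D - x * (D' - D)| ≤ |(E j k - x) * D| + |x * (D' - D)| := abs_sub _ _
    _ ≤ θ * x * D + x * (θ * D) := by
      rw [abs_mul, abs_mul, abs_of_pos hD, abs_of_pos hx]
      gcongr
    _ = 2 * θ * D * x := by ring
    _ ≤ 2 * θ * D * D := by gcongr
    _ = 4 * θ * (D / 2 * D) := by ring
    _ ≤ 4 * θ * (D' * D) := by gcongr

end Perturbation

/-! ### Truncation of the exponential series -/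

/-- As `N! s!` divides `(s + N)!`, each term of the tail is at most `r ^ N / N!` times the term with
index `s` of the full series. -/
theorem exp_sub_sum_le {r : ℝ} (hr : 0 ≤ r) (N : ℕ) :
    Real.exp r - ∑ s ∈ Finset.range N, r ^ s / s.factorial ≤
      r ^ N / N.factorial * Real.exp r := by
  have hsum := NormedSpace.expSeries_div_summable (𝔸 := ℝ) r
  have hexp : Real.exp r = ∑' s : ℕ, r ^ s / s.factorial := by
    rw [Real.exp_eq_exp_ℝ, NormedSpace.exp_eq_tsum_div]
  have h1 := hsum.sum_add_tsum_nat_add N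
  rw [← hexp] at h1
  have h2 : Real.exp r - ∑ s ∈ Finset.range N, r ^ s / s.factorial =
      ∑' s : ℕ, r ^ (s + N) / (s + N).factorial := by linarith
  rw [h2, hexp, ← tsum_mul_left]
  refine Summable.tsum_le_tsum (fun s => ?_) ((summable_nat_add_iff N).2 hsum)
    (hsum.mul_left _)
  have h3 : (N.factorial * s.factorial : ℝ) ≤ ((s + N).factorial : ℝ) := by
    have := Nat.le_of_dvd (Nat.factorial_pos _) (Nat.factorial_mul_factorial_dvd_factorial_add N s)
    rw [add_comm]
    exact_mod_cast this
  rw [div_mul_div_comm, pow_add, mul_comm (r ^ s)]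
  gcongr

/-- The remainder at `t`, of either sign, is dominated by the remainder at `|t|`, and this bound is
monotone in `|t|`. -/
theorem abs_sum_sub_exp_le {t r : ℝ} (ht : |t| ≤ r) (N : ℕ) :
    |∑ s ∈ Finset.range N, t ^ s / s.factorial - Real.exp t| ≤
      r ^ N / N.factorial * Real.exp r := by
  have hr : 0 ≤ r := (abs_nonneg t).trans ht
  have h := Complex.norm_exp_sub_sum_le_exp_norm_sub_sum (t : ℂ) N
  have e : Complex.exp t - ∑ m ∈ Finset.range N, (t : ℂ) ^ m / m.factorial =
      ((Real.exp t - ∑ s ∈ Finset.range N, t ^ s / s.factorial : ℝ) : ℂ) := by push_cast; rfl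
  rw [e, Complex.norm_real, Complex.norm_real, Real.norm_eq_abs, Real.norm_eq_abs] at h
  rw [abs_sub_comm]
  refine h.trans ((exp_sub_sum_le (abs_nonneg t) N).trans ?_)
  gcongr

/-- If `r` is small, the terms of the exponential series soon become tiny. -/
theorem pow_div_factorial_le {r lam : ℝ} (hr : 0 ≤ r) (hlam : 0 < lam) (s : ℕ) :
    r ^ s / s.factorial ≤ Real.exp (lam * r) / lam ^ s := by
  rw [le_div_iff₀ (by positivity)]
  have := Real.pow_div_factorial_le_exp (lam * r) (by positivity) s
  calc r ^ s / s.factorial * lam ^ s = (lam * r) ^ s / s.factorial := by rw [mul_pow]; ring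
    _ ≤ _ := this

/-! ### Monomials -/

/-- A monomial: its degree, and its values at two families of points (for the second one
without the coefficient). -/
structure Node where
  deg : ℕ
  u : ℕ → ℝ
  v : ℕ → ℝ

namespace Node

/-- Multiplication by the `e`-th power of a new variable with values `x` and `y`. -/
def shift (x y : ℕ → ℝ) (e : ℕ) (ν : Node) : Node where
  deg := ν.deg + e
  u j := ν.u j * (x j ^ e / e.factorial)
  v k := ν.v k * y k ^ e

/-- The multiples of a monomial by positive powers of a new variable, up to degree `g`. -/
def chain (g : ℕ) (x y : ℕ → ℝ) (ν : Node) : List Node :=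
  (List.range (g - ν.deg)).map fun e => ν.shift x y (e + 1)

/-- The monomials of degree at most `g` in `b` variables. -/
def list (g : ℕ) (x y : ℕ → ℕ → ℝ) : ℕ → List Node
  | 0 => [⟨0, fun _ => 1, fun _ => 1⟩]
  | b + 1 => list g x y b ++
      (list g x y b).flatMap (chain g (fun j => x j b) (fun k => y k b))

theorem shift_zero (x y : ℕ → ℝ) (ν : Node) : ν.shift x y 0 = ν := by
  cases ν; simp [shift]

theorem shift_succ (x y : ℕ → ℝ) (e : ℕ) (ν : Node) :
    ν.shift x y (e + 1) = ⟨(ν.shift x y e).deg + 1, fun j => (ν.shift x y e).u j * x j / (e + 1),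
      fun k => (ν.shift x y e).v k * y k⟩ := by
  simp only [shift, Node.mk.injEq]
  refine ⟨by ring, ?_, ?_⟩
  · funext j
    rw [Nat.factorial_succ]
    push_cast
    field_simp
    ring
  · funext k
    ring

/-- The list keeps the old monomials and appends their multiples by positive powers; together these
are all exponents `e` of the new variable that the degree bound permits. Sums over monomials become
recursive in the number of variables. -/
theorem sum_list_succ (g : ℕ) (x y : ℕ → ℕ → ℝ) (b : ℕ) (Φ : Node → ℝ) :
    ((list g x y (b + 1)).map Φ).sum = ((list g x y b).map fun ν =>
      ∑ e ∈ Finset.range (g - ν.deg + 1), Φ (ν.shift (fun j => x j b) (fun k => y k b) e)).sum := by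
  have hν : ∀ ν : Node, ∑ e ∈ Finset.range (g - ν.deg + 1),
      Φ (ν.shift (fun j => x j b) (fun k => y k b) e) =
        Φ ν + ((chain g (fun j => x j b) (fun k => y k b) ν).map Φ).sum := by
    intro ν
    rw [Finset.sum_range_succ', shift_zero, add_comm, chain, List.map_map]
    rfl
  have key : ∀ l : List Node,
      ((l ++ l.flatMap (chain g (fun j => x j b) (fun k => y k b))).map Φ).sum =
      (l.map fun ν =>
        ∑ e ∈ Finset.range (g - ν.deg + 1), Φ (ν.shift (fun j => x j b) (fun k => y k b) e)).sum := by
    intro l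
    induction l with
    | nil => simp
    | cons ν l ih =>
      simp only [List.map_append, List.sum_append] at ih
      simp only [List.map_append, List.sum_append, List.map_cons, List.sum_cons,
        List.flatMap_cons, ← ih, hν ν]
      ring
  exact key _

theorem deg_le {g : ℕ} {x y : ℕ → ℕ → ℝ} {b : ℕ} : ∀ ν ∈ list g x y b, ν.deg ≤ g := by
  induction b with
  | zero => intro ν hν; simp only [list, List.mem_singleton] at hν; rw [hν]; exact Nat.zero_le _
  | succ b ih =>
    intro ν hν
    simp only [list, List.mem_append, List.mem_flatMap, chain, List.mem_map, List.mem_range] at hν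
    rcases hν with h | ⟨μ, hμ, e, he, rfl⟩
    · exact ih ν h
    · simp only [shift]; omega

/-- The monomials represent the truncated exponential series of a scalar product. -/
theorem sum_list_mul (g : ℕ) (x y : ℕ → ℕ → ℝ) (b : ℕ) (j k : ℕ) (F : ℕ → ℝ) :
    ((list g x y b).map fun ν => F ν.deg * (ν.u j * ν.v k)).sum =
      ∑ s ∈ Finset.range (g + 1), F s * ((∑ a ∈ Finset.range b, x j a * y k a) ^ s /
        s.factorial) := by
  induction b generalizing F with
  | zero =>
    rw [Finset.sum_eq_single 0]
    · simp [list]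
    · intro s _ hs; simp [hs]
    · simp
  | succ b ih =>
    rw [sum_list_succ]
    set t := x j b * y k b with ht
    set σ := ∑ a ∈ Finset.range b, x j a * y k a with hσ
    have h1 : ∀ ν : Node, (∑ e ∈ Finset.range (g - ν.deg + 1),
        F (ν.shift (fun j => x j b) (fun k => y k b) e).deg *
          ((ν.shift (fun j => x j b) (fun k => y k b) e).u j *
            (ν.shift (fun j => x j b) (fun k => y k b) e).v k)) =
        (∑ e ∈ Finset.range (g - ν.deg + 1), F (ν.deg + e) * (t ^ e / e.factorial)) *
          (ν.u j * ν.v k) := by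
      intro ν
      rw [Finset.sum_mul]
      refine Finset.sum_congr rfl fun e _ => ?_
      simp only [shift, ht, mul_pow]
      ring
    simp only [h1]
    -- The sum over the exponents of the new variable depends on the old monomial only through its
    -- degree, so it is again a weight `F`; this is why the induction is over all weights.
    rw [ih (fun D => ∑ e ∈ Finset.range (g - D + 1), F (D + e) * (t ^ e / e.factorial))]
    rw [Finset.sum_range_succ _ b, ← hσ, ← ht]
    simp only [Finset.sum_mul]
    -- The binomial theorem for divided powers. Afterwards both sides run over the pairs `(s, e)`
    -- with `s + e ≤ g`.
    have h2 : ∀ r, (σ + t) ^ r / (r.factorial : ℝ) =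
        ∑ p ∈ Finset.HasAntidiagonal.antidiagonal r, σ ^ p.1 / p.1.factorial * (t ^ p.2 / p.2.factorial) := by
      intro r
      rw [(Commute.all σ t).add_pow', Finset.sum_div]
      refine Finset.sum_congr rfl fun p hp => ?_
      rw [Finset.HasAntidiagonal.mem_antidiagonal] at hp
      rw [← hp, ← Nat.add_choose_mul_factorial_mul_factorial p.1 p.2]
      have h3 : ((p.1 + p.2).choose p.2 : ℝ) ≠ 0 := by
        exact_mod_cast (Nat.choose_pos (Nat.le_add_left _ _)).ne'
      rw [nsmul_eq_mul, Nat.choose_symm_add]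
      push_cast
      field_simp
    simp only [h2, Finset.mul_sum]
    rw [Finset.sum_sigma', Finset.sum_sigma']
    refine Finset.sum_bij' (fun p _ => ⟨p.1 + p.2, (p.1, p.2)⟩) (fun p _ => ⟨p.2.1, p.2.2⟩)
      ?_ ?_ ?_ ?_ ?_
    · rintro ⟨s, e⟩ h
      simp only [Finset.mem_sigma, Finset.mem_range, Finset.HasAntidiagonal.mem_antidiagonal, and_true] at h ⊢
      omega
    · rintro ⟨r, s, e⟩ h
      simp only [Finset.mem_sigma, Finset.mem_range, Finset.HasAntidiagonal.mem_antidiagonal] at h ⊢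
      omega
    · rintro ⟨s, e⟩ _; rfl
    · rintro ⟨r, s, e⟩ h
      simp only [Finset.mem_sigma, Finset.mem_range, Finset.HasAntidiagonal.mem_antidiagonal] at h
      obtain ⟨-, rfl⟩ := h
      rfl
    · rintro ⟨s, e⟩ _
      simp only
      ring

/-- Generating function by degree: each new variable contributes a factor at most the full geometric
series in `z`. -/
theorem sum_list_pow_le (g : ℕ) (x y : ℕ → ℕ → ℝ) (b : ℕ) {z : ℝ} (h0 : 0 < z) (h1 : z < 1) :
    ((list g x y b).map fun ν => z ^ ν.deg).sum ≤ (1 - z)⁻¹ ^ b := by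
  induction b with
  | zero => simp [list]
  | succ b ih =>
    rw [sum_list_succ]
    have h2 : ∀ ν : Node, (∑ e ∈ Finset.range (g - ν.deg + 1),
        z ^ (ν.shift (fun j => x j b) (fun k => y k b) e).deg) ≤ z ^ ν.deg * (1 - z)⁻¹ := by
      intro ν
      simp only [shift, pow_add, ← Finset.mul_sum]
      refine mul_le_mul_of_nonneg_left ?_ (by positivity)
      rw [← tsum_geometric_of_lt_one h0.le h1]
      exact (summable_geometric_of_lt_one h0.le h1).sum_le_tsum _ fun _ _ => by positivity
    refine (List.sum_le_sum fun ν _ => h2 ν).trans ?_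
    rw [List.sum_map_mul_right, pow_succ]
    exact mul_le_mul_of_nonneg_right ih (inv_nonneg.2 (by linarith))

/-- The number of monomials. -/
theorem length_list_le (g : ℕ) (x y : ℕ → ℕ → ℝ) (b : ℕ) {z : ℝ} (h0 : 0 < z) (h1 : z < 1) :
    ((list g x y b).length : ℝ) ≤ z⁻¹ ^ g * (1 - z)⁻¹ ^ b := by
  -- Every degree is at most `g` and `z < 1`, so each monomial weighs at least `z ^ g`. The
  -- parameter `z` stays free for later optimisation.
  have h2 : ((list g x y b).length : ℝ) * z ^ g ≤ ((list g x y b).map fun ν => z ^ ν.deg).sum := by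
    have : ((list g x y b).map fun _ => z ^ g).sum ≤
        ((list g x y b).map fun ν => z ^ ν.deg).sum :=
      List.sum_le_sum fun ν hν => pow_le_pow_of_le_one h0.le h1.le (deg_le ν hν)
    simpa using this
  have h3 := h2.trans (sum_list_pow_le g x y b h0 h1)
  rw [inv_pow, mul_comm, ← div_eq_mul_inv, le_div_iff₀ (by positivity)]
  exact h3

theorem length_list_mono (g : ℕ) (x y : ℕ → ℕ → ℝ) :
    Monotone fun b => (list g x y b).length := by
  refine monotone_nat_of_le_succ fun b => ?_
  simp [list]

end Node

/-! ### The program that lists the monomials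

Variable `13` holds the degree `g`, variable `14` the number of monomials, variable `12` the number
of the layer from which the second family of points is read; the first one is in array `4`. Arrays
`9`, `10`, `11` hold the degrees and the values of the monomials. -/

/-- The arrays `9`, `10`, `11` hold the list `l`, with values at `n` points. -/
structure View.Lists (s : View) (n : ℕ) (l : List Node) : Prop where
  len : s.idx 14 = l.length
  node : ∀ q ν, l[q]? = some ν → s.real (9, q, 0, 0) = ν.deg ∧
    ∀ j < n, s.real (10, q, j, 0) = ν.u j ∧ s.real (11, q, j, 0) = ν.v j

/-- Apart from the arrays `9`, `10`, `11` and the variables in `V`, nothing has changed. -/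
structure View.SameBut (V : Finset ℕ) (A : Finset ℕ) (s s' : View) : Prop where
  idx : ∀ w ∉ V, s'.idx w = s.idx w
  real : ∀ a ∉ A, ∀ i j k, s'.real (a, i, j, k) = s.real (a, i, j, k)

theorem View.SameBut.refl (V A : Finset ℕ) (s : View) : View.SameBut V A s s :=
  ⟨fun _ _ => rfl, fun _ _ _ _ _ => rfl⟩

theorem View.SameBut.trans {V A : Finset ℕ} {s s' s'' : View} (h : View.SameBut V A s s')
    (h' : View.SameBut V A s' s'') : View.SameBut V A s s'' :=
  ⟨fun w hw => (h'.idx w hw).trans (h.idx w hw),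
    fun a ha i j k => (h'.real a ha i j k).trans (h.real a ha i j k)⟩

theorem View.SameBut.mono {V A V' A' : Finset ℕ} {s s' : View} (h : View.SameBut V A s s')
    (hV : V ⊆ V') (hA : A ⊆ A') : View.SameBut V' A' s s' :=
  ⟨fun w hw => h.idx w fun hw' => hw (hV hw'), fun a ha => h.real a fun ha' => ha (hA ha')⟩

theorem View.SameBut.setIdx {V A : Finset ℕ} {s s' : View} (h : View.SameBut V A s s') {v : ℕ}
    (hv : v ∈ V) (t : ℕ) : View.SameBut V A s (s'.setIdx v t) := by
  refine ⟨fun w hw => ?_, h.real⟩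
  rw [View.setIdx_idx, if_neg (by rintro rfl; exact hw hv), h.idx w hw]

theorem View.Sizes.sameBut {s s' : View} {n d : ℕ} {V A : Finset ℕ} (h : s.Sizes n d)
    (h' : View.SameBut V A s s') (h0 : 0 ∉ V := by decide) (h7 : 7 ∉ V := by decide)
    (h8 : 8 ∉ V := by decide) (h9 : 9 ∉ V := by decide) : s'.Sizes n d :=
  h.congr (h'.idx _ h0) (h'.idx _ h7) (h'.idx _ h8) (h'.idx _ h9)

theorem View.Lists.setIdx {s : View} {n : ℕ} {l : List Node} (h : s.Lists n l) {v : ℕ}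
    (hv : v ≠ 14) (t : ℕ) : (s.setIdx v t).Lists n l :=
  ⟨by rw [View.setIdx_idx, if_neg hv.symm, h.len], h.node⟩

namespace Stmt

/-- Appends a monomial: the monomial with the number in variable `17`, times the coordinate with the
number in variable `15`, divided by one plus variable `18`. -/
def appendNode : Stmt :=
  .seq (.asn 9 14 0 0 (.add (.arr 9 17 0 0) (.const 1)))
  (.seq (.loop 2 8 (.asn 10 14 2 0 (.div (.mul (.arr 10 17 2 0) (.arr 4 0 2 15))
    (.add (.ofIdx 18) (.const 1)))))
  (.seq (.loop 2 8 (.asn 11 14 2 0 (.mul (.arr 11 17 2 0) (.inp 0 12 2 15))))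
  (.seq (.icopy 17 14) (.isucc 14))))

theorem appendNode_spec {inp : Input} {n d : ℕ} {s : View} {l : List Node} {ν : Node}
    (hs : s.Sizes n d) (hl : s.Lists n l) (hν : l[s.idx 17]? = some ν) :
    appendNode.cost inp s ≤ 50 * (n + 1) ∧
    (appendNode.run inp s).Lists n (l ++ [⟨ν.deg + 1,
      fun j => ν.u j * s.real (4, 0, j, s.idx 15) / (s.idx 18 + 1),
      fun k => ν.v k * inp.real (0, s.idx 12, k, s.idx 15)⟩]) ∧
    (appendNode.run inp s).idx 17 = l.length ∧
    View.SameBut {14, 17} {9, 10, 11} s (appendNode.run inp s) := by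
  have hlt : s.idx 17 < l.length := (List.getElem?_eq_some_iff.1 hν).1
  obtain ⟨hdeg, hval⟩ := hl.node _ _ hν
  set s₁ := (asn 9 14 0 0 (.add (.arr 9 17 0 0) (.const 1))).run inp s with hs₁
  have r1 : ∀ a i j k, s₁.real (a, i, j, k) = if a = 9 ∧ i = l.length ∧ j = 0 ∧ k = 0 then
      (ν.deg : ℝ) + 1 else s.real (a, i, j, k) := by
    intro a i j k
    simp [hs₁, run, View.setReal, Function.update_apply, Expr.eval, hs.zero, hl.len, hdeg]
  have i1 : s₁.idx = s.idx := rfl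
  obtain ⟨i2, o2, f2, g2⟩ := run_for_fill (inp := inp) (v := 2) (N := 8) (A := 10) (s := s₁)
    (S := asn 10 14 2 0 (.div (.mul (.arr 10 17 2 0) (.arr 4 0 2 15))
      (.add (.ofIdx 18) (.const 1))))
    (D := fun t i j k => i = l.length ∧ j = t ∧ k = 0)
    (f := fun _ j _ => ν.u j * s.real (4, 0, j, s.idx 15) / (s.idx 18 + 1)) (by
      intro t ht s' h1 h2 h3 h4
      rw [i1] at h1
      have ht : t < n := by rwa [i1, hs.idx_n] at ht
      have hv : s'.real (10, s.idx 17, t, 0) = ν.u t := by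
        -- The source row `s.idx 17` has a number below `l.length`, so it differs from the row being
        -- filled and is still intact.
        rw [h4 _ _ _ (by rintro ⟨t', _, h, _⟩; omega), r1, if_neg (by norm_num)]
        exact (hval t ht).1
      have hx : s'.real (4, 0, t, s.idx 15) = s.real (4, 0, t, s.idx 15) := by
        rw [h3 _ _ _ _ (by norm_num), r1, if_neg (by norm_num)]
      refine ⟨rfl, fun a i j k ha => ?_, ?_, ?_⟩
      · simp [run, View.setReal, ha]
      · rintro i j k ⟨rfl, rfl, rfl⟩
        simp [run, View.setReal, Expr.eval, h1, h2, hl.len, hs.zero, hv, hx]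
      · intro i j k hn
        simp only [run, View.setReal, Function.update_apply, h1 14 (by norm_num),
          h1 0 (by norm_num), h2, hl.len, hs.zero, Prod.mk.injEq, true_and]
        rw [if_neg hn])
  set s₂ := (Stmt.loop 2 8 (asn 10 14 2 0 (.div (.mul (.arr 10 17 2 0) (.arr 4 0 2 15))
      (.add (.ofIdx 18) (.const 1))))).run inp s₁
  rw [i1] at i2
  obtain ⟨i3, o3, f3, g3⟩ := run_for_fill (inp := inp) (v := 2) (N := 8) (A := 11) (s := s₂)
    (S := asn 11 14 2 0 (.mul (.arr 11 17 2 0) (.inp 0 12 2 15)))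
    (D := fun t i j k => i = l.length ∧ j = t ∧ k = 0)
    (f := fun _ j _ => ν.v j * inp.real (0, s.idx 12, j, s.idx 15)) (by
      intro t ht s' h1 h2 h3 h4
      rw [i2] at h1
      have ht : t < n := by rwa [i2, hs.idx_n] at ht
      have hv : s'.real (11, s.idx 17, t, 0) = ν.v t := by
        rw [h4 _ _ _ (by rintro ⟨t', _, h, _⟩; omega), o2 _ _ _ _ (by norm_num), r1,
          if_neg (by norm_num)]
        exact (hval t ht).2
      refine ⟨rfl, fun a i j k ha => ?_, ?_, ?_⟩
      · simp [run, View.setReal, ha]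
      · rintro i j k ⟨rfl, rfl, rfl⟩
        simp [run, View.setReal, Expr.eval, h1, h2, hl.len, hs.zero, hv]
      · intro i j k hn
        simp only [run, View.setReal, Function.update_apply, h1 14 (by norm_num),
          h1 0 (by norm_num), h2, hl.len, hs.zero, Prod.mk.injEq, true_and]
        rw [if_neg hn])
  set s₃ := (Stmt.loop 2 8 (asn 11 14 2 0 (.mul (.arr 11 17 2 0) (.inp 0 12 2 15)))).run inp s₂
  rw [i2] at i3
  have hrun : appendNode.run inp s = (s₃.setIdx 17 l.length).setIdx 14 (l.length + 1) := by
    change (isucc 14).run inp ((icopy 17 14).run inp s₃) = _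
    simp [run, View.setIdx_idx, i3, hl.len]
  have hc2 : (Stmt.loop 2 8 (asn 10 14 2 0 (.div (.mul (.arr 10 17 2 0) (.arr 4 0 2 15))
      (.add (.ofIdx 18) (.const 1))))).cost inp s₁ ≤ n * (8 + 10) + 10 :=
    cost_for_le (by rw [i1, hs.idx_n]) fun t _ => by simp [cost, Expr.cost]
  have hc3 : (Stmt.loop 2 8 (asn 11 14 2 0 (.mul (.arr 11 17 2 0) (.inp 0 12 2 15)))).cost inp s₂
      ≤ n * (8 + 10) + 10 :=
    cost_for_le (by rw [i2, hs.idx_n]) fun t _ => by simp [cost, Expr.cost]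
  refine ⟨?_, ?_, ?_, ?_, ?_⟩
  · have e : appendNode.cost inp s =
      4 + ((Stmt.loop 2 8 (asn 10 14 2 0 (.div (.mul (.arr 10 17 2 0) (.arr 4 0 2 15))
      (.add (.ofIdx 18) (.const 1))))).cost inp s₁ +
      ((Stmt.loop 2 8 (asn 11 14 2 0 (.mul (.arr 11 17 2 0) (.inp 0 12 2 15)))).cost inp s₂ +
        2)) := rfl
    omega
  · rw [hrun]
    refine ⟨by simp [View.setIdx_idx], fun q μ hq => ?_⟩
    simp only [View.setIdx_real]
    rcases Nat.lt_or_ge q l.length with h | h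
    · rw [List.getElem?_append_left h] at hq
      obtain ⟨hμ, hμ'⟩ := hl.node _ _ hq
      have hne : q ≠ l.length := h.ne
      refine ⟨?_, fun j hj => ⟨?_, ?_⟩⟩
      · rw [o3 _ _ _ _ (by norm_num), o2 _ _ _ _ (by norm_num), r1,
          if_neg (by simp [hne]), hμ]
      · rw [o3 _ _ _ _ (by norm_num), g2 _ _ _ (by simp [hne]), r1,
          if_neg (by simp), (hμ' j hj).1]
      · rw [g3 _ _ _ (by simp [hne]), o2 _ _ _ _ (by norm_num), r1,
          if_neg (by simp), (hμ' j hj).2]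
    · have hq' := (List.getElem?_eq_some_iff.1 hq).1
      simp only [List.length_append, List.length_singleton] at hq'
      obtain rfl : q = l.length := by omega
      rw [List.getElem?_concat_length, Option.some.injEq] at hq
      subst hq
      refine ⟨?_, fun j hj => ⟨?_, ?_⟩⟩
      · rw [o3 _ _ _ _ (by norm_num), o2 _ _ _ _ (by norm_num), r1, if_pos (by simp)]
        push_cast; rfl
      · rw [o3 _ _ _ _ (by norm_num),
          f2 _ _ _ ⟨j, by rw [i1, hs.idx_n]; exact hj, rfl, rfl, rfl⟩]
      · rw [f3 _ _ _ ⟨j, by rw [i2, hs.idx_n]; exact hj, rfl, rfl, rfl⟩]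
  · rw [hrun]
    simp [View.setIdx_idx]
  · intro w hw
    simp only [Finset.mem_insert, Finset.mem_singleton, not_or] at hw
    rw [hrun, View.setIdx_idx, if_neg hw.1, View.setIdx_idx, if_neg hw.2, i3]
  · intro a ha i j k
    simp only [Finset.mem_insert, Finset.mem_singleton, not_or] at ha
    rw [hrun, View.setIdx_real, View.setIdx_real, o3 _ _ _ _ ha.2.2, o2 _ _ _ _ ha.2.1, r1,
      if_neg (by simp [ha.1])]

/-- Appends the multiples of the monomial with the number in variable `16`. -/
def appendChain : Stmt :=
  .seq (.icopy 17 16) (.loop 18 13 (.ifLt (.arr 9 17 0 0) (.ofIdx 13) appendNode))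

/-- Adds one more coordinate, whose number is in variable `15`. -/
def addCoordinate : Stmt := .seq (.icopy 19 14) (.loop 16 19 appendChain)

/-- Lists the monomials. -/
def listNodes : Stmt :=
  .seq (.iconst 14 1) (.seq (tab 9 7 7 7 (.const 0)) (.seq (tab 10 7 8 7 (.const 1))
    (.seq (tab 11 7 8 7 (.const 1)) (.loop 15 9 addCoordinate))))

/-- The loop always has `g` rounds; once the degree has reached `g`, the remaining ones do nothing.
Variable `17` points to the latest multiple, so the next one costs one multiplication per point for
each family, and one division for the first. -/
theorem appendChain_spec {inp : Input} {n d g : ℕ} {s : View} {l : List Node} {ν : Node}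
    (hs : s.Sizes n d) (hg : s.idx 13 = g) (hl : s.Lists n l) (hν : l[s.idx 16]? = some ν) :
    appendChain.cost inp s ≤ 100 * ((g + 1) * (n + 1)) ∧
    (appendChain.run inp s).Lists n (l ++ ν.chain g (fun j => s.real (4, 0, j, s.idx 15))
      (fun k => inp.real (0, s.idx 12, k, s.idx 15))) ∧
    View.SameBut {14, 17} {9, 10, 11} s (appendChain.run inp s) := by
  set x : ℕ → ℝ := fun j => s.real (4, 0, j, s.idx 15) with hx
  set y : ℕ → ℝ := fun k => inp.real (0, s.idx 12, k, s.idx 15) with hy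
  set s₁ := s.setIdx 17 (s.idx 16) with hs₁
  have h1 : View.SameBut {14, 17, 18} {9, 10, 11} s s₁ :=
    (View.SameBut.refl _ _ s).setIdx (by decide) _
  have hg1 : s₁.idx 13 = g := (h1.idx 13 (by decide)).trans hg
  obtain ⟨hc, s', ⟨hl', -, hs'⟩, hrun⟩ := for_spec (inp := inp)
    (S := .ifLt (.arr 9 17 0 0) (.ofIdx 13) appendNode) (v := 18) (N := 13)
    (B := 50 * (n + 1) + 3) (s := s₁)
    -- The minimum counts the effective rounds among the first `t`.
    (I := fun t s' => s'.Lists n (l ++ (List.range (min t (g - ν.deg))).map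
        fun e => ν.shift x y (e + 1)) ∧
      (l ++ (List.range (min t (g - ν.deg))).map fun e => ν.shift x y (e + 1))[s'.idx 17]? =
        some (ν.shift x y (min t (g - ν.deg))) ∧
      View.SameBut {14, 17, 18} {9, 10, 11} s s')
    ⟨by simpa using hl.setIdx (by norm_num) _, by simpa [hs₁, View.setIdx_idx, Node.shift_zero]
      using hν, h1⟩ (by
    rintro t - s' ⟨hl', hν', hs'⟩
    have hs'' := hs'.setIdx (v := 18) (by decide) t
    have hl'' := hl'.setIdx (v := 18) (by norm_num) t
    set s'' := s'.setIdx 18 t with hs''def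
    have e17 : s''.idx 17 = s'.idx 17 := by simp [hs''def, View.setIdx_idx]
    have e18 : s''.idx 18 = t := by simp [hs''def, View.setIdx_idx]
    rw [← e17] at hν'
    have hz := hs.sameBut hs''
    obtain ⟨ac, al, ai, as⟩ := appendNode_spec (inp := inp) hz hl'' hν'
    have hcond : Expr.eval inp (.arr 9 17 0 0) s'' < Expr.eval inp (.ofIdx 13) s'' ↔
        t < g - ν.deg := by
      simp only [Expr.eval, hz.zero, (hl''.node _ _ hν').1, hs''.idx 13 (by decide), hg]
      rw [Nat.cast_lt, Node.shift]
      simp only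
      omega
    by_cases ht : t < g - ν.deg
    · have hm : min t (g - ν.deg) = t := min_eq_left ht.le
      have hm' : min (t + 1) (g - ν.deg) = t + 1 := min_eq_left ht
      rw [hm] at al ai
      rw [hm']
      have hrun : (ifLt (.arr 9 17 0 0) (.ofIdx 13) appendNode).run inp s'' =
          appendNode.run inp s'' := by
        simp only [run]; rw [if_pos (hcond.2 ht)]
      have hnode : (⟨(ν.shift x y t).deg + 1,
          fun j => (ν.shift x y t).u j * s''.real (4, 0, j, s''.idx 15) / (s''.idx 18 + 1),
          fun k => (ν.shift x y t).v k * inp.real (0, s''.idx 12, k, s''.idx 15)⟩ : Node) =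
          ν.shift x y (t + 1) := by
        rw [Node.shift_succ, e18, hs''.idx 15 (by decide), hs''.idx 12 (by decide)]
        simp only [hs''.real 4 (by decide), hx, hy]
      rw [hnode, List.append_assoc] at al
      have hlist : (List.range t).map (fun e => ν.shift x y (e + 1)) ++ [ν.shift x y (t + 1)] =
          (List.range (t + 1)).map fun e => ν.shift x y (e + 1) := by
        rw [List.range_succ, List.map_append]; rfl
      rw [hlist] at al
      rw [hrun]
      refine ⟨?_, al, ?_, hs''.trans (as.mono (by decide) (by decide))⟩
      · simp only [cost, Expr.cost]
        rw [if_pos (hcond.2 ht)]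
        omega
      · rw [ai, ← hlist, ← List.append_assoc, List.getElem?_concat_length]
    · have hm : min t (g - ν.deg) = g - ν.deg := min_eq_right (by omega)
      have hm' : min (t + 1) (g - ν.deg) = g - ν.deg := min_eq_right (by omega)
      rw [hm] at hl'' hν'
      rw [hm']
      have hrun : (ifLt (.arr 9 17 0 0) (.ofIdx 13) appendNode).run inp s'' = s'' := by
        simp only [run]; rw [if_neg (mt hcond.1 ht)]
      rw [hrun]
      refine ⟨?_, hl'', hν', hs''⟩
      simp only [cost, Expr.cost]
      rw [if_neg (mt hcond.1 ht)]
      omega)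
  have hrun' : appendChain.run inp s = s'.setIdx 18 (s.idx 18) := by
    change (Stmt.loop 18 13 (.ifLt (.arr 9 17 0 0) (.ofIdx 13) appendNode)).run inp s₁ = _
    rw [hrun]; simp [hs₁, View.setIdx_idx]
  rw [hg1] at hc hl'
  rw [hrun']
  refine ⟨?_, ?_, ?_, ?_⟩
  · have e : appendChain.cost inp s =
      1 + (Stmt.loop 18 13 (.ifLt (.arr 9 17 0 0) (.ofIdx 13) appendNode)).cost inp s₁ := rfl
    rw [e]
    refine (Nat.add_le_add_left hc 1).trans ?_
    nlinarith
  · rw [min_eq_right (Nat.sub_le _ _)] at hl'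
    exact hl'.setIdx (by norm_num) _
  · intro w hw
    rw [View.setIdx_idx]
    split_ifs with h
    · rw [h]
    · exact hs'.idx w (by simp only [Finset.mem_insert, Finset.mem_singleton] at hw ⊢; tauto)
  · exact hs'.real

/-- The number of rounds is the length saved before the list grows, so only the old monomials are
multiplied. New ones are appended behind them and leave their positions unchanged. -/
theorem addCoordinate_spec {inp : Input} {n d g : ℕ} {s : View} {l : List Node}
    (hs : s.Sizes n d) (hg : s.idx 13 = g) (hl : s.Lists n l) :
    addCoordinate.cost inp s ≤ 200 * ((l.length + 1) * ((g + 1) * (n + 1))) ∧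
    (addCoordinate.run inp s).Lists n (l ++ l.flatMap
      (Node.chain g (fun j => s.real (4, 0, j, s.idx 15))
        (fun k => inp.real (0, s.idx 12, k, s.idx 15)))) ∧
    View.SameBut {14, 17, 19} {9, 10, 11} s (addCoordinate.run inp s) := by
  set x : ℕ → ℝ := fun j => s.real (4, 0, j, s.idx 15) with hx
  set y : ℕ → ℝ := fun k => inp.real (0, s.idx 12, k, s.idx 15) with hy
  set s₁ := s.setIdx 19 (s.idx 14) with hs₁
  have h1 : View.SameBut {14, 16, 17, 19} {9, 10, 11} s s₁ :=
    (View.SameBut.refl _ _ s).setIdx (by decide) _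
  have hN : s₁.idx 19 = l.length := by simp [hs₁, View.setIdx_idx, hl.len]
  obtain ⟨hc, s', ⟨hl', hs'⟩, hrun⟩ := for_spec (inp := inp) (S := appendChain) (v := 16)
    (N := 19) (B := 100 * ((g + 1) * (n + 1))) (s := s₁)
    (I := fun t s' => s'.Lists n (l ++ (l.take t).flatMap (Node.chain g x y)) ∧
      View.SameBut {14, 16, 17, 19} {9, 10, 11} s s')
    ⟨by simpa using hl.setIdx (by norm_num) _, h1⟩ (by
    rintro t ht s' ⟨hl', hs'⟩
    rw [hN] at ht
    have hs'' := hs'.setIdx (v := 16) (by decide) t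
    have hl'' := hl'.setIdx (v := 16) (by norm_num) t
    set s'' := s'.setIdx 16 t with hs''def
    have e16 : s''.idx 16 = t := by simp [hs''def, View.setIdx_idx]
    have hν : (l ++ (l.take t).flatMap (Node.chain g x y))[s''.idx 16]? = some l[t] := by
      rw [e16, List.getElem?_append_left ht, List.getElem?_eq_getElem ht]
    obtain ⟨ac, al, as⟩ := appendChain_spec (inp := inp) (g := g) (hs.sameBut hs'')
      ((hs''.idx 13 (by decide)).trans hg) hl'' hν
    refine ⟨ac, ?_, hs''.trans (as.mono (by decide) (by decide))⟩
    have hx' : (fun j => s''.real (4, 0, j, s''.idx 15)) = x := by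
      simp only [hs''.real 4 (by decide), hs''.idx 15 (by decide), hx]
    have hy' : (fun k => inp.real (0, s''.idx 12, k, s''.idx 15)) = y := by
      simp only [hs''.idx 12 (by decide), hs''.idx 15 (by decide), hy]
    rw [hx', hy', List.append_assoc] at al
    rw [← List.take_concat_get' l t ht, List.flatMap_append]
    simpa using al)
  have hrun' : addCoordinate.run inp s = s'.setIdx 16 (s.idx 16) := by
    change (Stmt.loop 16 19 appendChain).run inp s₁ = _
    rw [hrun]; simp [hs₁, View.setIdx_idx]
  rw [hN] at hc hl'
  rw [hrun']
  refine ⟨?_, ?_, ?_, ?_⟩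
  · have e : addCoordinate.cost inp s = 1 + (Stmt.loop 16 19 appendChain).cost inp s₁ := rfl
    rw [e]
    refine (Nat.add_le_add_left hc 1).trans ?_
    have q1 : 1 ≤ (g + 1) * (n + 1) := Nat.mul_pos (by omega) (by omega)
    generalize (g + 1) * (n + 1) = Q at q1
    have q2 : l.length ≤ l.length * Q := Nat.le_mul_of_pos_right _ q1
    have q3 : 200 * ((l.length + 1) * Q) = 200 * (l.length * Q) + 200 * Q := by ring
    have q4 : l.length * (100 * Q + 10) = 100 * (l.length * Q) + 10 * l.length := by ring
    omega
  · rw [List.take_length] at hl'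
    exact hl'.setIdx (by norm_num) _
  · intro w hw
    rw [View.setIdx_idx]
    split_ifs with h
    · rw [h]
    · exact hs'.idx w (by simp only [Finset.mem_insert, Finset.mem_singleton] at hw ⊢; tauto)
  · exact hs'.real

/-- The list starts with the monomial `1` and receives one coordinate per round. Its length never
decreases, so the final length bounds the cost of each round. -/
theorem listNodes_spec {inp : Input} {n d g : ℕ} {s : View}
    (hs : s.Sizes n d) (hg : s.idx 13 = g) {x y : ℕ → ℕ → ℝ}
    (hx : ∀ j b, x j b = s.real (4, 0, j, b)) (hy : ∀ k b, y k b = inp.real (0, s.idx 12, k, b)) :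
    listNodes.cost inp s ≤
      400 * ((d + 1) * (((Node.list g x y d).length + 1) * ((g + 1) * (n + 1)))) ∧
    (listNodes.run inp s).Lists n (Node.list g x y d) ∧
    View.SameBut {14, 17, 19} {9, 10, 11} s (listNodes.run inp s) := by
  set s₁ := s.setIdx 14 1 with hs₁
  have h1 : View.SameBut {14, 15, 17, 19} {9, 10, 11} s s₁ :=
    (View.SameBut.refl _ _ s).setIdx (by decide) _
  have hz1 := hs.sameBut h1
  obtain ⟨i2, o2, f2⟩ := tab_spec inp (A := 9) (N₁ := 7) (N₂ := 7) (N₃ := 7) (e := .const 0)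
    trivial (by norm_num) (by norm_num) (by norm_num) s₁
  set s₂ := (tab 9 7 7 7 (.const 0)).run inp s₁
  have h2 : View.SameBut {14, 15, 17, 19} {9, 10, 11} s s₂ := h1.trans
    ⟨fun w _ => by rw [i2], fun a ha i j k => o2 a i j k (by rintro rfl; exact ha (by decide))⟩
  have hz2 := hs.sameBut h2
  obtain ⟨i3, o3, f3⟩ := tab_spec inp (A := 10) (N₁ := 7) (N₂ := 8) (N₃ := 7) (e := .const 1)
    trivial (by norm_num) (by norm_num) (by norm_num) s₂
  set s₃ := (tab 10 7 8 7 (.const 1)).run inp s₂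
  have h3 : View.SameBut {14, 15, 17, 19} {9, 10, 11} s s₃ := h2.trans
    ⟨fun w _ => by rw [i3], fun a ha i j k => o3 a i j k (by rintro rfl; exact ha (by decide))⟩
  have hz3 := hs.sameBut h3
  obtain ⟨i4, o4, f4⟩ := tab_spec inp (A := 11) (N₁ := 7) (N₂ := 8) (N₃ := 7) (e := .const 1)
    trivial (by norm_num) (by norm_num) (by norm_num) s₃
  set s₄ := (tab 11 7 8 7 (.const 1)).run inp s₃
  have h4 : View.SameBut {14, 15, 17, 19} {9, 10, 11} s s₄ := h3.trans
    ⟨fun w _ => by rw [i4], fun a ha i j k => o4 a i j k (by rintro rfl; exact ha (by decide))⟩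
  have hz4 := hs.sameBut h4
  have c2 := tab_cost_le inp (A := 9) (N₁ := 7) (N₂ := 7) (N₃ := 7) (e := .const 0)
    (by norm_num) (by norm_num) (by norm_num) (s := s₁) (B := 1) hz1.one.le hz1.one.le hz1.one.le
    (fun _ _ => le_rfl)
  have c3 := tab_cost_le inp (A := 10) (N₁ := 7) (N₂ := 8) (N₃ := 7) (e := .const 1)
    (by norm_num) (by norm_num) (by norm_num) (s := s₂) (B := 1) hz2.one.le hz2.idx_n.le
    hz2.one.le (fun _ _ => le_rfl)
  have c4 := tab_cost_le inp (A := 11) (N₁ := 7) (N₂ := 8) (N₃ := 7) (e := .const 1)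
    (by norm_num) (by norm_num) (by norm_num) (s := s₃) (B := 1) hz3.one.le hz3.idx_n.le
    hz3.one.le (fun _ _ => le_rfl)
  have hl4 : s₄.Lists n (Node.list g x y 0) := by
    refine ⟨by rw [i4, i3, i2]; simp [hs₁, View.setIdx_idx, Node.list], fun q ν hq => ?_⟩
    have hq0 : q = 0 := by
      have := (List.getElem?_eq_some_iff.1 hq).1
      simpa [Node.list] using this
    subst hq0
    simp only [Node.list, List.getElem?_cons_zero, Option.some.injEq] at hq
    subst hq
    refine ⟨?_, fun j hj => ⟨?_, ?_⟩⟩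
    · rw [o4 _ _ _ _ (by norm_num), o3 _ _ _ _ (by norm_num),
        f2 0 (by rw [hz1.one]; norm_num) 0 (by rw [hz1.one]; norm_num) 0
          (by rw [hz1.one]; norm_num)]
      simp [Expr.eval]
    · rw [o4 _ _ _ _ (by norm_num), f3 0 (by rw [hz2.one]; norm_num) j
        (by rw [hz2.idx_n]; exact hj) 0 (by rw [hz2.one]; norm_num)]
      simp [Expr.eval]
    · rw [f4 0 (by rw [hz3.one]; norm_num) j
        (by rw [hz3.idx_n]; exact hj) 0 (by rw [hz3.one]; norm_num)]
      simp [Expr.eval]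
  set Lf := (Node.list g x y d).length with hLf
  obtain ⟨hc, s', ⟨hl', hs'⟩, hrun⟩ := for_spec (inp := inp) (S := addCoordinate) (v := 15)
    (N := 9) (B := 200 * ((Lf + 1) * ((g + 1) * (n + 1)))) (s := s₄)
    (I := fun t s' => s'.Lists n (Node.list g x y t) ∧
      View.SameBut {14, 15, 17, 19} {9, 10, 11} s s') ⟨hl4, h4⟩ (by
    rintro t ht s' ⟨hl', hs'⟩
    rw [hz4.idx_d] at ht
    have hs'' := hs'.setIdx (v := 15) (by decide) t
    have hl'' := hl'.setIdx (v := 15) (by norm_num) t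
    set s'' := s'.setIdx 15 t with hs''def
    have e15 : s''.idx 15 = t := by simp [hs''def, View.setIdx_idx]
    obtain ⟨ac, al, as⟩ := addCoordinate_spec (inp := inp) (g := g) (hs.sameBut hs'')
      ((hs''.idx 13 (by decide)).trans hg) hl''
    refine ⟨ac.trans ?_, ?_, hs''.trans (as.mono (by decide) (by decide))⟩
    · have : (Node.list g x y t).length ≤ Lf := Node.length_list_mono g x y ht.le
      gcongr
    · have hx' : (fun j => s''.real (4, 0, j, s''.idx 15)) = fun j => x j t := by
        simp only [hs''.real 4 (by decide), e15, hx]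
      have hy' : (fun k => inp.real (0, s''.idx 12, k, s''.idx 15)) = fun k => y k t := by
        simp only [hs''.idx 12 (by decide), e15, hy]
      rw [hx', hy'] at al
      exact al)
  have hrun' : listNodes.run inp s = s'.setIdx 15 (s.idx 15) := by
    change (Stmt.loop 15 9 addCoordinate).run inp s₄ = _
    rw [hrun, i4, i3, i2]; simp [hs₁, View.setIdx_idx]
  rw [hz4.idx_d] at hc hl'
  rw [hrun']
  refine ⟨?_, hl'.setIdx (by norm_num) _, ?_, hs'.real⟩
  · have e : listNodes.cost inp s = 1 + ((tab 9 7 7 7 (.const 0)).cost inp s₁ +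
      ((tab 10 7 8 7 (.const 1)).cost inp s₂ + ((tab 11 7 8 7 (.const 1)).cost inp s₃ +
      (Stmt.loop 15 9 addCoordinate).cost inp s₄))) := rfl
    rw [e]
    have q1 : n + 1 ≤ (g + 1) * (n + 1) := Nat.le_mul_of_pos_left _ (by omega)
    have q2 : (g + 1) * (n + 1) ≤ (Lf + 1) * ((g + 1) * (n + 1)) :=
      Nat.le_mul_of_pos_left _ (by omega)
    set Q := (Lf + 1) * ((g + 1) * (n + 1))
    have q3 : (d + 1) * Q = d * Q + Q := by ring
    have q4 : d ≤ d * Q := Nat.le_mul_of_pos_right _ (by omega)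
    have q5 : d * (200 * Q + 10) = 200 * (d * Q) + 10 * d := by ring
    rw [q5] at hc
    omega
  · intro w hw
    rw [View.setIdx_idx]
    split_ifs with h
    · rw [h]
    · exact hs'.idx w (by simp only [Finset.mem_insert, Finset.mem_singleton] at hw ⊢; tauto)

end Stmt

/-! ### Bounds for the number of steps of expressions -/

namespace Expr

/-- The bounds of all sums are the variables `8`, `9`, `14`, and these are not summed over. -/
def Standard : Expr → Prop
  | const _ | ofIdx _ | arr _ _ _ _ | .inp _ _ _ _ => True
  | add e f | sub e f | mul e f | div e f => e.Standard ∧ f.Standard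
  | sum v N e | sup v N e =>
    (N = 8 ∨ N = 9 ∨ N = 14) ∧ v ≠ 8 ∧ v ≠ 9 ∧ v ≠ 14 ∧ e.Standard

/-- A bound for the number of steps, where sums up to variable `8` have at most `m` terms,
and other sums at most `Q`. -/
def costBound (m Q : ℕ) : Expr → ℕ
  | const _ | ofIdx _ | arr _ _ _ _ | .inp _ _ _ _ => 1
  | add e f | sub e f | mul e f | div e f => e.costBound m Q + f.costBound m Q + 1
  | sum _ N e | sup _ N e => (if N = 8 then m else Q) * (e.costBound m Q + 10) + 10

theorem cost_sum_le {m Q v N : ℕ} {e : Expr} {s : View}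
    (he : ∀ s : View, s.idx 8 ≤ m → s.idx 9 ≤ Q → s.idx 14 ≤ Q → e.cost s ≤ e.costBound m Q)
    (hN : N = 8 ∨ N = 9 ∨ N = 14) (h8 : v ≠ 8) (h9 : v ≠ 9) (h14 : v ≠ 14)
    (s8 : s.idx 8 ≤ m) (s9 : s.idx 9 ≤ Q) (s14 : s.idx 14 ≤ Q) :
    ∑ t ∈ Finset.range (s.idx N), (e.cost (s.setIdx v t) + 10) + 10 ≤
      (if N = 8 then m else Q) * (e.costBound m Q + 10) + 10 := by
  have h1 := Finset.sum_le_card_nsmul (Finset.range (s.idx N))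
    (fun t => e.cost (s.setIdx v t) + 10) (e.costBound m Q + 10) (fun t _ => by
      refine Nat.add_le_add_right (he _ ?_ ?_ ?_) 10 <;> rw [View.setIdx_idx] <;> split_ifs
      all_goals first | assumption | omega)
  simp only [Finset.card_range, smul_eq_mul] at h1
  have h2 : s.idx N ≤ if N = 8 then m else Q := by
    rcases hN with rfl | rfl | rfl <;> simpa
  have h3 := Nat.mul_le_mul_right (e.costBound m Q + 10) h2
  omega

theorem cost_le_costBound {m Q : ℕ} {e : Expr} (he : e.Standard) :
    ∀ s : View, s.idx 8 ≤ m → s.idx 9 ≤ Q → s.idx 14 ≤ Q → e.cost s ≤ e.costBound m Q := by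
  induction e with
  | const | ofIdx | arr | inp => intro s _ _ _; exact le_rfl
  | add e f h1 h2 | sub e f h1 h2 | mul e f h1 h2 | div e f h1 h2 =>
    intro s a b c
    exact Nat.add_le_add_right (add_le_add (h1 he.1 s a b c) (h2 he.2 s a b c)) 1
  | sum v N e h | sup v N e h =>
    intro s a b c
    exact cost_sum_le (h he.2.2.2.2) he.1 he.2.1 he.2.2.1 he.2.2.2.1 a b c

end Expr

namespace Stmt

/-- A `tab` over an `n × Q` matrix with cheap entries. -/
theorem tab_cost_le_rows (inp : Input) {A N₃ n d Q : ℕ} {e : Expr} (he : e.Standard) {s : View}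
    (hs : s.Sizes n d) (hQ : 1 ≤ Q) (h9 : d ≤ Q) (h14 : s.idx 14 ≤ Q) (hN : N₃ = 7 ∨ N₃ = 9)
    (hB : e.costBound (n + 1) Q ≤ 200 * Q ^ 2) :
    (tab A 7 8 N₃ e).cost inp s ≤ 300 * ((n + 1) * Q ^ 4) := by
  have h1 := tab_cost_le inp (A := A) (N₁ := 7) (N₂ := 8) (N₃ := N₃) (e := e) (s := s)
    (M₁ := 1) (M₂ := n + 1) (M₃ := Q) (B := 200 * Q ^ 2) (by norm_num)
    (by rcases hN with rfl | rfl <;> norm_num) (by rcases hN with rfl | rfl <;> norm_num)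
    hs.one.le (by rw [hs.idx_n]; omega) (by
      rcases hN with rfl | rfl
      · rwa [hs.one]
      · rwa [hs.idx_d]) (fun s' h => (Expr.cost_le_costBound he s'
        (by rw [h 8 (by norm_num) (by norm_num) (by norm_num), hs.idx_n]; omega)
        (by rw [h 9 (by norm_num) (by norm_num) (by norm_num), hs.idx_d]; exact h9)
        (by rw [h 14 (by norm_num) (by norm_num) (by norm_num)]; exact h14)).trans hB)
  refine h1.trans ?_
  have q1 : 1 ≤ Q ^ 4 := Nat.one_le_pow _ _ hQ
  have q2 : Q ≤ Q ^ 4 := Nat.le_self_pow (by norm_num) Q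
  have q3 : Q ^ 3 ≤ Q ^ 4 := Nat.pow_le_pow_right hQ (by norm_num)
  calc 1 * ((n + 1) * (Q * (200 * Q ^ 2 + 11) + 20) + 20) + 10
      ≤ (n + 1) * (200 * Q ^ 3 + 11 * Q + 20) + (n + 1) * 30 := by ring_nf; omega
    _ = (n + 1) * (200 * Q ^ 3 + 11 * Q + 50) := by ring
    _ ≤ (n + 1) * (300 * Q ^ 4) := Nat.mul_le_mul_left _ (by omega)
    _ = _ := by ring

/-- A `tab` over a `Q × Q × Q` array, with entries that take linear time. -/
theorem tab_cost_le_cube (inp : Input) {A N₁ N₂ N₃ n d Q : ℕ} {e : Expr} (he : e.Standard)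
    {s : View} (hs : s.Sizes n d) (hQ : 1 ≤ Q) (h9 : d ≤ Q) (h14 : s.idx 14 ≤ Q)
    (hN₁ : N₁ = 7 ∨ N₁ = 14) (hN₂ : N₂ = 7 ∨ N₂ = 9) (hN₃ : N₃ = 7 ∨ N₃ = 9)
    (hB : e.costBound (n + 1) Q ≤ 200 * ((n + 1) * Q)) :
    (tab A N₁ N₂ N₃ e).cost inp s ≤ 300 * ((n + 1) * Q ^ 4) := by
  have h1 := tab_cost_le inp (A := A) (N₁ := N₁) (N₂ := N₂) (N₃ := N₃) (e := e) (s := s)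
    (M₁ := Q) (M₂ := Q) (M₃ := Q) (B := 200 * ((n + 1) * Q))
    (by rcases hN₂ with rfl | rfl <;> norm_num)
    (by rcases hN₃ with rfl | rfl <;> norm_num) (by rcases hN₃ with rfl | rfl <;> norm_num)
    (by rcases hN₁ with rfl | rfl <;> simp [hs.one, hQ, h14])
    (by rcases hN₂ with rfl | rfl <;> simp [hs.one, hs.idx_d, hQ, h9])
    (by rcases hN₃ with rfl | rfl <;> simp [hs.one, hs.idx_d, hQ, h9])
    (fun s' h => (Expr.cost_le_costBound he s'
        (by rw [h 8 (by norm_num) (by norm_num) (by norm_num), hs.idx_n]; omega)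
        (by rw [h 9 (by norm_num) (by norm_num) (by norm_num), hs.idx_d]; exact h9)
        (by rw [h 14 (by norm_num) (by norm_num) (by norm_num)]; exact h14)).trans hB)
  refine h1.trans ?_
  have q1 : 1 ≤ Q ^ 4 := Nat.one_le_pow _ _ hQ
  have q2 : Q ≤ Q ^ 4 := Nat.le_self_pow (by norm_num) Q
  have q3 : Q ^ 3 ≤ Q ^ 4 := Nat.pow_le_pow_right hQ (by norm_num)
  have q4 : Q ^ 2 ≤ Q ^ 4 := Nat.pow_le_pow_right hQ (by norm_num)
  calc Q * (Q * (Q * (200 * ((n + 1) * Q) + 11) + 20) + 20) + 10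
      = 200 * ((n + 1) * Q ^ 4) + (11 * Q ^ 3 + 20 * Q ^ 2 + 20 * Q + 10) := by ring
    _ ≤ 200 * ((n + 1) * Q ^ 4) + 100 * ((n + 1) * Q ^ 4) := by
      have : Q ^ 4 ≤ (n + 1) * Q ^ 4 := Nat.le_mul_of_pos_left _ (by omega)
      omega
    _ = _ := by ring

end Stmt

/-! ### The backward pass through attention, with a factored attention matrix -/

section Factored

variable {n d L : ℕ}

/-- The attention matrix with rows proportional to those of `∑_q u_q v_qᵀ`. -/
def factoredAttn (u v : Fin L → Fin n → ℝ) : Mat n n :=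
  Matrix.of fun j k => (∑ q, u q j * v q k) / ∑ k', ∑ q, u q j * v q k'

theorem sum_factor_right (u v : Fin L → Fin n → ℝ) (j : Fin n) :
    ∑ q, u q j * ∑ k, v q k = ∑ k, ∑ q, u q j * v q k := by
  simp only [Finset.mul_sum]
  exact Finset.sum_comm

/-- On the left, the inner sum over `j` does not depend on `k`: it is computed once for each `q`,
and a product with the attention matrix takes about `n L` instead of `n ^ 2` operations. -/
theorem sum_factor_columns (u v : Fin L → Fin n → ℝ) (M : Fin n → ℝ) (k : Fin n) :
    ∑ q, v q k * ∑ j, u q j / (∑ q', u q' j * ∑ k', v q' k') * M j =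
      ∑ j, factoredAttn u v j k * M j := by
  simp only [factoredAttn, Matrix.of_apply, ← sum_factor_right, Finset.mul_sum]
  rw [Finset.sum_comm]
  refine Finset.sum_congr rfl fun j _ => ?_
  rw [div_mul_eq_mul_div, Finset.sum_mul, Finset.sum_div]
  exact Finset.sum_congr rfl fun _ _ => by ring

theorem sum_factor_rows (u v : Fin L → Fin n → ℝ) (M : Fin n → ℝ) (j : Fin n) :
    ∑ q, u q j / (∑ q', u q' j * ∑ k', v q' k') * ∑ k, v q k * M k =
      ∑ k, factoredAttn u v j k * M k := by
  simp only [factoredAttn, Matrix.of_apply, ← sum_factor_right, Finset.mul_sum]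
  rw [Finset.sum_comm]
  refine Finset.sum_congr rfl fun j _ => ?_
  rw [div_mul_eq_mul_div, Finset.sum_mul, Finset.sum_div]
  exact Finset.sum_congr rfl fun _ _ => by ring

/-- The backward pass through attention in terms of the factors of the attention matrix. -/
theorem factored_backward (u v : Fin L → Fin n → ℝ) (X Y H G : Mat n d) (V : Mat d d)
    {D ρ : Fin n → ℝ} (hD : ∀ j, D j = ∑ q, u q j * ∑ k, v q k)
    (hρ : ∀ j, ρ j = (∑ a, G j a * ∑ q, u q j * ∑ k, v q k * H k a) / D j) (k : Fin n)
    (b : Fin d) :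
    (∑ q, v q k * ((∑ j, u q j / D j * ∑ a, G j a * V b a) +
        (∑ a, H k a * ∑ j, u q j / D j * (G j a * X j b)) -
          ∑ j, u q j / D j * (ρ j * X j b))) +
      ∑ q, u q k / D k * ((∑ a, G k a * ∑ k', v q k' * (H k' a * Y k' b)) -
        ρ k * ∑ k', v q k' * Y k' b) =
      attnBackward (factoredAttn u v) X Y H V G k b := by
  have hρ' : ∀ j, ρ j = ∑ a, G j a * ∑ k', factoredAttn u v j k' * H k' a := by
    intro j
    rw [hρ, Finset.sum_div]
    refine Finset.sum_congr rfl fun a _ => ?_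
    rw [← sum_factor_rows, ← hD, mul_div_assoc, Finset.sum_div]
    congr 1
    exact Finset.sum_congr rfl fun _ _ => by ring
  have e1 := sum_factor_columns u v (fun j => ∑ a, G j a * V b a) k
  -- The coefficient `∑ a, G j a * H k a` couples `j` and `k`, but has rank `d`. Postponing the
  -- contraction over `a` separates the two indices, at the price of an array of size `L × d × d`.
  have e2 : ∑ q, v q k * ∑ a, H k a * ∑ j, u q j / D j * (G j a * X j b) =
      ∑ j, factoredAttn u v j k * ((∑ a, G j a * H k a) * X j b) := by
    have := fun a => sum_factor_columns u v (fun j => G j a * X j b) k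
    simp only [← hD] at this
    calc _ = ∑ a, H k a * ∑ q, v q k * ∑ j, u q j / D j * (G j a * X j b) := by
          simp only [Finset.mul_sum (s := (Finset.univ : Finset (Fin d)))]
          rw [Finset.sum_comm]
          simp only [Finset.mul_sum (s := (Finset.univ : Finset (Fin L)))]
          exact Finset.sum_congr rfl fun _ _ => Finset.sum_congr rfl fun _ _ => by ring
      _ = _ := by
          simp only [this]
          simp only [Finset.mul_sum, Finset.sum_mul]
          rw [Finset.sum_comm]
          exact Finset.sum_congr rfl fun _ _ => Finset.sum_congr rfl fun _ _ => by ring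
  have e3 := sum_factor_columns u v (fun j => ρ j * X j b) k
  have e4 : ∑ q, u q k / D k * ∑ a, G k a * ∑ k', v q k' * (H k' a * Y k' b) =
      ∑ k', factoredAttn u v k k' * ((∑ a, G k a * H k' a) * Y k' b) := by
    have := fun a => sum_factor_rows u v (fun k' => H k' a * Y k' b) k
    simp only [← hD] at this
    calc _ = ∑ a, G k a * ∑ q, u q k / D k * ∑ k', v q k' * (H k' a * Y k' b) := by
          simp only [Finset.mul_sum (s := (Finset.univ : Finset (Fin d)))]
          rw [Finset.sum_comm]
          simp only [Finset.mul_sum (s := (Finset.univ : Finset (Fin L)))]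
          exact Finset.sum_congr rfl fun _ _ => Finset.sum_congr rfl fun _ _ => by ring
      _ = _ := by
          simp only [this]
          simp only [Finset.mul_sum, Finset.sum_mul]
          rw [Finset.sum_comm]
          exact Finset.sum_congr rfl fun _ _ => Finset.sum_congr rfl fun _ _ => by ring
  have e5 := sum_factor_rows u v (fun k' => Y k' b) k
  simp only [← hD] at e1 e3 e5
  have e6 : ∑ q, u q k / D k * (ρ k * ∑ k', v q k' * Y k' b) =
      ρ k * ∑ k', factoredAttn u v k k' * Y k' b := by
    rw [← e5, Finset.mul_sum]
    exact Finset.sum_congr rfl fun _ _ => by ring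
  simp only [attnBackward, scoreCotangent, Matrix.of_apply, ← hρ', mul_sub, mul_add, sub_mul,
    Finset.sum_add_distrib, Finset.sum_sub_distrib, e1, e2, e3, e4, e6]
  have f1 : ∑ j, factoredAttn u v j k * (∑ a, G j a * H k a) * X j b =
      ∑ j, factoredAttn u v j k * ((∑ a, G j a * H k a) * X j b) :=
    Finset.sum_congr rfl fun _ _ => by ring
  have f2 : ∑ j, factoredAttn u v j k * ρ j * X j b =
      ∑ j, factoredAttn u v j k * (ρ j * X j b) := Finset.sum_congr rfl fun _ _ => by ring
  have f3 : ∑ j, factoredAttn u v k j * (∑ a, G k a * H j a) * Y j b =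
      ∑ j, factoredAttn u v k j * ((∑ a, G k a * H j a) * Y j b) :=
    Finset.sum_congr rfl fun _ _ => by ring
  have f4 : ∑ j, factoredAttn u v k j * ρ k * Y j b = ρ k * ∑ j, factoredAttn u v k j * Y j b := by
    rw [Finset.mul_sum]
    exact Finset.sum_congr rfl fun _ _ => by ring
  rw [f1, f2, f3, f4]
  ring

end Factored

/-! ### The program for the backward pass through attention -/

namespace Stmt

/-- The steps of the backward pass after the monomials have been listed. Array `3` holds the
cotangent, the arrays `4`, `5`, `6` the matrices `X`, `Y`, `H`. Array `2` receives the sum of the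
cotangent and the result. -/
def contract : Stmt :=
  -- Arrays `12` to `15` contract `v` over the points with `1`, `H`, `Y` and the products of `H` and
  -- `Y`; `16` and `17` hold the row sums `D` and the means `ρ`; `18`, `19`, `21` contract `u / D`
  -- with `G Vᵀ`, `ρ X` and the products of `G` and `X`. No array has two indices of size `n`.
  .seq (tab 12 14 7 7 (.sum 4 8 (.arr 11 1 4 0)))
  (.seq (tab 13 14 9 7 (.sum 4 8 (.mul (.arr 11 1 4 0) (.arr 6 0 4 2))))
  (.seq (tab 14 14 9 7 (.sum 4 8 (.mul (.arr 11 1 4 0) (.arr 5 0 4 2))))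
  (.seq (tab 15 14 9 9 (.sum 4 8 (.mul (.arr 11 1 4 0) (.mul (.arr 6 0 4 2) (.arr 5 0 4 3)))))
  (.seq (tab 16 7 8 7 (.sum 4 14 (.mul (.arr 10 4 2 0) (.arr 12 4 0 0))))
  (.seq (tab 17 7 8 7 (.div (.sum 4 9 (.mul (.arr 3 0 2 4)
    (.sum 5 14 (.mul (.arr 10 5 2 0) (.arr 13 5 4 0))))) (.arr 16 0 2 0)))
  (.seq (tab 18 14 9 7 (.sum 4 8 (.mul (.div (.arr 10 1 4 0) (.arr 16 0 4 0))
    (.sum 5 9 (.mul (.arr 3 0 4 5) (.inp 4 11 2 5))))))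
  (.seq (tab 19 14 9 7 (.sum 4 8 (.mul (.div (.arr 10 1 4 0) (.arr 16 0 4 0))
    (.mul (.arr 17 0 4 0) (.arr 4 0 4 2)))))
  (.seq (tab 21 14 9 9 (.sum 4 8 (.mul (.div (.arr 10 1 4 0) (.arr 16 0 4 0))
    (.mul (.arr 3 0 4 2) (.arr 4 0 4 3)))))
  (tab 2 7 8 9 (.add (.arr 3 0 2 3) (.add
    (.sum 4 14 (.mul (.arr 11 4 2 0) (.sub (.add (.arr 18 4 3 0)
      (.sum 5 9 (.mul (.arr 6 0 2 5) (.arr 21 4 5 3)))) (.arr 19 4 3 0))))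
    (.sum 4 14 (.mul (.div (.arr 10 4 2 0) (.arr 16 0 2 0)) (.sub
      (.sum 5 9 (.mul (.arr 3 0 2 5) (.arr 15 4 5 3)))
      (.mul (.arr 17 0 2 0) (.arr 14 4 3 0))))))))))))))))

set_option maxHeartbeats 1600000 in
-- Each of the ten tables either has at most `Q ^ 3` entries of cost `O(n Q)`, or at most `n Q`
-- entries of cost `O(Q ^ 2)`. The values match `factored_backward` term by term.
theorem contract_spec {inp : Input} {n d L Q : ℕ} {s : View} (hs : s.Sizes n d)
    (hL : s.idx 14 = L) (hQ : 1 ≤ Q) (hdQ : d ≤ Q) (hLQ : L ≤ Q) {X Y H G : Mat n d} {V : Mat d d}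
    {u v : Fin L → Fin n → ℝ} (hG : s.HoldsMat 3 G) (hX : s.HoldsMat 4 X) (hY : s.HoldsMat 5 Y)
    (hH : s.HoldsMat 6 H) (hu : ∀ q j, s.real (10, (q : Fin L), (j : Fin n), 0) = u q j)
    (hv : ∀ q j, s.real (11, (q : Fin L), (j : Fin n), 0) = v q j)
    (hV : ∀ a b, inp.real (4, s.idx 11, (a : Fin d), (b : Fin d)) = V a b) :
    contract.cost inp s ≤ 3000 * ((n + 1) * Q ^ 4) ∧
    (contract.run inp s).idx = s.idx ∧
    (contract.run inp s).HoldsMat 2 (G + attnBackward (factoredAttn u v) X Y H V G) := by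
  have hst : ∀ {s' : View}, s'.idx = s.idx → s'.Sizes n d ∧ s'.idx 14 = L := fun h =>
    ⟨hs.congr (by rw [h]) (by rw [h]) (by rw [h]) (by rw [h]), by rw [h, hL]⟩
  have hQ2 : Q ≤ Q ^ 2 := Nat.le_self_pow (by norm_num) Q
  have hnQ : n + 1 ≤ (n + 1) * Q := Nat.le_mul_of_pos_right _ hQ
  have hQn : Q ≤ (n + 1) * Q := Nat.le_mul_of_pos_left _ (by omega)
  -- the ten assignments
  let e₁ : Expr := .sum 4 8 (.arr 11 1 4 0)
  let e₂ : Expr := .sum 4 8 (.mul (.arr 11 1 4 0) (.arr 6 0 4 2))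
  let e₃ : Expr := .sum 4 8 (.mul (.arr 11 1 4 0) (.arr 5 0 4 2))
  let e₄ : Expr := .sum 4 8 (.mul (.arr 11 1 4 0) (.mul (.arr 6 0 4 2) (.arr 5 0 4 3)))
  let e₅ : Expr := .sum 4 14 (.mul (.arr 10 4 2 0) (.arr 12 4 0 0))
  let e₆ : Expr := .div (.sum 4 9 (.mul (.arr 3 0 2 4)
    (.sum 5 14 (.mul (.arr 10 5 2 0) (.arr 13 5 4 0))))) (.arr 16 0 2 0)
  let e₇ : Expr := .sum 4 8 (.mul (.div (.arr 10 1 4 0) (.arr 16 0 4 0))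
    (.sum 5 9 (.mul (.arr 3 0 4 5) (.inp 4 11 2 5))))
  let e₈ : Expr := .sum 4 8 (.mul (.div (.arr 10 1 4 0) (.arr 16 0 4 0))
    (.mul (.arr 17 0 4 0) (.arr 4 0 4 2)))
  let e₉ : Expr := .sum 4 8 (.mul (.div (.arr 10 1 4 0) (.arr 16 0 4 0))
    (.mul (.arr 3 0 4 2) (.arr 4 0 4 3)))
  let e₁₀ : Expr := .add (.arr 3 0 2 3) (.add
    (.sum 4 14 (.mul (.arr 11 4 2 0) (.sub (.add (.arr 18 4 3 0)
      (.sum 5 9 (.mul (.arr 6 0 2 5) (.arr 21 4 5 3)))) (.arr 19 4 3 0))))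
    (.sum 4 14 (.mul (.div (.arr 10 4 2 0) (.arr 16 0 2 0)) (.sub
      (.sum 5 9 (.mul (.arr 3 0 2 5) (.arr 15 4 5 3)))
      (.mul (.arr 17 0 2 0) (.arr 14 4 3 0))))))
  obtain ⟨i1, o1, f1⟩ := tab_spec inp (A := 12) (N₁ := 14) (N₂ := 7) (N₃ := 7) (e := e₁)
    (by simp [e₁, Expr.Avoids]) (by norm_num) (by norm_num) (by norm_num) s
  have c1 := tab_cost_le_cube inp (A := 12) (N₁ := 14) (N₂ := 7) (N₃ := 7) (e := e₁) (s := s)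
    (by simp [e₁, Expr.Standard]) hs hQ hdQ (by omega) (by norm_num) (by norm_num) (by norm_num)
    (by simp only [e₁, Expr.costBound, if_true]; ring_nf at hnQ hQn ⊢; omega)
  set s₁ := (tab 12 14 7 7 e₁).run inp s with hs₁
  obtain ⟨z1, l1⟩ := hst i1
  obtain ⟨i2, o2, f2⟩ := tab_spec inp (A := 13) (N₁ := 14) (N₂ := 9) (N₃ := 7) (e := e₂)
    (by simp [e₂, Expr.Avoids]) (by norm_num) (by norm_num) (by norm_num) s₁
  have c2 := tab_cost_le_cube inp (A := 13) (N₁ := 14) (N₂ := 9) (N₃ := 7) (e := e₂) (s := s₁)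
    (by simp [e₂, Expr.Standard]) z1 hQ hdQ (by omega) (by norm_num) (by norm_num) (by norm_num)
    (by simp only [e₂, Expr.costBound, if_true]; ring_nf at hnQ hQn ⊢; omega)
  set s₂ := (tab 13 14 9 7 e₂).run inp s₁ with hs₂
  replace i2 := i2.trans i1
  obtain ⟨z2, l2⟩ := hst i2
  obtain ⟨i3, o3, f3⟩ := tab_spec inp (A := 14) (N₁ := 14) (N₂ := 9) (N₃ := 7) (e := e₃)
    (by simp [e₃, Expr.Avoids]) (by norm_num) (by norm_num) (by norm_num) s₂
  have c3 := tab_cost_le_cube inp (A := 14) (N₁ := 14) (N₂ := 9) (N₃ := 7) (e := e₃) (s := s₂)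
    (by simp [e₃, Expr.Standard]) z2 hQ hdQ (by omega) (by norm_num) (by norm_num) (by norm_num)
    (by simp only [e₃, Expr.costBound, if_true]; ring_nf at hnQ hQn ⊢; omega)
  set s₃ := (tab 14 14 9 7 e₃).run inp s₂ with hs₃
  replace i3 := i3.trans i2
  obtain ⟨z3, l3⟩ := hst i3
  obtain ⟨i4, o4, f4⟩ := tab_spec inp (A := 15) (N₁ := 14) (N₂ := 9) (N₃ := 9) (e := e₄)
    (by simp [e₄, Expr.Avoids]) (by norm_num) (by norm_num) (by norm_num) s₃
  have c4 := tab_cost_le_cube inp (A := 15) (N₁ := 14) (N₂ := 9) (N₃ := 9) (e := e₄) (s := s₃)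
    (by simp [e₄, Expr.Standard]) z3 hQ hdQ (by omega) (by norm_num) (by norm_num) (by norm_num)
    (by simp only [e₄, Expr.costBound, if_true]; ring_nf at hnQ hQn ⊢; omega)
  set s₄ := (tab 15 14 9 9 e₄).run inp s₃ with hs₄
  replace i4 := i4.trans i3
  obtain ⟨z4, l4⟩ := hst i4
  obtain ⟨i5, o5, f5⟩ := tab_spec inp (A := 16) (N₁ := 7) (N₂ := 8) (N₃ := 7) (e := e₅)
    (by simp [e₅, Expr.Avoids]) (by norm_num) (by norm_num) (by norm_num) s₄
  have c5 := tab_cost_le_rows inp (A := 16) (N₃ := 7) (e := e₅) (s := s₄)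
    (by simp [e₅, Expr.Standard]) z4 hQ hdQ (by omega) (by norm_num)
    (by simp [e₅, Expr.costBound]; ring_nf at hQ2 ⊢; omega)
  set s₅ := (tab 16 7 8 7 e₅).run inp s₄ with hs₅
  replace i5 := i5.trans i4
  obtain ⟨z5, l5⟩ := hst i5
  obtain ⟨i6, o6, f6⟩ := tab_spec inp (A := 17) (N₁ := 7) (N₂ := 8) (N₃ := 7) (e := e₆)
    (by simp [e₆, Expr.Avoids]) (by norm_num) (by norm_num) (by norm_num) s₅
  have c6 := tab_cost_le_rows inp (A := 17) (N₃ := 7) (e := e₆) (s := s₅)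
    (by simp [e₆, Expr.Standard]) z5 hQ hdQ (by omega) (by norm_num)
    (by simp [e₆, Expr.costBound]; ring_nf at hQ2 ⊢; omega)
  set s₆ := (tab 17 7 8 7 e₆).run inp s₅ with hs₆
  replace i6 := i6.trans i5
  obtain ⟨z6, l6⟩ := hst i6
  obtain ⟨i7, o7, f7⟩ := tab_spec inp (A := 18) (N₁ := 14) (N₂ := 9) (N₃ := 7) (e := e₇)
    (by simp [e₇, Expr.Avoids]) (by norm_num) (by norm_num) (by norm_num) s₆
  have c7 := tab_cost_le_cube inp (A := 18) (N₁ := 14) (N₂ := 9) (N₃ := 7) (e := e₇) (s := s₆)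
    (by simp [e₇, Expr.Standard]) z6 hQ hdQ (by omega) (by norm_num) (by norm_num) (by norm_num)
    (by simp [e₇, Expr.costBound]; ring_nf at hnQ hQn ⊢; omega)
  set s₇ := (tab 18 14 9 7 e₇).run inp s₆ with hs₇
  replace i7 := i7.trans i6
  obtain ⟨z7, l7⟩ := hst i7
  obtain ⟨i8, o8, f8⟩ := tab_spec inp (A := 19) (N₁ := 14) (N₂ := 9) (N₃ := 7) (e := e₈)
    (by simp [e₈, Expr.Avoids]) (by norm_num) (by norm_num) (by norm_num) s₇
  have c8 := tab_cost_le_cube inp (A := 19) (N₁ := 14) (N₂ := 9) (N₃ := 7) (e := e₈) (s := s₇)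
    (by simp [e₈, Expr.Standard]) z7 hQ hdQ (by omega) (by norm_num) (by norm_num) (by norm_num)
    (by simp only [e₈, Expr.costBound, if_true]; ring_nf at hnQ hQn ⊢; omega)
  set s₈ := (tab 19 14 9 7 e₈).run inp s₇ with hs₈
  replace i8 := i8.trans i7
  obtain ⟨z8, l8⟩ := hst i8
  obtain ⟨i9, o9, f9⟩ := tab_spec inp (A := 21) (N₁ := 14) (N₂ := 9) (N₃ := 9) (e := e₉)
    (by simp [e₉, Expr.Avoids]) (by norm_num) (by norm_num) (by norm_num) s₈
  have c9 := tab_cost_le_cube inp (A := 21) (N₁ := 14) (N₂ := 9) (N₃ := 9) (e := e₉) (s := s₈)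
    (by simp [e₉, Expr.Standard]) z8 hQ hdQ (by omega) (by norm_num) (by norm_num) (by norm_num)
    (by simp only [e₉, Expr.costBound, if_true]; ring_nf at hnQ hQn ⊢; omega)
  set s₉ := (tab 21 14 9 9 e₉).run inp s₈ with hs₉
  replace i9 := i9.trans i8
  obtain ⟨z9, l9⟩ := hst i9
  obtain ⟨i10, o10, f10⟩ := tab_spec inp (A := 2) (N₁ := 7) (N₂ := 8) (N₃ := 9) (e := e₁₀)
    (by simp [e₁₀, Expr.Avoids]) (by norm_num) (by norm_num) (by norm_num) s₉
  have c10 := tab_cost_le_rows inp (A := 2) (N₃ := 9) (e := e₁₀) (s := s₉)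
    (by simp [e₁₀, Expr.Standard]) z9 hQ hdQ (by omega) (by norm_num)
    (by simp [e₁₀, Expr.costBound]; ring_nf at hQ2 ⊢; omega)
  replace i10 := i10.trans i9
  rw [hs.one, hL] at f1
  rw [z1.one, z1.idx_d, l1] at f2
  rw [z2.one, z2.idx_d, l2] at f3
  rw [z3.idx_d, l3] at f4
  rw [z4.one, z4.idx_n] at f5
  rw [z5.one, z5.idx_n] at f6
  rw [z6.one, z6.idx_d, l6] at f7
  rw [z7.one, z7.idx_d, l7] at f8
  rw [z8.idx_d, l8] at f9
  rw [z9.one, z9.idx_n, z9.idx_d] at f10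
  refine ⟨?_, i10, ?_⟩
  · have e : contract.cost inp s = (tab 12 14 7 7 e₁).cost inp s +
      ((tab 13 14 9 7 e₂).cost inp s₁ + ((tab 14 14 9 7 e₃).cost inp s₂ +
      ((tab 15 14 9 9 e₄).cost inp s₃ + ((tab 16 7 8 7 e₅).cost inp s₄ +
      ((tab 17 7 8 7 e₆).cost inp s₅ + ((tab 18 14 9 7 e₇).cost inp s₆ +
      ((tab 19 14 9 7 e₈).cost inp s₇ + ((tab 21 14 9 9 e₉).cost inp s₈ +
        (tab 2 7 8 9 e₁₀).cost inp s₉)))))))) := rfl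
    omega
  have hc : contract.run inp s = (tab 2 7 8 9 e₁₀).run inp s₉ := rfl
  rw [hc]
  -- values of the intermediate arrays
  have w0 := hs.zero
  have w12 : ∀ q : Fin L, s₁.real (12, q, 0, 0) = ∑ k, v q k := by
    intro q
    rw [f1 q q.2 0 one_pos 0 one_pos]
    simp [e₁, Expr.eval, View.setIdx_idx, hs.idx_n, w0, Finset.sum_range, hv]
  have w13 : ∀ (q : Fin L) (a : Fin d), s₂.real (13, q, a, 0) = ∑ k, v q k * H k a := by
    intro q a
    rw [f2 q q.2 a a.2 0 one_pos]
    simp [e₂, Expr.eval, View.setIdx_idx, i1, o1, hs.idx_n, w0, Finset.sum_range, hv, hH _ _]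
  have w14 : ∀ (q : Fin L) (a : Fin d), s₃.real (14, q, a, 0) = ∑ k, v q k * Y k a := by
    intro q a
    rw [f3 q q.2 a a.2 0 one_pos]
    simp [e₃, Expr.eval, View.setIdx_idx, i2, o1, o2, hs.idx_n, w0, Finset.sum_range, hv, hY _ _]
  have w15 : ∀ (q : Fin L) (a b : Fin d), s₄.real (15, q, a, b) =
      ∑ k, v q k * (H k a * Y k b) := by
    intro q a b
    rw [f4 q q.2 a a.2 b b.2]
    simp [e₄, Expr.eval, View.setIdx_idx, i3, o1, o2, o3, hs.idx_n, w0, Finset.sum_range, hv,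
      hH _ _, hY _ _]
  set D : Fin n → ℝ := fun j => ∑ q, u q j * ∑ k, v q k with hD
  have w16 : ∀ j : Fin n, s₅.real (16, 0, j, 0) = D j := by
    intro j
    rw [f5 0 one_pos j j.2 0 one_pos]
    simp [e₅, Expr.eval, View.setIdx_idx, i4, o1, o2, o3, o4, hL, w0, Finset.sum_range, hu, w12, hD]
  set ρ : Fin n → ℝ := fun j => (∑ a, G j a * ∑ q, u q j * ∑ k, v q k * H k a) / D j with hρ
  have w17 : ∀ j : Fin n, s₆.real (17, 0, j, 0) = ρ j := by
    intro j
    rw [f6 0 one_pos j j.2 0 one_pos]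
    simp [e₆, Expr.eval, View.setIdx_idx, i5, o1, o2, o3, o4, o5, hL, w0, Finset.sum_range, hu,
      hs.idx_d, w13, w16, hG _ _, hρ]
  have w18 : ∀ (q : Fin L) (b : Fin d), s₇.real (18, q, b, 0) =
      ∑ j, u q j / D j * ∑ a, G j a * V b a := by
    intro q b
    rw [f7 q q.2 b b.2 0 one_pos]
    simp [e₇, Expr.eval, View.setIdx_idx, i6, o1, o2, o3, o4, o5, o6, w0, Finset.sum_range,
      hs.idx_n, hs.idx_d, hu, w16, hG _ _, hV]
  have w19 : ∀ (q : Fin L) (b : Fin d), s₈.real (19, q, b, 0) =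
      ∑ j, u q j / D j * (ρ j * X j b) := by
    intro q b
    rw [f8 q q.2 b b.2 0 one_pos]
    simp [e₈, Expr.eval, View.setIdx_idx, i7, o1, o2, o3, o4, o5, o6, o7, w0, Finset.sum_range,
      hs.idx_n, hu, w16, w17, hX _ _]
  have w21 : ∀ (q : Fin L) (a b : Fin d), s₉.real (21, q, a, b) =
      ∑ j, u q j / D j * (G j a * X j b) := by
    intro q a b
    rw [f9 q q.2 a a.2 b b.2]
    simp [e₉, Expr.eval, View.setIdx_idx, i8, o1, o2, o3, o4, o5, o6, o7, o8, w0,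
      Finset.sum_range, hs.idx_n, hu, w16, hX _ _, hG _ _]
  intro k b
  rw [f10 0 one_pos k k.2 b b.2, Matrix.add_apply,
    ← factored_backward u v X Y H G V (D := D) (ρ := ρ) (fun _ => rfl) (fun _ => rfl) k b]
  simp [e₁₀, Expr.eval, View.setIdx_idx, i9, o1, o2, o3, o4, o5, o6, o7, o8, o9, w0,
      Finset.sum_range, hs.idx_d, hL, hu, hv, w14, w15, w16, w17, w18, w19, w21, hG _ _, hH _ _]

end Stmt

/-! ### Preparations: largest entries, search for the degree, data of a layer -/

theorem abs_le_supAbs {f : ℕ → ℝ} {N t : ℕ} (h : t < N) : |f t| ≤ supAbs f N := by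
  induction N with
  | zero => omega
  | succ N ih =>
    rcases Nat.lt_succ_iff_lt_or_eq.1 h with h | rfl
    · exact (ih h).trans (le_max_left _ _)
    · exact le_max_right _ _

theorem supAbs_le {f : ℕ → ℝ} {N : ℕ} {B : ℝ} (hB : 0 ≤ B) (h : ∀ t < N, |f t| ≤ B) :
    supAbs f N ≤ B := by
  induction N with
  | zero => exact hB
  | succ N ih => exact max_le (ih fun t ht => h t (by omega)) (h N (by omega))

theorem supAbs_nonneg (f : ℕ → ℝ) (N : ℕ) : 0 ≤ supAbs f N := by
  cases N with
  | zero => exact le_rfl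
  | succ N => exact (abs_nonneg _).trans (le_max_right _ _)

/-- The number `g` that the search for a degree finds: all terms `r ^ t / t!`, `g ≤ t < n`, of the
exponential series are at most `ε`, and `g` is minimal. -/
structure IsDegree (n : ℕ) (r ε : ℝ) (g : ℕ) : Prop where
  small : ∀ t < n, g ≤ t → r ^ t / t.factorial ≤ ε
  minimal : g = 0 ∨ ∃ t < n, g = t + 1 ∧ ε < r ^ t / t.factorial

namespace Stmt

/-- The `K`-th power of variable `8`. -/
def powExpr : ℕ → Expr
  | 0 => .const 1
  | K + 1 => .mul (.ofIdx 8) (powExpr K)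

theorem powExpr_eval (inp : Input) (K : ℕ) (s : View) :
    (powExpr K).eval inp s = (s.idx 8 : ℝ) ^ K := by
  induction K with
  | zero => simp [powExpr, Expr.eval]
  | succ K ih => simp [powExpr, Expr.eval, ih, pow_succ']

theorem powExpr_avoids (A K : ℕ) : (powExpr K).Avoids A := by
  induction K with
  | zero => trivial
  | succ K ih => exact ⟨trivial, ih⟩

theorem powExpr_standard (K : ℕ) : (powExpr K).Standard := by
  induction K with
  | zero => trivial
  | succ K ih => exact ⟨trivial, ih⟩

theorem powExpr_costBound (m Q K : ℕ) : (powExpr K).costBound m Q = 2 * K + 1 := by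
  induction K with
  | zero => rfl
  | succ K ih => simp only [powExpr, Expr.costBound, ih]; ring

/-- The search for the degree, which variable `13` receives. Array `7` holds the bound `r` for the
scores and array `20` the allowed error. -/
def findDegree : Stmt :=
  .seq (.iconst 13 0) (.seq (.asn 8 0 0 0 (.const 1)) (.loop 20 8 (.seq
    (.ifLt (.arr 20 0 0 0) (.arr 8 0 0 0) (.seq (.icopy 13 20) (.isucc 13)))
    (.asn 8 0 0 0 (.div (.mul (.arr 8 0 0 0) (.arr 7 0 0 0)) (.add (.ofIdx 20) (.const 1)))))))

/-- The terms `r ^ t / t!` need not be monotone in `t`, so the loop passes through all `t < n` and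
remembers the successor of the last index whose term exceeds the allowed error. -/
theorem findDegree_spec {inp : Input} {n d : ℕ} {s : View} (hs : s.Sizes n d) :
    findDegree.cost inp s ≤ 50 * (n + 1) ∧
    IsDegree n (s.real (7, 0, 0, 0)) (s.real (20, 0, 0, 0)) ((findDegree.run inp s).idx 13) ∧
    View.SameBut {13} {8} s (findDegree.run inp s) := by
  set r := s.real (7, 0, 0, 0) with hr
  set ε := s.real (20, 0, 0, 0) with hε
  set s₁ := (s.setIdx 13 0).setReal (8, 0, 0, 0) 1 with hs₁
  have h1 : View.SameBut {13, 20} {8} s s₁ := by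
    refine ⟨fun w hw => ?_, fun a ha i j k => ?_⟩
    · simp only [Finset.mem_insert, Finset.mem_singleton, not_or] at hw
      simp only [hs₁, View.setReal, View.setIdx_idx]
      rw [if_neg hw.1]
    · simp only [Finset.mem_singleton] at ha
      simp [hs₁, View.setReal, ha]
  obtain ⟨hc, s', ⟨hV, hsm, hmin, hs'⟩, hrun⟩ := for_spec (inp := inp) (v := 20) (N := 8) (B := 15)
    (S := .seq (.ifLt (.arr 20 0 0 0) (.arr 8 0 0 0) (.seq (.icopy 13 20) (.isucc 13)))
      (.asn 8 0 0 0 (.div (.mul (.arr 8 0 0 0) (.arr 7 0 0 0)) (.add (.ofIdx 20) (.const 1)))))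
    (s := s₁)
    (I := fun t s' => s'.real (8, 0, 0, 0) = r ^ t / t.factorial ∧
      (∀ t' < t, s'.idx 13 ≤ t' → r ^ t' / t'.factorial ≤ ε) ∧
      (s'.idx 13 = 0 ∨ ∃ t' < t, s'.idx 13 = t' + 1 ∧ ε < r ^ t' / t'.factorial) ∧
      View.SameBut {13, 20} {8} s s')
    ⟨by simp [hs₁, View.setReal], by simp, Or.inl (by simp [hs₁, View.setReal, View.setIdx_idx]),
      h1⟩ (by
    rintro t - s' ⟨hV, hsm, hmin, hs'⟩
    have hs'' := hs'.setIdx (v := 20) (by decide) t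
    have e13 : (s'.setIdx 20 t).idx 13 = s'.idx 13 := by simp [View.setIdx_idx]
    have e20 : (s'.setIdx 20 t).idx 20 = t := by simp [View.setIdx_idx]
    have hV' : (s'.setIdx 20 t).real (8, 0, 0, 0) = r ^ t / t.factorial := hV
    set s'' := s'.setIdx 20 t
    have hz := (hs.sameBut hs'').zero
    have hr' : s''.real (7, 0, 0, 0) = r := hs''.real 7 (by decide) _ _ _
    have hε' : s''.real (20, 0, 0, 0) = ε := hs''.real 20 (by decide) _ _ _
    have hnext : r ^ t / (t.factorial : ℝ) * r / (t + 1) = r ^ (t + 1) / (t + 1).factorial := by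
      rw [Nat.factorial_succ]
      push_cast
      rw [pow_succ]
      field_simp
    by_cases hlt : ε < r ^ t / t.factorial
    · have hrun : (Stmt.seq (.ifLt (.arr 20 0 0 0) (.arr 8 0 0 0) (.seq (.icopy 13 20) (.isucc 13)))
          (.asn 8 0 0 0 (.div (.mul (.arr 8 0 0 0) (.arr 7 0 0 0))
            (.add (.ofIdx 20) (.const 1))))).run inp s'' =
          (s''.setIdx 13 (t + 1)).setReal (8, 0, 0, 0) (r ^ (t + 1) / (t + 1).factorial) := by
        simp [run, Expr.eval, hz, hr', hε', hV', hlt, View.setIdx_idx, e20, hnext]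
      rw [hrun]
      refine ⟨by simp [cost, Expr.cost, Expr.eval, hz, hε', hV', hlt], ?_, ?_, ?_, ?_⟩
      · simp [View.setReal]
      · intro t' ht' h
        simp only [View.setReal, View.setIdx_idx, if_true] at h
        omega
      · exact Or.inr ⟨t, by omega, by simp [View.setReal, View.setIdx_idx], hlt⟩
      · refine ⟨fun w hw => ?_, fun a ha i j k => ?_⟩
        · exact (hs''.setIdx (v := 13) (by decide) (t + 1)).idx w hw
        · have := hs''.real a ha i j k
          simp only [Finset.mem_singleton] at ha
          simpa [View.setReal, ha] using this
    · have hrun : (Stmt.seq (.ifLt (.arr 20 0 0 0) (.arr 8 0 0 0) (.seq (.icopy 13 20) (.isucc 13)))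
          (.asn 8 0 0 0 (.div (.mul (.arr 8 0 0 0) (.arr 7 0 0 0))
            (.add (.ofIdx 20) (.const 1))))).run inp s'' =
          s''.setReal (8, 0, 0, 0) (r ^ (t + 1) / (t + 1).factorial) := by
        simp [run, Expr.eval, hz, hr', hε', hV', hlt, e20, hnext]
      rw [hrun]
      refine ⟨by simp [cost, Expr.cost, Expr.eval, hz, hε', hV', hlt], ?_, ?_, ?_, ?_⟩
      · simp [View.setReal]
      · intro t' ht' h
        simp only [View.setReal, e13] at h
        rcases Nat.lt_succ_iff_lt_or_eq.1 ht' with h' | rfl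
        · exact hsm t' h' h
        · exact not_lt.1 hlt
      · simp only [View.setReal, e13]
        exact hmin.imp id fun ⟨t', h', h''⟩ => ⟨t', by omega, h''⟩
      · refine ⟨fun w hw => hs''.idx w hw, fun a ha i j k => ?_⟩
        have := hs''.real a ha i j k
        simp only [Finset.mem_singleton] at ha
        simpa [View.setReal, ha] using this)
  have hn : s₁.idx 8 = n := (hs.sameBut h1).idx_n
  have e0 : findDegree.run inp s = s'.setIdx 20 (s.idx 20) := by
    have : findDegree.run inp s = (Stmt.loop 20 8 _).run inp
      ((s.setIdx 13 0).setReal (8, (s.setIdx 13 0).idx 0, (s.setIdx 13 0).idx 0,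
        (s.setIdx 13 0).idx 0) ((Expr.const 1).eval inp (s.setIdx 13 0))) := rfl
    have e1 : (s.setIdx 13 0).setReal (8, (s.setIdx 13 0).idx 0, (s.setIdx 13 0).idx 0,
        (s.setIdx 13 0).idx 0) ((Expr.const 1).eval inp (s.setIdx 13 0)) = s₁ := by
      simp [hs₁, View.setIdx_idx, hs.zero, Expr.eval]
    rw [this, e1, hrun]
    simp [hs₁, View.setReal, View.setIdx_idx]
  have e2 : findDegree.cost inp s = 3 + (Stmt.loop 20 8 (.seq
      (.ifLt (.arr 20 0 0 0) (.arr 8 0 0 0) (.seq (.icopy 13 20) (.isucc 13)))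
      (.asn 8 0 0 0 (.div (.mul (.arr 8 0 0 0) (.arr 7 0 0 0))
        (.add (.ofIdx 20) (.const 1)))))).cost inp s₁ := by
    have e1 : (s.setIdx 13 0).setReal (8, (s.setIdx 13 0).idx 0, (s.setIdx 13 0).idx 0,
        (s.setIdx 13 0).idx 0) ((Expr.const 1).eval inp (s.setIdx 13 0)) = s₁ := by
      simp [hs₁, View.setIdx_idx, hs.zero, Expr.eval]
    rw [← e1]
    simp only [findDegree, cost, Expr.cost, run]
    ring_nf
  rw [hn] at hc hV hsm hmin
  refine ⟨by omega, ?_, ?_⟩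
  · rw [e0]
    have : (s'.setIdx 20 (s.idx 20)).idx 13 = s'.idx 13 := by simp [View.setIdx_idx]
    rw [this]
    exact ⟨hsm, hmin⟩
  · rw [e0]
    refine ⟨fun w hw => ?_, hs'.real⟩
    rw [View.setIdx_idx]
    split_ifs with h
    · rw [h]
    · exact hs'.idx w (by simp only [Finset.mem_insert, Finset.mem_singleton] at hw ⊢; tauto)

/-- The preparations: the matrices `X`, `Y`, `H` in the arrays `4`, `5`, `6`, the bound for the
scores in array `7`, and the allowed error `n ^ (-K)` in array `20`. -/
def prepare (K : ℕ) : Stmt :=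
  .seq (tab 4 7 8 9 (.div (.sum 4 9 (.mul (.inp 0 12 2 4)
    (.sum 5 9 (.mul (.inp 2 11 4 5) (.inp 3 11 3 5))))) (.ofIdx 9)))
  (.seq (tab 5 7 8 9 (.div (.sum 4 9 (.mul (.inp 0 12 2 4)
    (.sum 5 9 (.mul (.inp 2 11 3 5) (.inp 3 11 4 5))))) (.ofIdx 9)))
  (.seq (tab 6 7 8 9 (.sum 4 9 (.mul (.inp 0 12 2 4) (.inp 4 11 4 3))))
  -- The bound for the scores is computed from the actual entries, as `R` is unknown to the program:
  -- `d` times the largest entries of `T` and of `X = T W / d`.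
  (.seq (tab 7 7 7 7 (.mul (.ofIdx 9) (.mul (.sup 4 8 (.sup 5 9 (.inp 0 12 4 5)))
    (.sup 4 8 (.sup 5 9 (.arr 4 0 4 5))))))
  (tab 20 7 7 7 (.div (.const 1) (powExpr K))))))

/-- The input arrays hold the argument `T` of the layer and the weights; the numbers of the layers
are in the variables `11` and `12`. -/
structure LayerInput {n d : ℕ} (inp : Input) (s : View) (T : Mat n d) (WQ WK WV : Mat d d) :
    Prop where
  T : ∀ j k, inp.real (0, s.idx 12, (j : Fin n), (k : Fin d)) = T j k
  WQ : ∀ j k, inp.real (2, s.idx 11, (j : Fin d), (k : Fin d)) = WQ j k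
  WK : ∀ j k, inp.real (3, s.idx 11, (j : Fin d), (k : Fin d)) = WK j k
  WV : ∀ j k, inp.real (4, s.idx 11, (j : Fin d), (k : Fin d)) = WV j k

theorem sup_entries_le {n d : ℕ} {f : ℕ → ℕ → ℝ} {A : Mat n d}
    (h : ∀ (j : Fin n) (k : Fin d), f j k = A j k) :
    supAbs (fun j => supAbs (f j) d) n ≤ ‖A‖ := by
  refine supAbs_le (norm_nonneg _) fun j hj => ?_
  rw [abs_of_nonneg (supAbs_nonneg _ _)]
  refine supAbs_le (norm_nonneg _) fun k hk => ?_
  have := h ⟨j, hj⟩ ⟨k, hk⟩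
  simp only at this
  rw [this]
  exact abs_entry_le_norm _ _ _

theorem entry_le_sup {n d : ℕ} {f : ℕ → ℕ → ℝ} {A : Mat n d}
    (h : ∀ (j : Fin n) (k : Fin d), f j k = A j k) (j : Fin n) (k : Fin d) :
    |A j k| ≤ supAbs (fun j => supAbs (f j) d) n := by
  have h1 := abs_le_supAbs (f := fun j => supAbs (f j) d) j.2
  rw [abs_of_nonneg (supAbs_nonneg _ _)] at h1
  rw [← h]
  exact (abs_le_supAbs k.2).trans h1

/-- The bound for the scores from the largest entries of the factors. -/
theorem abs_scores_le {n d : ℕ} {W : Mat d d} {T : Mat n d} {a b : ℝ} (ha : ∀ j k, |T j k| ≤ a)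
    (hb : ∀ j k, |((1 / (d : ℝ)) • (T * W)) j k| ≤ b) (hb0 : 0 ≤ b) (j k : Fin n) :
    |scores W T T j k| ≤ d * (a * b) := by
  rw [scores_right]
  refine (Finset.abs_sum_le_sum_abs _ _).trans ?_
  calc ∑ i, |((1 / (d : ℝ)) • (T * W)) j i * T k i| ≤ ∑ _i : Fin d, b * a :=
        Finset.sum_le_sum fun i _ => by
          rw [abs_mul]
          exact mul_le_mul (hb _ _) (ha _ _) (abs_nonneg _) hb0
    _ = d * (a * b) := by simp [mul_comm]

set_option maxHeartbeats 1000000 in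
theorem prepare_spec {inp : Input} {n d Q K : ℕ} {s : View} (hs : s.Sizes n d) (hQ : 1 ≤ Q)
    (hdQ : d ≤ Q) (hKQ : K ≤ Q) (h14 : s.idx 14 ≤ Q) {T : Mat n d} {WQ WK WV : Mat d d}
    (hin : LayerInput inp s T WQ WK WV) :
    (prepare K).cost inp s ≤ 3000 * ((n + 1) * Q ^ 4) ∧
    ((prepare K).run inp s).HoldsMat 4 ((1 / (d : ℝ)) • (T * (WQ * WK.transpose))) ∧
    ((prepare K).run inp s).HoldsMat 5 ((1 / (d : ℝ)) • (T * (WQ * WK.transpose).transpose)) ∧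
    ((prepare K).run inp s).HoldsMat 6 (T * WV) ∧
    (0 ≤ ((prepare K).run inp s).real (7, 0, 0, 0) ∧
      ((prepare K).run inp s).real (7, 0, 0, 0) ≤ ‖T‖ * ‖T * (WQ * WK.transpose)‖ ∧
      ∀ j k, |scores (WQ * WK.transpose) T T j k| ≤
        ((prepare K).run inp s).real (7, 0, 0, 0)) ∧
    ((prepare K).run inp s).real (20, 0, 0, 0) = 1 / (n : ℝ) ^ K ∧
    View.SameBut ∅ {4, 5, 6, 7, 20} s ((prepare K).run inp s) := by
  have hst : ∀ {s' : View}, s'.idx = s.idx → s'.Sizes n d ∧ s'.idx 14 ≤ Q := fun h =>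
    ⟨hs.congr (by rw [h]) (by rw [h]) (by rw [h]) (by rw [h]), by rw [h]; exact h14⟩
  have hQ2 : Q ≤ Q ^ 2 := Nat.le_self_pow (by norm_num) Q
  have hnQ : n + 1 ≤ (n + 1) * Q := Nat.le_mul_of_pos_right _ hQ
  have hQn : Q ≤ (n + 1) * Q := Nat.le_mul_of_pos_left _ (by omega)
  let e₁ : Expr := .div (.sum 4 9 (.mul (.inp 0 12 2 4)
    (.sum 5 9 (.mul (.inp 2 11 4 5) (.inp 3 11 3 5))))) (.ofIdx 9)
  let e₂ : Expr := .div (.sum 4 9 (.mul (.inp 0 12 2 4)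
    (.sum 5 9 (.mul (.inp 2 11 3 5) (.inp 3 11 4 5))))) (.ofIdx 9)
  let e₃ : Expr := .sum 4 9 (.mul (.inp 0 12 2 4) (.inp 4 11 4 3))
  let e₄ : Expr := .mul (.ofIdx 9) (.mul (.sup 4 8 (.sup 5 9 (.inp 0 12 4 5)))
    (.sup 4 8 (.sup 5 9 (.arr 4 0 4 5))))
  let e₅ : Expr := .div (.const 1) (powExpr K)
  obtain ⟨i1, o1, f1⟩ := tab_spec inp (A := 4) (N₁ := 7) (N₂ := 8) (N₃ := 9) (e := e₁)
    (by simp [e₁, Expr.Avoids]) (by norm_num) (by norm_num) (by norm_num) s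
  have c1 := tab_cost_le_rows inp (A := 4) (N₃ := 9) (e := e₁) (s := s)
    (by simp [e₁, Expr.Standard]) hs hQ hdQ h14 (by norm_num)
    (by simp [e₁, Expr.costBound]; ring_nf at hQ2 ⊢; omega)
  set s₁ := (tab 4 7 8 9 e₁).run inp s with hs₁
  obtain ⟨z1, l1⟩ := hst i1
  obtain ⟨i2, o2, f2⟩ := tab_spec inp (A := 5) (N₁ := 7) (N₂ := 8) (N₃ := 9) (e := e₂)
    (by simp [e₂, Expr.Avoids]) (by norm_num) (by norm_num) (by norm_num) s₁
  have c2 := tab_cost_le_rows inp (A := 5) (N₃ := 9) (e := e₂) (s := s₁)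
    (by simp [e₂, Expr.Standard]) z1 hQ hdQ l1 (by norm_num)
    (by simp [e₂, Expr.costBound]; ring_nf at hQ2 ⊢; omega)
  set s₂ := (tab 5 7 8 9 e₂).run inp s₁ with hs₂
  replace i2 := i2.trans i1
  obtain ⟨z2, l2⟩ := hst i2
  obtain ⟨i3, o3, f3⟩ := tab_spec inp (A := 6) (N₁ := 7) (N₂ := 8) (N₃ := 9) (e := e₃)
    (by simp [e₃, Expr.Avoids]) (by norm_num) (by norm_num) (by norm_num) s₂
  have c3 := tab_cost_le_rows inp (A := 6) (N₃ := 9) (e := e₃) (s := s₂)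
    (by simp [e₃, Expr.Standard]) z2 hQ hdQ l2 (by norm_num)
    (by simp [e₃, Expr.costBound]; ring_nf at hQ2 ⊢; omega)
  set s₃ := (tab 6 7 8 9 e₃).run inp s₂ with hs₃
  replace i3 := i3.trans i2
  obtain ⟨z3, l3⟩ := hst i3
  obtain ⟨i4, o4, f4⟩ := tab_spec inp (A := 7) (N₁ := 7) (N₂ := 7) (N₃ := 7) (e := e₄)
    (by simp [e₄, Expr.Avoids]) (by norm_num) (by norm_num) (by norm_num) s₃
  have c4 := tab_cost_le_cube inp (A := 7) (N₁ := 7) (N₂ := 7) (N₃ := 7) (e := e₄) (s := s₃)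
    (by simp [e₄, Expr.Standard]) z3 hQ hdQ l3 (by norm_num) (by norm_num) (by norm_num)
    (by simp [e₄, Expr.costBound]; ring_nf at hnQ hQn ⊢; omega)
  set s₄ := (tab 7 7 7 7 e₄).run inp s₃ with hs₄
  replace i4 := i4.trans i3
  obtain ⟨z4, l4⟩ := hst i4
  obtain ⟨i5, o5, f5⟩ := tab_spec inp (A := 20) (N₁ := 7) (N₂ := 7) (N₃ := 7) (e := e₅)
    ⟨trivial, powExpr_avoids 20 K⟩ (by norm_num) (by norm_num) (by norm_num) s₄
  have c5 := tab_cost_le_cube inp (A := 20) (N₁ := 7) (N₂ := 7) (N₃ := 7) (e := e₅) (s := s₄)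
    ⟨trivial, powExpr_standard K⟩ z4 hQ hdQ l4 (by norm_num) (by norm_num) (by norm_num)
    (by simp only [e₅, Expr.costBound, powExpr_costBound]; ring_nf at hnQ hQn ⊢; omega)
  replace i5 := i5.trans i4
  rw [hs.one, hs.idx_n, hs.idx_d] at f1
  rw [z1.one, z1.idx_n, z1.idx_d] at f2
  rw [z2.one, z2.idx_n, z2.idx_d] at f3
  rw [z3.one] at f4
  rw [z4.one] at f5
  have hc : (prepare K).run inp s = (tab 20 7 7 7 e₅).run inp s₄ := rfl
  have w0 := hs.zero
  have m1 : s₁.HoldsMat 4 ((1 / (d : ℝ)) • (T * (WQ * WK.transpose))) := by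
    intro j k
    rw [f1 0 one_pos j j.2 k k.2]
    simp [e₁, Expr.eval, View.setIdx_idx, hs.idx_d, Finset.sum_range, hin.T, hin.WQ, hin.WK,
      Matrix.mul_apply, div_eq_inv_mul]
  have m2 : s₂.HoldsMat 5 ((1 / (d : ℝ)) • (T * (WQ * WK.transpose).transpose)) := by
    intro j k
    rw [f2 0 one_pos j j.2 k k.2]
    simp [e₂, Expr.eval, View.setIdx_idx, i1, hs.idx_d, Finset.sum_range, hin.T, hin.WQ, hin.WK,
      Matrix.mul_apply, div_eq_inv_mul, mul_comm (WK _ _)]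
  have m3 : s₃.HoldsMat 6 (T * WV) := by
    intro j k
    rw [f3 0 one_pos j j.2 k k.2]
    simp [e₃, Expr.eval, View.setIdx_idx, i2, hs.idx_d, Finset.sum_range, hin.T, hin.WV,
      Matrix.mul_apply]
  have w7 : s₄.real (7, 0, 0, 0) =
      d * (supAbs (fun j => supAbs (fun k => inp.real (0, s.idx 12, j, k)) d) n *
        supAbs (fun j => supAbs (fun k => s₁.real (4, 0, j, k)) d) n) := by
    rw [f4 0 one_pos 0 one_pos 0 one_pos]
    simp [e₄, Expr.eval, View.setIdx_idx, i3, o2, o3, hs.idx_d, hs.idx_n, w0]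
  rw [hc, o5 _ _ _ _ (by norm_num), w7]
  refine ⟨?_, ?_, ?_, ?_, ⟨?_, ?_, ?_⟩, ?_, ?_⟩
  · have e : (prepare K).cost inp s = (tab 4 7 8 9 e₁).cost inp s +
      ((tab 5 7 8 9 e₂).cost inp s₁ + ((tab 6 7 8 9 e₃).cost inp s₂ +
      ((tab 7 7 7 7 e₄).cost inp s₃ + (tab 20 7 7 7 e₅).cost inp s₄))) := rfl
    omega
  · intro j k
    rw [o5 _ _ _ _ (by norm_num), o4 _ _ _ _ (by norm_num), o3 _ _ _ _ (by norm_num),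
      o2 _ _ _ _ (by norm_num), m1]
  · intro j k
    rw [o5 _ _ _ _ (by norm_num), o4 _ _ _ _ (by norm_num), o3 _ _ _ _ (by norm_num), m2]
  · intro j k
    rw [o5 _ _ _ _ (by norm_num), o4 _ _ _ _ (by norm_num), m3]
  · exact mul_nonneg (by positivity) (mul_nonneg (supAbs_nonneg _ _) (supAbs_nonneg _ _))
  · have h1 := sup_entries_le (f := fun j k => inp.real (0, s.idx 12, j, k)) hin.T
    have h2 := sup_entries_le (f := fun j k => s₁.real (4, 0, j, k)) m1
    rw [norm_smul] at h2
    -- The factor `d` cancels the `1 / d` in `X`, which leaves the product of the two norms bounded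
    -- by `R`. For `d = 0` the product is `0`.
    have h3 : (d : ℝ) * ‖(1 / (d : ℝ))‖ ≤ 1 := by
      rw [Real.norm_of_nonneg (by positivity)]
      rw [mul_one_div]
      exact div_self_le_one _
    have h0 := norm_nonneg T
    have h0' := norm_nonneg (T * (WQ * WK.transpose))
    calc _ ≤ (d : ℝ) * (‖T‖ * (‖(1 / (d : ℝ))‖ * ‖T * (WQ * WK.transpose)‖)) := by
          refine mul_le_mul_of_nonneg_left ?_ (by positivity)
          exact mul_le_mul h1 h2 (supAbs_nonneg _ _) h0
      _ = (d : ℝ) * ‖(1 / (d : ℝ))‖ * (‖T‖ * ‖T * (WQ * WK.transpose)‖) := by ring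
      _ ≤ _ := mul_le_of_le_one_left (by positivity) h3
  · exact abs_scores_le (entry_le_sup (f := fun j k => inp.real (0, s.idx 12, j, k)) hin.T)
      (entry_le_sup (f := fun j k => s₁.real (4, 0, j, k)) m1) (supAbs_nonneg _ _)
  · rw [f5 0 one_pos 0 one_pos 0 one_pos]
    simp [e₅, Expr.eval, View.setIdx_idx, powExpr_eval, i4, hs.idx_n]
  · refine ⟨fun w _ => by rw [i5], fun a ha i j k => ?_⟩
    simp only [Finset.mem_insert, Finset.mem_singleton, not_or] at ha
    rw [o5 _ _ _ _ ha.2.2.2.2, o4 _ _ _ _ ha.2.2.2.1, o3 _ _ _ _ ha.2.2.1, o2 _ _ _ _ ha.2.1,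
      o1 _ _ _ _ ha.1]

end Stmt

/-! ### One step through attention -/

/-- The truncated exponential series of the scores, with rows that are divided by their sums. -/
def truncatedAttn {n : ℕ} (g : ℕ) (S : Mat n n) : Mat n n :=
  Matrix.of fun j k => (∑ t ∈ Finset.range (g + 1), S j k ^ t / t.factorial) /
    ∑ k', ∑ t ∈ Finset.range (g + 1), S j k' ^ t / t.factorial

/-- The representation by monomials with constant weight `1`: the scalar products of the rows are
the scores, and the monomials supply the factors. -/
theorem factoredAttn_list {n d g : ℕ} {x y : ℕ → ℕ → ℝ} {X Y : Mat n d} {S : Mat n n}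
    (hx : ∀ (j : Fin n) (b : Fin d), x j b = X j b) (hy : ∀ (k : Fin n) (b : Fin d), y k b = Y k b)
    (hS : ∀ j k, S j k = ∑ b, X j b * Y k b) :
    factoredAttn (fun (q : Fin (Node.list g x y d).length) (j : Fin n) =>
        (Node.list g x y d)[q].u j) (fun q k => (Node.list g x y d)[q].v k) = truncatedAttn g S := by
  have h : ∀ j k : Fin n, ∑ q : Fin (Node.list g x y d).length,
      (Node.list g x y d)[q].u j * (Node.list g x y d)[q].v k =
        ∑ t ∈ Finset.range (g + 1), S j k ^ t / t.factorial := by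
    intro j k
    have := Node.sum_list_mul g x y d j k (fun _ => 1)
    simp only [one_mul, Finset.sum_range, hx, hy, ← hS] at this
    rw [← Fin.sum_univ_fun_getElem] at this
    rw [Finset.sum_range, ← this]
    rfl
  ext j k
  simp only [factoredAttn, truncatedAttn, Matrix.of_apply, h]

namespace Stmt

/-- Array `2` receives the sum of the cotangent in array `3` and an approximation of its backward
pass through attention. -/
def attnStep (K : ℕ) : Stmt :=
  .seq (.iconst 14 0) (.seq (prepare K) (.seq findDegree (.seq listNodes contract)))


/-- The degree and the number of monomials are outcomes of the run. They are returned with the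
properties that determine their size, and the time bound is conditional on them, as they are small
only asymptotically. -/
theorem attnStep_spec {inp : Input} {n d Q K : ℕ} {s : View} (hs : s.Sizes n d)
    (hdQ : d + 1 ≤ Q) (hKQ : K ≤ Q) {T G : Mat n d} {WQ WK WV : Mat d d}
    (hin : LayerInput inp s T WQ WK WV) (hG : s.HoldsMat 3 G) :
    ∃ (g L : ℕ) (r : ℝ), 0 ≤ r ∧ r ≤ ‖T‖ * ‖T * (WQ * WK.transpose)‖ ∧
      (∀ j k, |scores (WQ * WK.transpose) T T j k| ≤ r) ∧ IsDegree n r (1 / (n : ℝ) ^ K) g ∧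
      (∀ z : ℝ, 0 < z → z < 1 → (L : ℝ) ≤ z⁻¹ ^ g * (1 - z)⁻¹ ^ d) ∧
      (g + 1 ≤ Q → L + 1 ≤ Q → (attnStep K).cost inp s ≤ 10000 * ((n + 1) * Q ^ 4)) ∧
      (∀ w < 13, ((attnStep K).run inp s).idx w = s.idx w) ∧
      ((attnStep K).run inp s).HoldsMat 2 (G +
        attnBackward (truncatedAttn g (scores (WQ * WK.transpose) T T))
          ((1 / (d : ℝ)) • (T * (WQ * WK.transpose)))
          ((1 / (d : ℝ)) • (T * (WQ * WK.transpose).transpose)) (T * WV) WV G) := by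
  set s₀ := s.setIdx 14 0 with hs₀
  have b0 : View.SameBut {14} ∅ s s₀ := (View.SameBut.refl _ _ s).setIdx (by decide) _
  have hin0 : LayerInput inp s₀ T WQ WK WV := by
    have h11 := b0.idx 11 (by decide)
    have h12 := b0.idx 12 (by decide)
    exact ⟨by rw [h12]; exact hin.T, by rw [h11]; exact hin.WQ, by rw [h11]; exact hin.WK,
      by rw [h11]; exact hin.WV⟩
  have z0 := hs.sameBut b0
  obtain ⟨cp, mX, mY, mH, ⟨r0, r1, r2⟩, hε, b1⟩ := prepare_spec (Q := Q) z0 (by omega) (by omega)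
    hKQ (by simp [hs₀, View.setIdx_idx]) hin0
  set s₁ := (prepare K).run inp s₀ with hs₁
  have z1 := z0.sameBut b1
  obtain ⟨cf, hdeg, b2⟩ := findDegree_spec (inp := inp) z1
  set s₂ := findDegree.run inp s₁ with hs₂
  have z2 := z1.sameBut b2
  set g := s₂.idx 13 with hg
  rw [hε] at hdeg
  set x : ℕ → ℕ → ℝ := fun j b => s₂.real (4, 0, j, b) with hx
  set y : ℕ → ℕ → ℝ := fun k b => inp.real (0, s₂.idx 12, k, b) with hy
  obtain ⟨cl, ll, b3⟩ := listNodes_spec (inp := inp) z2 hg.symm (x := x) (y := y)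
    (fun _ _ => rfl) (fun _ _ => rfl)
  set s₃ := listNodes.run inp s₂ with hs₃
  have z3 := z2.sameBut b3
  set l := Node.list g x y d with hl
  have i12 : s₂.idx 12 = s.idx 12 := by
    rw [b2.idx _ (by decide), b1.idx _ (by decide), b0.idx _ (by decide)]
  have i11 : s₃.idx 11 = s.idx 11 := by
    rw [b3.idx _ (by decide), b2.idx _ (by decide), b1.idx _ (by decide), b0.idx _ (by decide)]
  have n3 : s₃.HoldsMat 3 G := fun j k => by
    rw [b3.real 3 (by decide), b2.real 3 (by decide), b1.real 3 (by decide),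
      b0.real 3 (by decide), hG]
  have n4 : s₃.HoldsMat 4 ((1 / (d : ℝ)) • (T * (WQ * WK.transpose))) := fun j k => by
    rw [b3.real 4 (by decide), b2.real 4 (by decide), mX]
  have n5 : s₃.HoldsMat 5 ((1 / (d : ℝ)) • (T * (WQ * WK.transpose).transpose)) := fun j k => by
    rw [b3.real 5 (by decide), b2.real 5 (by decide), mY]
  have n6 : s₃.HoldsMat 6 (T * WV) := fun j k => by
    rw [b3.real 6 (by decide), b2.real 6 (by decide), mH]
  have hcontract := fun (Q' : ℕ) (hd : d + 1 ≤ Q') (hQ : l.length ≤ Q') =>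
    contract_spec (inp := inp) (Q := Q') z3 ll.len (by omega) (by omega) hQ n3 n4 n5 n6
    (u := fun (q : Fin l.length) (j : Fin n) => l[q].u j) (v := fun q k => l[q].v k)
    (fun q j => ((ll.node q l[q] (by simp)).2 j j.2).1)
    (fun q k => ((ll.node q l[q] (by simp)).2 k k.2).2)
    (V := WV) (by rw [i11]; exact hin.WV)
  have hrun : (attnStep K).run inp s = contract.run inp s₃ := rfl
  -- The result is correct whatever the number of monomials is, so an ad hoc bound replaces `Q`.
  obtain ⟨-, i4, m4⟩ := hcontract (max (d + 1) l.length) (le_max_left _ _) (le_max_right _ _)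
  refine ⟨g, l.length, _, r0, r1, r2, hdeg,
    fun z h0 h1 => Node.length_list_le g x y d h0 h1, fun hgQ hLQ => ?_, fun w hw => ?_, ?_⟩
  · obtain ⟨cc, -, -⟩ := hcontract Q hdQ (by omega)
    have e : (attnStep K).cost inp s = 1 + ((prepare K).cost inp s₀ + (findDegree.cost inp s₁ +
      (listNodes.cost inp s₂ + contract.cost inp s₃))) := rfl
    have q1 : 1 ≤ Q ^ 4 := Nat.one_le_pow _ _ (by omega)
    have q2 : n + 1 ≤ (n + 1) * Q ^ 4 := Nat.le_mul_of_pos_right _ q1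
    have q3 : (d + 1) * ((l.length + 1) * ((g + 1) * (n + 1))) ≤ (n + 1) * Q ^ 4 := by
      calc _ ≤ Q * (Q * (Q * (n + 1))) := by gcongr
        _ = (n + 1) * Q ^ 3 := by ring
        _ ≤ _ := Nat.mul_le_mul_left _ (Nat.pow_le_pow_right (by omega) (by norm_num))
    omega
  · rw [hrun, i4, b3.idx _ (by simp; omega), b2.idx _ (by simp; omega),
      b1.idx _ (by simp), b0.idx _ (by simp; omega)]
  · rw [hrun, ← factoredAttn_list (x := x) (y := y) (fun j b => ?_) (fun k b => ?_)
      (scores_right (WQ * WK.transpose) T T)]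
    · exact m4
    · rw [← n4 j b, b3.real 4 (by decide)]
    · simp only [hy, i12]
      exact hin.T k b

end Stmt

/-! ### The program for the transformer -/

theorem Rep.setIdx_low {b : ℕ} {σ : Store} {s : View} (h : Rep b σ s) {a : ℕ} (ha : a < b)
    (t : ℕ) : Rep b (σ.setIdx a t) s := by
  refine ⟨fun w => ?_, fun A i j k => h.real A i j k⟩
  rw [Store.setIdx_idx, if_neg (by omega), h.idx]

theorem Rep.storeHoldsMat_zero {n d b : ℕ} {σ : Store} {s : View} (h : Rep b σ s) {a t : ℕ}
    {A : Mat n d} (hA : s.HoldsMat 0 A) : (σ.setIdx a t).HoldsMat 0 A :=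
  h.holdsMat_zero.2 hA

namespace Transformer

/-- The preparations: sizes and the number of layers. -/
def initStmt : Stmt := .seq .initSizes (.seq (.iconst 1 2) (.iinp 10 0 0 0 1))

/-- Array `2` receives the gradient of the loss, variable `11` the number of layers. -/
def startStmt : Stmt := .seq (.copyMat 2 1) (.icopy 11 10)

/-- Array `0` receives the cotangent, variable `12` the number of the preceding layer. -/
def beforeLayer : Stmt := .seq (.icopy 12 11) (.seq (.ipred 12) (.copyMat 0 2))

/-- The residual connection around `g_i`, the attention block, and the step to the preceding
layer. -/
def afterLayer (K : ℕ) : Stmt := .seq (.addMat 3 1 2) (.seq (.attnStep K) (.ipred 11))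

/-- The backward pass through one layer. -/
def layerProg (b K : ℕ) (Pg : Prog) : Prog :=
  .seq (beforeLayer.compile b 0) (.seq (.op (.icopy 0 (b + 2 * 11)))
    (.seq Pg ((afterLayer K).compile b 0)))

/-- The backward pass through the transformer. -/
def backwardProg (b K : ℕ) (Pg Pl : Prog) : Prog :=
  .seq (initStmt.compile b 0) (.seq Pl (.seq (startStmt.compile b 0)
    (.seq (.while (.ilt (b + 2 * 0) (b + 2 * 11)) (layerProg b K Pg))
      (.seq ((Stmt.copyMat 0 2).compile b 0) (.seq (.op (.iconst 0 0)) Pg)))))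

/-- The matrix `W_Q W_Kᵀ` of layer `i`. -/
def W (x : Transformer) (i : ℕ) : Mat x.d x.d := x.WQ i * (x.WK i).transpose

/-- The attention scores of layer `i + 1`. -/
def S (x : Transformer) (i : ℕ) : Mat x.n x.n := scores (x.W (i + 1)) (x.T i) (x.T i)

/-- The degree `g`, the number of monomials `L` and the bound `r` for the scores are possible in
layer `i + 1`. -/
structure Choice (x : Transformer) (K i g L : ℕ) (r : ℝ) : Prop where
  nonneg : 0 ≤ r
  le_norm : r ≤ ‖x.T i‖ * ‖x.T i * x.W (i + 1)‖
  abs_scores_le : ∀ j k, |x.S i j k| ≤ r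
  isDegree : IsDegree x.n r (1 / (x.n : ℝ) ^ K) g
  length_le : ∀ z : ℝ, 0 < z → z < 1 → (L : ℝ) ≤ z⁻¹ ^ g * (1 - z)⁻¹ ^ x.d

/-- The backward pass through attention in layer `i + 1`, with attention matrix `f`. -/
def attnBack (x : Transformer) (i : ℕ) (f : Mat x.n x.n) (G : Mat x.n x.d) : Mat x.n x.d :=
  attnBackward f ((1 / (x.d : ℝ)) • (x.T i * x.W (i + 1)))
    ((1 / (x.d : ℝ)) • (x.T i * (x.W (i + 1)).transpose)) (x.T i * x.WV (i + 1)) (x.WV (i + 1)) G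

/-- The backward pass through layer `i + 1`, with attention matrix `f`. -/
def layerBack (x : Transformer) (i : ℕ) (f : Mat x.n x.n) (G : Mat x.n x.d) : Mat x.n x.d :=
  G + vjp (x.g (i + 1)) (x.Z (i + 1)) G +
    x.attnBack i f (G + vjp (x.g (i + 1)) (x.Z (i + 1)) G)

theorem layerProg_runs {x : Transformer} {prim : ℕ → ℝ → ℝ} {Pg : Prog} {τ : ℝ} {b K Q : ℕ}
    (hx : x.Encoded) (hg : x.BackwardRuns prim Pg τ) (hb : Pg.bound ≤ b) (hb0 : 0 < b)
    (hdQ : x.d + 1 ≤ Q) (hKQ : K ≤ Q) {i : ℕ} (hi : i < x.m)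
    (hQ : ∀ g L r, x.Choice K i g L r → g + 1 ≤ Q ∧ L + 1 ≤ Q)
    {σ : Store} {s : View} (hσ : Rep b σ s) (hs : s.Sizes x.n x.d) (h11 : s.idx 11 = i + 1)
    {G : Mat x.n x.d} (hG : s.HoldsMat 2 G) :
    RunsWithin prim x.input (layerProg b K Pg) σ (⌊τ⌋₊ + 11000 * ((x.n + 1) * Q ^ 4)) fun σ' =>
      ∃ s' : View, Rep b σ' s' ∧ s'.Sizes x.n x.d ∧ s'.idx 11 = i ∧
        ∃ g L r, x.Choice K i g L r ∧ s'.HoldsMat 2 (x.layerBack i (truncatedAttn g (x.S i)) G) := by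
  -- before the backward pass through `g`
  set s₁ := (s.setIdx 12 (s.idx 11)).setIdx 12 i with hs₁
  have z1 : s₁.Sizes x.n x.d := by
    refine hs.congr ?_ ?_ ?_ ?_ <;> simp [hs₁, View.setIdx_idx]
  obtain ⟨i2, o2, m2⟩ := Stmt.copyMat_spec (inp := x.input) (A := 0) (B := 2) (by norm_num) z1
    (M := G) hG
  have c2 := Stmt.copyMat_cost_le x.input (A := 0) (B := 2) z1
  set s₂ := (Stmt.copyMat 0 2).run x.input s₁ with hs₂
  have e2 : beforeLayer.run x.input s = s₂ := by
    have : ((s.setIdx 12 (s.idx 11)).setIdx 12 ((s.setIdx 12 (s.idx 11)).idx 12 - 1)) = s₁ := by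
      simp [hs₁, View.setIdx_idx, h11]
    rw [hs₂, ← this]
    rfl
  have cc2 : beforeLayer.cost x.input s = 2 + (Stmt.copyMat 0 2).cost x.input s₁ := by
    have : ((s.setIdx 12 (s.idx 11)).setIdx 12 ((s.setIdx 12 (s.idx 11)).idx 12 - 1)) = s₁ := by
      simp [hs₁, View.setIdx_idx, h11]
    rw [← this]
    simp only [beforeLayer, Stmt.cost, Stmt.run]
    omega
  have z2 : s₂.Sizes x.n x.d := z1.congr (by rw [i2]) (by rw [i2]) (by rw [i2]) (by rw [i2])
  have j11 : s₂.idx 11 = i + 1 := by rw [i2]; simp [hs₁, View.setIdx_idx, h11]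
  have j12 : s₂.idx 12 = i := by rw [i2]; simp [hs₁, View.setIdx_idx]
  have n2 : s₂.HoldsMat 2 G := fun j k => by rw [o2 _ _ _ _ (by norm_num)]; exact hG j k
  have q1 : 1 ≤ Q ^ 4 := Nat.one_le_pow _ _ (by omega)
  have q2 : Q ≤ Q ^ 4 := Nat.le_self_pow (by norm_num) Q
  have q3 : (x.n + 1) * (x.d + 1) ≤ (x.n + 1) * Q ^ 4 := Nat.mul_le_mul_left _ (by omega)
  have q4 : x.n + 1 ≤ (x.n + 1) * Q ^ 4 := Nat.le_mul_of_pos_right _ q1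
  refine (RunsWithin.seq (u := 2 + 50 * ((x.n + 1) * (x.d + 1)))
    (w := 1 + (⌊τ⌋₊ + (50 * ((x.n + 1) * (x.d + 1)) + (10000 * ((x.n + 1) * Q ^ 4) + 1))))
    ((Stmt.correct prim x.input b beforeLayer 0 σ s hσ).mono (by omega) fun σ' h => h) ?_).mono
    (by omega) fun σ' h => h
  rintro σ₂ ⟨r2, -⟩
  rw [e2] at r2
  -- Register `0`, in which the given program expects the number of the layer, lies below `b` and
  -- does not belong to the view.
  refine RunsWithin.seq (p := fun σ' => Rep b σ' s₂ ∧ σ'.idx 0 = i + 1 ∧ σ'.HoldsMat 0 G)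
    (RunsWithin.op ⟨r2.setIdx_low hb0 _, ?_, r2.storeHoldsMat_zero m2⟩) ?_
  · simp only [Op.run, Store.setIdx_idx, if_true, r2.idx, j11]
  rintro σ₃ ⟨r3, h0, hG0⟩
  refine RunsWithin.seq ((hg (i + 1) (by omega) G σ₃ h0 hG0).runsWithin.agreeFrom hb) ?_
  rintro σ₄ ⟨hO, ha⟩
  -- after the backward pass through `g`
  obtain ⟨s₄, r4, i4, a4⟩ := r3.of_agreeFrom ha
  have z4 : s₄.Sizes x.n x.d := z2.congr (by rw [i4]) (by rw [i4]) (by rw [i4]) (by rw [i4])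
  have m4 : s₄.HoldsMat 2 G := fun j k => by rw [a4 _ le_rfl, n2 j k]
  obtain ⟨i5, -, m5⟩ := Stmt.addMat_spec (inp := x.input) (A := 3) (B := 1) (C := 2)
    (by norm_num) (by norm_num) z4 (r4.holdsMat_one.1 hO) m4
  have c5 := Stmt.addMat_cost_le x.input (A := 3) (B := 1) (C := 2) z4
  set s₅ := (Stmt.addMat 3 1 2).run x.input s₄ with hs₅
  have z5 : s₅.Sizes x.n x.d := z4.congr (by rw [i5]) (by rw [i5]) (by rw [i5]) (by rw [i5])
  have hin : Stmt.LayerInput x.input s₅ (x.T i) (x.WQ (i + 1)) (x.WK (i + 1)) (x.WV (i + 1)) := by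
    have k11 : s₅.idx 11 = i + 1 := by rw [i5, i4, j11]
    have k12 : s₅.idx 12 = i := by rw [i5, i4, j12]
    refine ⟨?_, ?_, ?_, ?_⟩
    · rw [k12]; exact hx.input_T i (by omega)
    · rw [k11]; exact hx.input_WQ (i + 1) (by omega) (by omega)
    · rw [k11]; exact hx.input_WK (i + 1) (by omega) (by omega)
    · rw [k11]; exact hx.input_WV (i + 1) (by omega) (by omega)
  obtain ⟨g, L, r, r0, r1, r2, hdeg, hL, hcost, hidx, m6⟩ := Stmt.attnStep_spec z5 hdQ hKQ hin m5
  have hch : x.Choice K i g L r := ⟨r0, r1, r2, hdeg, hL⟩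
  have c6 := hcost (hQ g L r hch).1 (hQ g L r hch).2
  set s₆ := (Stmt.attnStep K).run x.input s₅ with hs₆
  have k11 : s₆.idx 11 = i + 1 := by rw [hidx _ (by norm_num), i5, i4, j11]
  have e7 : (afterLayer K).run x.input s₄ = s₆.setIdx 11 i := by
    have : s₆.setIdx 11 (s₆.idx 11 - 1) = s₆.setIdx 11 i := by rw [k11]; rfl
    rw [← this]
    rfl
  have c7 : (afterLayer K).cost x.input s₄ = (Stmt.addMat 3 1 2).cost x.input s₄ +
    ((Stmt.attnStep K).cost x.input s₅ + 1) := rfl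
  refine (Stmt.correct prim x.input b (afterLayer K) 0 σ₄ s₄ r4).mono (by omega) ?_
  rintro σ' ⟨r7, -⟩
  rw [e7] at r7
  refine ⟨_, r7, ?_, by simp [View.setIdx_idx], g, L, r, hch, ?_⟩
  · refine z5.congr ?_ ?_ ?_ ?_ <;> simp [View.setIdx_idx, hidx]
  · rw [add_comm (vjp _ _ _) G] at m6
    exact m6

/-- The invariant `P` on cotangents is left abstract, which separates the execution of the program
from the error analysis. It has to hold for every degree that the search may return. -/
theorem backwardProg_runs {x : Transformer} {prim : ℕ → ℝ → ℝ} {Pg Pl : Prog} {τ τ' : ℝ}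
    {b K Q : ℕ} (hx : x.Encoded) (hg : x.BackwardRuns prim Pg τ)
    (hl : x.LossGradientRuns prim Pl τ') (hb : Pg.bound ≤ b) (hb' : Pl.bound ≤ b) (hb0 : 0 < b)
    (hdQ : x.d + 1 ≤ Q) (hKQ : K ≤ Q)
    (hQ : ∀ i < x.m, ∀ g L r, x.Choice K i g L r → g + 1 ≤ Q ∧ L + 1 ≤ Q)
    {P : ℕ → Mat x.n x.d → Prop} (hP : P x.m (grad (overallLoss x.loss) (x.T x.m)))
    (hstep : ∀ i < x.m, ∀ G, P (i + 1) G → ∀ g L r, x.Choice K i g L r →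
      P i (x.layerBack i (truncatedAttn g (x.S i)) G)) (σ : Store) :
    RunsWithin prim x.input (backwardProg b K Pg Pl) σ
      (⌊τ'⌋₊ + (x.m + 1) * (⌊τ⌋₊ + 12000 * ((x.n + 1) * Q ^ 4))) fun σ' =>
      ∃ G, P 0 G ∧ σ'.HoldsMat 1 (vjp (x.g 0) x.X G) := by
  have q1 : 1 ≤ Q ^ 4 := Nat.one_le_pow _ _ (by omega)
  have q2 : Q ≤ Q ^ 4 := Nat.le_self_pow (by norm_num) Q
  have q3 : (x.n + 1) * (x.d + 1) ≤ (x.n + 1) * Q ^ 4 := Nat.mul_le_mul_left _ (by omega)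
  have q4 : x.n + 1 ≤ (x.n + 1) * Q ^ 4 := Nat.le_mul_of_pos_right _ q1
  obtain ⟨z1, -⟩ := Stmt.initSizes_spec (inp := x.input) hx.input_n hx.input_d (σ.view b)
  set s₁ := Stmt.initSizes.run x.input (σ.view b) with hs₁
  -- Variable `1` serves only as an address: the number of layers is in the input cell `(0, 0, 0,
  -- 2)`.
  set s₂ := (s₁.setIdx 1 2).setIdx 10 x.m with hs₂
  have e2 : initStmt.run x.input (σ.view b) = s₂ := by
    have : (s₁.setIdx 1 2).setIdx 10 (x.input.int (0, (s₁.setIdx 1 2).idx 0,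
        (s₁.setIdx 1 2).idx 0, (s₁.setIdx 1 2).idx 1)) = s₂ := by
      simp [hs₂, View.setIdx_idx, z1.zero, hx.input_m]
    rw [← this]
    rfl
  have z2 : s₂.Sizes x.n x.d := by refine z1.congr ?_ ?_ ?_ ?_ <;> simp [hs₂, View.setIdx_idx]
  refine (RunsWithin.seq (u := 6) (w := ⌊τ'⌋₊ + ((50 * ((x.n + 1) * (x.d + 1)) + 1) +
    ((∑ _t ∈ Finset.range x.m, (⌊τ⌋₊ + 11000 * ((x.n + 1) * Q ^ 4) + 1) + 1) +
      (50 * ((x.n + 1) * (x.d + 1)) + (1 + ⌊τ⌋₊)))))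
    ((Stmt.correct prim x.input b initStmt 0 σ _ (σ.rep_view b)).mono le_rfl fun σ' h => h)
    ?_).mono ?_ fun σ' h => h
  swap
  · simp only [Finset.sum_const, Finset.card_range, smul_eq_mul]
    have h1 : x.m * (⌊τ⌋₊ + 11000 * ((x.n + 1) * Q ^ 4) + 1) ≤
        x.m * (⌊τ⌋₊ + 12000 * ((x.n + 1) * Q ^ 4)) := Nat.mul_le_mul_left _ (by omega)
    have h2 : (x.m + 1) * (⌊τ⌋₊ + 12000 * ((x.n + 1) * Q ^ 4)) =
        x.m * (⌊τ⌋₊ + 12000 * ((x.n + 1) * Q ^ 4)) + (⌊τ⌋₊ + 12000 * ((x.n + 1) * Q ^ 4)) := by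
      ring
    omega
  rintro σ₂ ⟨r2, -⟩
  rw [e2] at r2
  refine RunsWithin.seq ((hl σ₂).runsWithin.agreeFrom hb') ?_
  rintro σ₃ ⟨hO, ha⟩
  obtain ⟨s₃, r3, i3, -⟩ := r2.of_agreeFrom ha
  have z3 : s₃.Sizes x.n x.d := z2.congr (by rw [i3]) (by rw [i3]) (by rw [i3]) (by rw [i3])
  obtain ⟨i4, -, m4⟩ := Stmt.copyMat_spec (inp := x.input) (A := 2) (B := 1) (by norm_num) z3
    (r3.holdsMat_one.1 hO)
  have c4 := Stmt.copyMat_cost_le x.input (A := 2) (B := 1) z3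
  set s₄ := (Stmt.copyMat 2 1).run x.input s₃ with hs₄
  have z4 : s₄.Sizes x.n x.d := z3.congr (by rw [i4]) (by rw [i4]) (by rw [i4]) (by rw [i4])
  have k10 : s₄.idx 10 = x.m := by rw [i4, i3]; simp [hs₂, View.setIdx_idx]
  have e5 : startStmt.run x.input s₃ = s₄.setIdx 11 x.m := by
    rw [← k10]
    rfl
  have c5 : startStmt.cost x.input s₃ = (Stmt.copyMat 2 1).cost x.input s₃ + 1 := rfl
  refine RunsWithin.seq
    ((Stmt.correct prim x.input b startStmt 0 σ₃ s₃ r3).mono (by omega) fun σ' h => h) ?_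
  rintro σ₅ ⟨r5, -⟩
  rw [e5] at r5
  refine RunsWithin.seq (RunsWithin.while (N := x.m)
    (I := fun t σ' => t ≤ x.m ∧ ∃ s', Rep b σ' s' ∧ s'.Sizes x.n x.d ∧ s'.idx 11 = x.m - t ∧
      ∃ G, s'.HoldsMat 2 G ∧ P (x.m - t) G)
    (u := fun _ => ⌊τ⌋₊ + 11000 * ((x.n + 1) * Q ^ 4)) ?_ ?_ ?_) ?_
  · rintro t σ' ⟨ht, s', r', z', h11, -⟩
    simp only [Cond.Holds, r'.idx, z'.zero, h11]
    omega
  · rintro t ht σ' ⟨-, s', r', z', h11, G, hG, hPG⟩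
    have hi : x.m - (t + 1) < x.m := by omega
    have hi' : x.m - t = x.m - (t + 1) + 1 := by omega
    rw [hi'] at h11 hPG
    refine (layerProg_runs hx hg hb hb0 hdQ hKQ hi (hQ _ hi) r' z' h11 hG).mono le_rfl ?_
    rintro σ'' ⟨s'', r'', z'', h11', g, L, r, hch, hG'⟩
    exact ⟨ht, s'', r'', z'', h11', _, hG', hstep _ hi G hPG g L r hch⟩
  · refine ⟨Nat.zero_le _, _, r5, ?_, by simp [View.setIdx_idx], _, m4, hP⟩
    refine z4.congr ?_ ?_ ?_ ?_ <;> simp [View.setIdx_idx]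
  rintro σ₆ ⟨-, s₆, r6, z6, -, G, hG, hPG⟩
  rw [Nat.sub_self] at hPG
  obtain ⟨-, -, m7⟩ := Stmt.copyMat_spec (inp := x.input) (A := 0) (B := 2) (by norm_num) z6 hG
  have c7 := Stmt.copyMat_cost_le x.input (A := 0) (B := 2) z6
  refine RunsWithin.seq
    ((Stmt.correct prim x.input b (.copyMat 0 2) 0 σ₆ s₆ r6).mono c7 fun σ' h => h) ?_
  rintro σ₇ ⟨r7, -⟩
  refine RunsWithin.seq (p := fun σ' => σ'.idx 0 = 0 ∧ σ'.HoldsMat 0 G)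
    (RunsWithin.op ⟨by simp [Op.run, Store.setIdx_idx], r7.storeHoldsMat_zero m7⟩) ?_
  rintro σ₈ ⟨h0, hG0⟩
  exact (hg 0 (Nat.zero_le _) G σ₈ h0 hG0).runsWithin.mono le_rfl fun σ' h => ⟨G, hPG, h⟩

end Transformer

/-! ### The gradients of the transformer -/

theorem norm_mul_le_mul {n d e : ℕ} (A : Mat n d) (B : Mat d e) :
    ‖A * B‖ ≤ d * (‖A‖ * ‖B‖) := by
  refine mat_norm_le (by positivity) fun j k => ?_
  rw [Matrix.mul_apply]
  exact abs_sum_fin_le le_rfl (by positivity) fun a =>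
    abs_mul_le_of_le (abs_entry_le_norm A j a) (abs_entry_le_norm B a k)

theorem norm_transpose_le {n d : ℕ} (A : Mat n d) : ‖A.transpose‖ ≤ ‖A‖ :=
  mat_norm_le (norm_nonneg _) fun j k => abs_entry_le_norm A k j

theorem norm_one_div_smul_le {n d : ℕ} (A : Mat n d) : ‖(1 / (d : ℝ)) • A‖ ≤ ‖A‖ := by
  rw [norm_smul, Real.norm_of_nonneg (by positivity)]
  refine mul_le_of_le_one_left (norm_nonneg _) ?_
  rcases d.eq_zero_or_pos with rfl | hd
  · simp
  · rw [div_le_one (by positivity)]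
    exact_mod_cast hd

namespace Transformer

variable {x : Transformer}

theorem T_succ (x : Transformer) (i : ℕ) : x.T (i + 1) = x.layer (i + 1) (x.T i) := by
  simp only [T, layers, Nat.zero_add]

theorem layers_T (x : Transformer) (i s : ℕ) : x.layers i s (x.T i) = x.T (i + s) := by
  induction s with
  | zero => rfl
  | succ s ih =>
    have h : x.T (i + (s + 1)) = x.layer (i + s + 1) (x.T (i + s)) := x.T_succ (i + s)
    rw [h, ← ih]
    rfl

theorem differentiable_attnBlock (x : Transformer) (i : ℕ) (A : Mat x.n x.d) :
    DifferentiableAt ℝ (x.attnBlock i) A :=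
  differentiableAt_residual (differentiable_attn _ _ _ A)

theorem Smooth.differentiableAt_layer (h : x.Smooth) {i : ℕ} (hi : i < x.m) :
    DifferentiableAt ℝ (x.layer (i + 1)) (x.T i) :=
  (differentiableAt_residual (h.diff_g (i + 1) hi)).comp (x.T i) (x.differentiable_attnBlock _ _)

theorem Smooth.differentiableAt_layers (h : x.Smooth) {i s : ℕ} (hi : i + s ≤ x.m) :
    DifferentiableAt ℝ (x.layers i s) (x.T i) := by
  induction s with
  | zero => exact differentiableAt_id
  | succ s ih =>
    have h1 := h.differentiableAt_layer (i := i + s) (by omega)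
    rw [← layers_T] at h1
    exact h1.comp (x.T i) (ih (by omega))

/-- Chain rule in reverse: first the residual connection around `g`, then the one around attention.
With the exact softmax matrix, `layerBack` is the true backward pass. -/
theorem Smooth.vjp_layer (h : x.Smooth) {i : ℕ} (hi : i < x.m) (G : Mat x.n x.d) :
    vjp (x.layer (i + 1)) (x.T i) G = x.layerBack i (softmax (x.S i)) G := by
  have h1 : vjp (x.layer (i + 1)) (x.T i) G =
      vjp (x.attnBlock (i + 1)) (x.T i) (vjp (residual (x.g (i + 1))) (x.Z (i + 1)) G) :=
    vjp_comp (differentiableAt_residual (h.diff_g (i + 1) hi)) (x.differentiable_attnBlock _ _) G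
  rw [h1, vjp_residual (h.diff_g (i + 1) hi), attnBlock, vjp_residual (differentiable_attn _ _ _ _),
    vjp_attn]
  rfl

theorem Smooth.vjp_layers_succ (h : x.Smooth) {i s : ℕ} (hi : i + s < x.m) (G : Mat x.n x.d) :
    vjp (x.layers i (s + 1)) (x.T i) G =
      vjp (x.layers i s) (x.T i) (x.layerBack (i + s) (softmax (x.S (i + s))) G) := by
  have h1 := h.differentiableAt_layer hi
  rw [← h.vjp_layer hi, ← layers_T]
  rw [← layers_T] at h1
  exact vjp_comp h1 (h.differentiableAt_layers hi.le) G

/-- The gradient of the loss with respect to `T_i`. -/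
def gradT (x : Transformer) (i : ℕ) : Mat x.n x.d :=
  vjp (x.layers i (x.m - i)) (x.T i) (grad (overallLoss x.loss) (x.T x.m))

theorem gradT_last (x : Transformer) : x.gradT x.m = grad (overallLoss x.loss) (x.T x.m) := by
  rw [gradT, Nat.sub_self]
  exact vjp_id _ _

/-- `layers` adds layers at the top, whereas the recursion for `gradT` removes one at the bottom; a
split at an arbitrary place mediates between the two. -/
theorem vjp_layers_add (h : x.Smooth) {i s t : ℕ} (hi : i + s + t ≤ x.m) (G : Mat x.n x.d) :
    vjp (x.layers i (s + t)) (x.T i) G =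
      vjp (x.layers i s) (x.T i) (vjp (x.layers (i + s) t) (x.T (i + s)) G) := by
  induction t generalizing G with
  | zero =>
    have : vjp (x.layers (i + s) 0) (x.T (i + s)) G = G := vjp_id _ _
    rw [this, Nat.add_zero]
  | succ t ih =>
    rw [← Nat.add_assoc, h.vjp_layers_succ (by omega), h.vjp_layers_succ (by omega),
      ih (by omega), Nat.add_assoc i s t]

theorem Smooth.gradT_eq (h : x.Smooth) {i : ℕ} (hi : i < x.m) :
    x.gradT i = x.layerBack i (softmax (x.S i)) (x.gradT (i + 1)) := by
  have e : x.m - i = 1 + (x.m - (i + 1)) := by omega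
  rw [gradT, e, vjp_layers_add h (by omega), h.vjp_layers_succ (s := 0) (by omega)]
  exact vjp_id _ _

theorem Smooth.differentiableAt_totalLoss (h : x.Smooth) :
    DifferentiableAt ℝ x.totalLoss x.X := by
  have h1 : DifferentiableAt ℝ (overallLoss x.loss) (x.layers 0 x.m (x.T 0)) := by
    rw [layers_T, Nat.zero_add]
    exact differentiableAt_overallLoss h.diff_loss
  exact (h1.comp (x.T 0) (h.differentiableAt_layers (by omega))).comp x.X
    (h.diff_g 0 (Nat.zero_le _))

theorem Smooth.grad_totalLoss (h : x.Smooth) :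
    grad x.totalLoss x.X = vjp (x.g 0) x.X (x.gradT 0) := by
  have h1 : DifferentiableAt ℝ (overallLoss x.loss) (x.layers 0 x.m (x.T 0)) := by
    rw [layers_T, Nat.zero_add]
    exact differentiableAt_overallLoss h.diff_loss
  have h2 := h.differentiableAt_layers (i := 0) (s := x.m) (by omega)
  have h3 : grad x.totalLoss x.X =
      vjp (x.g 0) x.X (grad (fun B => overallLoss x.loss (x.layers 0 x.m B)) (x.g 0 x.X)) :=
    grad_comp (H := x.g 0) (A := x.X) (h1.comp (x.T 0) h2) (h.diff_g 0 (Nat.zero_le _))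
  have h4 : grad (fun B => overallLoss x.loss (x.layers 0 x.m B)) (x.T 0) = _ := grad_comp h1 h2
  rw [h3, gradT, Nat.sub_zero]
  refine congrArg _ (h4.trans ?_)
  rw [layers_T, Nat.zero_add]

/-- For a fixed attention matrix, the backward pass is linear in the cotangent, although it is
quadratic in that matrix. -/
theorem attnBack_sub (x : Transformer) (i : ℕ) (f : Mat x.n x.n) (G G' : Mat x.n x.d) :
    x.attnBack i f (G - G') = x.attnBack i f G - x.attnBack i f G' := by
  ext j k
  simp only [attnBack, attnBackward, scoreCotangent, Matrix.of_apply, Matrix.sub_apply, sub_mul,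
    mul_sub, Finset.sum_sub_distrib]
  ring

theorem layerBack_sub (x : Transformer) (i : ℕ) (f : Mat x.n x.n) (G G' : Mat x.n x.d) :
    x.layerBack i f (G - G') = x.layerBack i f G - x.layerBack i f G' := by
  have h : G - G' + vjp (x.g (i + 1)) (x.Z (i + 1)) (G - G') =
      (G + vjp (x.g (i + 1)) (x.Z (i + 1)) G) - (G' + vjp (x.g (i + 1)) (x.Z (i + 1)) G') := by
    rw [vjp_sub]; abel
  simp only [layerBack]
  rw [h, attnBack_sub]
  abel

/-! ### The errors -/

variable {c : ℕ} {R : ℝ}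

theorem Bounded.norm_W_le (h : x.Bounded ((x.n : ℝ) ^ c) R) {i : ℕ} (hi : i < x.m) :
    ‖x.W (i + 1)‖ ≤ x.d * ((x.n : ℝ) ^ c * (x.n : ℝ) ^ c) := by
  refine (norm_mul_le_mul _ _).trans ?_
  have h1 := h.WQ_le (i + 1) (by omega) hi
  have h2 := (norm_transpose_le (x.WK (i + 1))).trans (h.WK_le (i + 1) (by omega) hi)
  gcongr

/-- The critical matrix is `Y = T Wᵀ / d`: the assumption on the scores controls `T W` only, so `Y`
is estimated through the entries of both weight matrices, which gives `n ^ (2 c + 2)`. -/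
theorem Bounded.attnData (h : x.Bounded ((x.n : ℝ) ^ c) R) (hn : 1 ≤ x.n) (hd : x.d ≤ x.n)
    (hR : R ≤ x.n) {i : ℕ} (hi : i < x.m) :
    AttnData ((1 / (x.d : ℝ)) • (x.T i * x.W (i + 1)))
      ((1 / (x.d : ℝ)) • (x.T i * (x.W (i + 1)).transpose)) (x.T i * x.WV (i + 1)) (x.WV (i + 1))
      ((x.n : ℝ) ^ (2 * c + 3)) := by
  have hn' : (1 : ℝ) ≤ x.n := by exact_mod_cast hn
  have hd' : (x.d : ℝ) ≤ x.n := by exact_mod_cast hd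
  have hT := (h.T_le i hi).trans hR
  have hle : ∀ {p : ℕ}, p ≤ 2 * c + 3 → (x.n : ℝ) ^ p ≤ (x.n : ℝ) ^ (2 * c + 3) := fun hp =>
    pow_le_pow_right₀ hn' hp
  have h1 : (x.n : ℝ) ≤ (x.n : ℝ) ^ (2 * c + 3) := by simpa using hle (p := 1) (by omega)
  refine ⟨one_le_pow₀ hn', h1, hd'.trans h1, ?_, ?_, ?_, ?_⟩
  · exact (norm_one_div_smul_le _).trans ((h.TW_le i hi).trans (hR.trans h1))
  · have hW := (norm_transpose_le (x.W (i + 1))).trans (h.norm_W_le hi)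
    rw [norm_smul, Real.norm_of_nonneg (by positivity)]
    have h2 : 1 / (x.d : ℝ) * x.d ≤ 1 := by
      rw [mul_comm, mul_one_div]
      exact div_self_le_one _
    calc 1 / (x.d : ℝ) * ‖x.T i * (x.W (i + 1)).transpose‖
        ≤ 1 / (x.d : ℝ) * (x.d * (x.n * (x.d * ((x.n : ℝ) ^ c * (x.n : ℝ) ^ c)))) := by
          refine mul_le_mul_of_nonneg_left ((norm_mul_le_mul _ _).trans ?_) (by positivity)
          gcongr
      _ = (1 / (x.d : ℝ) * x.d) * (x.n * (x.d * ((x.n : ℝ) ^ c * (x.n : ℝ) ^ c))) := by ring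
      _ ≤ 1 * (x.n * (x.n * ((x.n : ℝ) ^ c * (x.n : ℝ) ^ c))) := by gcongr
      _ = (x.n : ℝ) ^ (2 * c + 2) := by ring
      _ ≤ _ := hle (by omega)
  · have hV := h.WV_le (i + 1) (by omega) hi
    calc ‖x.T i * x.WV (i + 1)‖ ≤ x.d * (‖x.T i‖ * ‖x.WV (i + 1)‖) := norm_mul_le_mul _ _
      _ ≤ x.n * (x.n * (x.n : ℝ) ^ c) := by gcongr
      _ = (x.n : ℝ) ^ (c + 2) := by ring
      _ ≤ _ := hle (by omega)
  · exact (h.WV_le (i + 1) (by omega) hi).trans (hle (by omega))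

theorem Bounded.norm_vjp_g_le (h : x.Bounded ((x.n : ℝ) ^ c) R) (hd : x.d ≤ x.n) {i : ℕ}
    (hi : i ≤ x.m) (G : Mat x.n x.d) : ‖vjp (x.g i) (x.Z i) G‖ ≤ (x.n : ℝ) ^ (c + 2) * ‖G‖ := by
  have hd' : (x.d : ℝ) ≤ x.n := by exact_mod_cast hd
  calc _ ≤ x.n * x.d * (x.n : ℝ) ^ c * ‖G‖ := norm_vjp_le (h.jacobian_g i hi) G
    _ ≤ x.n * x.n * (x.n : ℝ) ^ c * ‖G‖ := by gcongr
    _ = _ := by ring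

theorem Bounded.norm_residual_le (h : x.Bounded ((x.n : ℝ) ^ c) R) (hn : 2 ≤ x.n) (hd : x.d ≤ x.n)
    {i : ℕ} (hi : i ≤ x.m) (G : Mat x.n x.d) :
    ‖G + vjp (x.g i) (x.Z i) G‖ ≤ (x.n : ℝ) ^ (c + 3) * ‖G‖ := by
  have hn' : (2 : ℝ) ≤ x.n := by exact_mod_cast hn
  have h1 : (1 : ℝ) ≤ (x.n : ℝ) ^ (c + 2) := one_le_pow₀ (by linarith)
  calc _ ≤ ‖G‖ + (x.n : ℝ) ^ (c + 2) * ‖G‖ :=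
        (norm_add_le _ _).trans (by gcongr; exact h.norm_vjp_g_le hd hi G)
    _ ≤ (x.n : ℝ) ^ (c + 2) * ‖G‖ + (x.n : ℝ) ^ (c + 2) * ‖G‖ := by
      have := mul_le_mul_of_nonneg_right h1 (norm_nonneg G)
      linarith
    _ = (x.n : ℝ) ^ (c + 2) * 2 * ‖G‖ := by ring
    _ ≤ (x.n : ℝ) ^ (c + 2) * x.n * ‖G‖ := by gcongr
    _ = _ := by ring

/-- The exact backward pass through one layer is polynomially bounded. -/
theorem Bounded.norm_layerBack_le (h : x.Bounded ((x.n : ℝ) ^ c) R) (hn : 6 ≤ x.n)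
    (hd : x.d ≤ x.n) (hR : R ≤ x.n) {i : ℕ} (hi : i < x.m) (G : Mat x.n x.d) :
    ‖x.layerBack i (softmax (x.S i)) G‖ ≤ (x.n : ℝ) ^ (11 * c + 19) * ‖G‖ := by
  have hn' : (6 : ℝ) ≤ x.n := by exact_mod_cast hn
  have h1 := h.norm_residual_le (by omega) hd (i := i + 1) hi G
  set G' := G + vjp (x.g (i + 1)) (x.Z (i + 1)) G with hG'
  have h2 : ‖x.attnBack i (softmax (x.S i)) G'‖ ≤ _ :=
    (h.attnData (by omega) hd hR hi).norm_attnBackward_le (abs_softmax_le_one _) G'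
  have h3 : (1 : ℝ) ≤ ((x.n : ℝ) ^ (2 * c + 3)) ^ 5 := one_le_pow₀ (one_le_pow₀ (by linarith))
  calc ‖G' + x.attnBack i (softmax (x.S i)) G'‖
      ≤ ‖G'‖ + 5 * ((x.n : ℝ) ^ (2 * c + 3)) ^ 5 * ‖G'‖ := (norm_add_le _ _).trans (by gcongr)
    _ ≤ 6 * ((x.n : ℝ) ^ (2 * c + 3)) ^ 5 * ‖G'‖ := by
      have := mul_le_mul_of_nonneg_right h3 (norm_nonneg G')
      linarith
    -- The exponent is `1 + 5 (2 c + 3) + (c + 3) = 11 c + 19`; the first factor `n` absorbs the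
    -- constant `6`.
    _ ≤ x.n * ((x.n : ℝ) ^ (2 * c + 3)) ^ 5 * ((x.n : ℝ) ^ (c + 3) * ‖G‖) := by gcongr
    _ = _ := by ring

/-- The vector-Jacobian products of all compositions of layers are bounded by `B`. -/
def VJPBound (x : Transformer) (B : ℝ) : Prop :=
  ∀ i s, i + s ≤ x.m → ∀ G : Mat x.n x.d, ‖vjp (x.layers i s) (x.T i) G‖ ≤ B * ‖G‖

theorem CrossLayerBound.vjpBound (h : x.CrossLayerBound ((x.n : ℝ) ^ c)) (hd : x.d ≤ x.n) :
    x.VJPBound ((x.n : ℝ) ^ (c + 2)) := fun i s hi G => by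
  have hd' : (x.d : ℝ) ≤ x.n := by exact_mod_cast hd
  calc _ ≤ x.n * x.d * (x.n : ℝ) ^ c * ‖G‖ := norm_vjp_le (h i s hi) G
    _ ≤ x.n * x.n * (x.n : ℝ) ^ c * ‖G‖ := by gcongr
    _ = _ := by ring

/-- Each layer costs a factor `n ^ (11 c + 19)`, so the bound is a fixed power of `n` when the
number of layers is bounded. Otherwise the assumption on Jacobians across layers takes its place. -/
theorem Bounded.vjpBound (h : x.Bounded ((x.n : ℝ) ^ c) R) (hx : x.Smooth) (hn : 6 ≤ x.n)
    (hd : x.d ≤ x.n) (hR : R ≤ x.n) {m₀ : ℕ} (hm : x.m ≤ m₀) :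
    x.VJPBound ((x.n : ℝ) ^ ((11 * c + 19) * m₀)) := by
  have hn' : (1 : ℝ) ≤ x.n := by exact_mod_cast (by omega : 1 ≤ x.n)
  have key : ∀ i s, i + s ≤ x.m → ∀ G : Mat x.n x.d,
      ‖vjp (x.layers i s) (x.T i) G‖ ≤ (x.n : ℝ) ^ ((11 * c + 19) * s) * ‖G‖ := by
    intro i s
    induction s with
    | zero =>
      intro _ G
      have : vjp (x.layers i 0) (x.T i) G = G := vjp_id _ _
      simp [this]
    | succ s ih =>
      intro hi G
      rw [hx.vjp_layers_succ (by omega)]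
      refine (ih (by omega) _).trans ?_
      calc _ ≤ (x.n : ℝ) ^ ((11 * c + 19) * s) * ((x.n : ℝ) ^ (11 * c + 19) * ‖G‖) := by
            gcongr
            exact h.norm_layerBack_le hn hd hR (by omega) G
        _ = _ := by ring
  intro i s hi G
  refine (key i s hi G).trans ?_
  have : (x.n : ℝ) ^ ((11 * c + 19) * s) ≤ (x.n : ℝ) ^ ((11 * c + 19) * m₀) :=
    pow_le_pow_right₀ hn' (Nat.mul_le_mul_left _ (by omega))
  gcongr

/-- The error of the attention matrix. -/
theorem Choice.abs_truncatedAttn_sub_le {K i g L : ℕ} {r : ℝ} (h : x.Choice K i g L r)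
    (hn : 1 ≤ x.n) (hr : Real.exp (2 * r) ≤ x.n) (hg : g + 1 < x.n)
    (hθ : (x.n : ℝ) / (x.n : ℝ) ^ K ≤ 1 / 2) (j k : Fin x.n) :
    |truncatedAttn g (x.S i) j k - softmax (x.S i) j k| ≤ 4 * (x.n / (x.n : ℝ) ^ K) := by
  have hn' : (0 : ℝ) < x.n := by exact_mod_cast hn
  refine abs_softmax_sub_le (E := fun j k => ∑ t ∈ Finset.range (g + 1), x.S i j k ^ t /
    t.factorial) hθ (fun j k => ?_) j k
  have h1 := abs_sum_sub_exp_le (h.abs_scores_le j k) (g + 1)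
  have h2 := h.isDegree.small (g + 1) hg (by omega)
  -- The absolute error of the series becomes a relative one: all scores are at least `-r`, and `exp
  -- (2 r) ≤ n` pays for the difference.
  have h3 : Real.exp r ≤ x.n * Real.exp (x.S i j k) := by
    have h4 := (abs_le.1 (h.abs_scores_le j k)).1
    calc Real.exp r = Real.exp (2 * r) * Real.exp (-r) := by rw [← Real.exp_add]; ring_nf
      _ ≤ x.n * Real.exp (x.S i j k) := by gcongr
  refine h1.trans ?_
  calc _ ≤ 1 / (x.n : ℝ) ^ K * (x.n * Real.exp (x.S i j k)) := by
        have := h.nonneg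
        gcongr
    _ = _ := by ring

end Transformer

/-! ### Propagation of the errors through the layers -/

namespace Transformer

variable {x : Transformer} {c q K k : ℕ} {R : ℝ}

/-- The error that one layer introduces. -/
theorem Bounded.norm_layerBack_sub_le (h : x.Bounded ((x.n : ℝ) ^ c) R) (hn : 36 ≤ x.n)
    (hd : x.d ≤ x.n) (hR : R ≤ x.n) {i : ℕ} (hi : i < x.m) {f : Mat x.n x.n} {θ : ℝ}
    (hθ : 0 ≤ θ) (hθ1 : 4 * θ ≤ 1) (hf : ∀ j k, |f j k - softmax (x.S i) j k| ≤ 4 * θ)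
    (G : Mat x.n x.d) :
    ‖x.layerBack i f G - x.layerBack i (softmax (x.S i)) G‖ ≤
      (x.n : ℝ) ^ (11 * c + 19) * (θ * ‖G‖) := by
  have hn' : (36 : ℝ) ≤ x.n := by exact_mod_cast hn
  have h1 := h.norm_residual_le (by omega) hd (i := i + 1) hi G
  set G' := G + vjp (x.g (i + 1)) (x.Z (i + 1)) G with hG'
  have h2 : ‖x.attnBack i f G' - x.attnBack i (softmax (x.S i)) G'‖ ≤ _ :=
    (h.attnData (by omega) hd hR hi).norm_attnBackward_sub_le (by positivity) hθ1
      (abs_softmax_le_one _) hf G'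
  have e : x.layerBack i f G - x.layerBack i (softmax (x.S i)) G =
      x.attnBack i f G' - x.attnBack i (softmax (x.S i)) G' := by
    simp only [layerBack]
    abel
  rw [e]
  calc _ ≤ 9 * ((x.n : ℝ) ^ (2 * c + 3)) ^ 5 * (4 * θ * ‖G'‖) := h2
    _ = 36 * ((x.n : ℝ) ^ (2 * c + 3)) ^ 5 * (θ * ‖G'‖) := by ring
    _ ≤ x.n * ((x.n : ℝ) ^ (2 * c + 3)) ^ 5 * (θ * ((x.n : ℝ) ^ (c + 3) * ‖G‖)) := by gcongr
    _ = _ := by ring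

/-- All products of the error with the Jacobians of the preceding layers are small. -/
def SmallError (x : Transformer) (η : ℝ) (i : ℕ) (G : Mat x.n x.d) : Prop :=
  ∀ j s, j + s = i → ‖vjp (x.layers j s) (x.T j) (G - x.gradT i)‖ ≤ ((x.m : ℝ) - i) * η

theorem smallError_last (x : Transformer) (η : ℝ) :
    x.SmallError η x.m (grad (overallLoss x.loss) (x.T x.m)) := by
  intro j s _
  rw [gradT_last, sub_self]
  have : vjp (x.layers j s) (x.T j) (0 : Mat x.n x.d) = 0 := by
    rw [← sub_self (0 : Mat x.n x.d), vjp_sub, sub_self, sub_self]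
  simp [this]

theorem SmallError.norm_sub_le {η : ℝ} {i : ℕ} {G : Mat x.n x.d} (h : x.SmallError η i G) :
    ‖G - x.gradT i‖ ≤ ((x.m : ℝ) - i) * η := by
  have h1 := h i 0 rfl
  have h2 : vjp (x.layers i 0) (x.T i) (G - x.gradT i) = G - x.gradT i := vjp_id _ _
  rwa [h2] at h1

/-- The new error is the error made in this layer plus the exact backward pass of the old error.
Carried down to layer `j`, the first part is bounded by `B` times its norm, hence by `η`. The second
part is the old error carried through one layer more, which the hypothesis covers. So the factor `B`
enters once per layer and does not accumulate. -/
theorem SmallError.step (hx : x.Smooth) {B η : ℝ} (hB : x.VJPBound B) {i : ℕ} (hi : i < x.m)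
    {G : Mat x.n x.d} (h : x.SmallError η (i + 1) G) {f : Mat x.n x.n}
    (hf : B * ‖x.layerBack i f G - x.layerBack i (softmax (x.S i)) G‖ ≤ η) :
    x.SmallError η i (x.layerBack i f G) := by
  rintro j s rfl
  have e : x.layerBack (j + s) f G - x.gradT (j + s) =
      (x.layerBack (j + s) f G - x.layerBack (j + s) (softmax (x.S (j + s))) G) +
        x.layerBack (j + s) (softmax (x.S (j + s))) (G - x.gradT (j + s + 1)) := by
    rw [hx.gradT_eq hi, layerBack_sub]
    abel
  rw [e, vjp_add, ← hx.vjp_layers_succ hi]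
  have h1 := hB j s hi.le (x.layerBack (j + s) f G -
    x.layerBack (j + s) (softmax (x.S (j + s))) G)
  have h2 := h j (s + 1) (by omega)
  refine (norm_add_le _ _).trans ((add_le_add (h1.trans hf) h2).trans (le_of_eq ?_))
  push_cast
  ring

/-- The size of the networks, and of the bounds, in which the approximate backward pass works. -/
structure Large (x : Transformer) (R : ℝ) : Prop where
  n_ge : 36 ≤ x.n
  d_le : x.d ≤ x.n
  m_le : x.m ≤ x.n
  R_le : R ≤ x.n
  exp_le : Real.exp (2 * (R * R)) ≤ x.n

/-- The error made in a layer is proportional to the computed cotangent. The latter is within `1` of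
the exact gradient, which is the VJP of the loss gradient through the upper layers. -/
theorem SmallError.norm_le (h : x.Bounded ((x.n : ℝ) ^ c) R) (hl : x.Large R)
    (hB : x.VJPBound ((x.n : ℝ) ^ q)) {i : ℕ} (hi : i ≤ x.m) {η : ℝ} (hη0 : 0 ≤ η)
    (hη : x.n * η ≤ 1) {G : Mat x.n x.d} (hG : x.SmallError η i G) :
    ‖G‖ ≤ (x.n : ℝ) ^ (q + c + 1) := by
  have hn' : (36 : ℝ) ≤ x.n := by exact_mod_cast hl.n_ge
  have hm' : (x.m : ℝ) ≤ x.n := by exact_mod_cast hl.m_le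
  have h1 : ‖G - x.gradT i‖ ≤ 1 := by
    refine hG.norm_sub_le.trans (le_trans ?_ hη)
    gcongr
    have : (0 : ℝ) ≤ i := by positivity
    linarith
  have h2 : ‖x.gradT i‖ ≤ (x.n : ℝ) ^ q * (x.n : ℝ) ^ c :=
    (hB i (x.m - i) (by omega) _).trans (by gcongr; exact h.grad_loss)
  have h3 : (1 : ℝ) ≤ (x.n : ℝ) ^ (q + c) := one_le_pow₀ (by linarith)
  calc ‖G‖ = ‖(G - x.gradT i) + x.gradT i‖ := by rw [sub_add_cancel]
    _ ≤ 1 + (x.n : ℝ) ^ q * (x.n : ℝ) ^ c := (norm_add_le _ _).trans (add_le_add h1 h2)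
    _ ≤ (x.n : ℝ) ^ (q + c) * 2 := by rw [← pow_add]; linarith
    _ ≤ (x.n : ℝ) ^ (q + c) * x.n := by gcongr; linarith
    _ = _ := by ring

/-- The exponent in the approximation of the exponential series that the error `n ^ (-k)` of the
gradient requires. -/
def precision (c q k : ℕ) : ℕ := 13 * c + 2 * q + 24 + k

/-- The error in each layer. -/
def layerError (n c k : ℕ) : ℝ := 1 / (n : ℝ) ^ (c + 3 + k)

theorem natCast_mul_layerError_le {n : ℕ} (hn : 1 ≤ n) (c k : ℕ) :
    (n : ℝ) * layerError n c k ≤ 1 := by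
  have hn' : (1 : ℝ) ≤ n := by exact_mod_cast hn
  rw [layerError, mul_one_div, div_le_one (by positivity)]
  exact le_self_pow₀ hn' (by omega)

theorem SmallError.layerBack (hx : x.Smooth) (h : x.Bounded ((x.n : ℝ) ^ c) R) (hl : x.Large R)
    (hB : x.VJPBound ((x.n : ℝ) ^ q)) {i g L : ℕ} {r : ℝ} (hi : i < x.m)
    (hch : x.Choice (precision c q k) i g L r) (hg : g + 1 < x.n) {G : Mat x.n x.d}
    (hG : x.SmallError (layerError x.n c k) (i + 1) G) :
    x.SmallError (layerError x.n c k) i (x.layerBack i (truncatedAttn g (x.S i)) G) := by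
  have hn' : (36 : ℝ) ≤ x.n := by exact_mod_cast hl.n_ge
  have hn0 : (0 : ℝ) < x.n := by linarith
  set θ : ℝ := x.n / (x.n : ℝ) ^ precision c q k with hθ
  have e : θ * (x.n : ℝ) ^ (precision c q k) = x.n := by rw [hθ]; field_simp
  have hθ4 : 4 * θ ≤ 1 := by
    have h2 : θ * (x.n : ℝ) ≤ 1 := by
      rw [hθ, div_mul_eq_mul_div, div_le_one (by positivity), ← pow_two]
      exact pow_le_pow_right₀ (by linarith) (by unfold precision; omega)
    have h3 : 0 ≤ θ := by positivity
    nlinarith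
  have hr : Real.exp (2 * r) ≤ x.n := by
    refine le_trans ?_ hl.exp_le
    have hT := h.T_le i hi
    have hr : r ≤ R * R := hch.le_norm.trans
      (mul_le_mul hT (h.TW_le i hi) (norm_nonneg _) ((norm_nonneg _).trans hT))
    gcongr
  have hf := hch.abs_truncatedAttn_sub_le (by linarith [hl.n_ge]) hr hg (by linarith)
  refine hG.step hx hB hi ?_
  have h1 := h.norm_layerBack_sub_le hl.n_ge hl.d_le hl.R_le hi (by positivity) hθ4 hf G
  have h2 := hG.norm_le h hl hB hi (by unfold layerError; positivity)
    (natCast_mul_layerError_le (by linarith [hl.n_ge]) c k)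
  calc _ ≤ (x.n : ℝ) ^ q * ((x.n : ℝ) ^ (11 * c + 19) * (θ * (x.n : ℝ) ^ (q + c + 1))) := by
        refine mul_le_mul_of_nonneg_left (h1.trans ?_) (by positivity)
        gcongr
    _ = layerError x.n c k := by
      rw [layerError, eq_div_iff (by positivity)]
      -- The exponents in `precision`: `1` from the relative error, `q` from the transport to lower
      -- layers, `11 c + 19` from the layer, `q + c + 1` from the cotangent, and `c + 3 + k` for the
      -- required error.
      have : (x.n : ℝ) ^ precision c q k =
          x.n * (x.n : ℝ) ^ (q + (11 * c + 19) + (q + c + 1) + (c + 3 + k)) := by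
        rw [precision]; ring
      rw [this] at e
      have h3 : x.n * (θ * (x.n : ℝ) ^ (q + (11 * c + 19) + (q + c + 1) + (c + 3 + k))) =
          (x.n : ℝ) * 1 := by linarith
      have h4 := mul_left_cancel₀ hn0.ne' h3
      rw [← h4]
      ring

theorem SmallError.norm_grad_sub_le (hx : x.Smooth) (h : x.Bounded ((x.n : ℝ) ^ c) R)
    (hl : x.Large R) {G : Mat x.n x.d} (hG : x.SmallError (layerError x.n c k) 0 G) :
    ‖vjp (x.g 0) x.X G - grad x.totalLoss x.X‖ ≤ 1 / (x.n : ℝ) ^ k := by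
  have hn' : (36 : ℝ) ≤ x.n := by exact_mod_cast hl.n_ge
  have hn0 : (0 : ℝ) < x.n := by linarith
  have hm' : (x.m : ℝ) ≤ x.n := by exact_mod_cast hl.m_le
  rw [hx.grad_totalLoss, ← vjp_sub]
  have h1 := hG.norm_sub_le
  have h2 : 0 ≤ layerError x.n c k := by unfold layerError; positivity
  calc _ ≤ (x.n : ℝ) ^ (c + 2) * ‖G - x.gradT 0‖ := h.norm_vjp_g_le hl.d_le (Nat.zero_le _) _
    -- This explains the exponent in `layerError`: `c + 2` for the passage through `g 0` and `1` for
    -- the at most `n` layers whose errors add up.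
    _ ≤ (x.n : ℝ) ^ (c + 2) * (x.n * layerError x.n c k) := by
      gcongr
      refine h1.trans ?_
      gcongr
      simpa using hm'
    _ = _ := by
      rw [layerError, eq_div_iff (by positivity)]
      field_simp
      ring

end Transformer

/-! ### The degrees and the numbers of monomials -/

/-- By minimality, the term before `g` exceeds `n ^ (-K)`. Compared with `r ^ t / t! ≤ exp (lam r) /
lam ^ t` for `lam = exp ((K + 1) / η)` and `lam r ≤ log n`, this forces `t < η log n`. The constant
`lam` may be huge, since `r = o(log n)`. -/
theorem IsDegree.le_log {n K g : ℕ} {r η : ℝ} (h : IsDegree n r (1 / (n : ℝ) ^ K) g) (hr : 0 ≤ r)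
    (hn : 1 < n) (hη : 0 < η) (hr' : Real.exp ((K + 1) / η) * r ≤ Real.log n) :
    (g : ℝ) ≤ η * Real.log n + 1 := by
  have hn' : (1 : ℝ) < n := by exact_mod_cast hn
  have hlog : 0 < Real.log n := Real.log_pos hn'
  rcases h.minimal with rfl | ⟨t, -, rfl, ht⟩
  · push_cast; positivity
  have h1 := ht.trans_le (pow_div_factorial_le hr (Real.exp_pos ((K + 1) / η)) t)
  have h2 : 1 / (n : ℝ) ^ K = Real.exp (-(K * Real.log n)) := by
    rw [Real.exp_neg, one_div, Real.exp_nat_mul, Real.exp_log (by linarith)]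
  rw [h2, ← Real.exp_nat_mul, ← Real.exp_sub, Real.exp_lt_exp] at h1
  have h3 : (t : ℝ) * ((K + 1) / η) < (K + 1) * Real.log n := by linarith
  have h4 : (t : ℝ) < η * Real.log n := by
    rw [mul_div_assoc', div_lt_iff₀ hη] at h3
    have : (0 : ℝ) < K + 1 := by positivity
    nlinarith
  push_cast
  linarith

theorem eventually_mul_sq_le_log {R : ℕ → ℝ}
    (hR : Asymptotics.IsLittleO atTop R fun n : ℕ => Real.sqrt (Real.log n)) {lam : ℝ}
    (hlam : 0 < lam) : ∀ᶠ n : ℕ in atTop, lam * (R n * R n) ≤ Real.log n := by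
  have h := (hR.mul hR).bound (c := lam⁻¹) (by positivity)
  filter_upwards [h, eventually_ge_atTop 1] with n hn h1
  have hlog : 0 ≤ Real.log n := Real.log_nonneg (by exact_mod_cast h1)
  rw [Real.mul_self_sqrt hlog, Real.norm_of_nonneg hlog,
    Real.norm_of_nonneg (mul_self_nonneg _)] at hn
  calc lam * (R n * R n) ≤ lam * (lam⁻¹ * Real.log n) := by gcongr
    _ = _ := by field_simp

/-- The degrees and the numbers of monomials are `n ^ o(1)`. -/
theorem eventually_degree_length_le (C : ℝ) (K : ℕ) {R : ℕ → ℝ}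
    (hR : Asymptotics.IsLittleO atTop R fun n : ℕ => Real.sqrt (Real.log n)) {ε : ℝ}
    (hε : 0 < ε) :
    ∀ᶠ n : ℕ in atTop, ∀ (d g L : ℕ) (r : ℝ), 0 ≤ r → r ≤ R n * R n →
      IsDegree n r (1 / (n : ℝ) ^ K) g → (d : ℝ) ≤ C * Real.log n →
      (∀ z : ℝ, 0 < z → z < 1 → (L : ℝ) ≤ z⁻¹ ^ g * (1 - z)⁻¹ ^ d) →
      (g : ℝ) + 1 ≤ (n : ℝ) ^ ε ∧ (L : ℝ) + 1 ≤ (n : ℝ) ^ ε := by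
  -- The order of the choices matters. First `z` is fixed near `0` with `(1 - z)⁻¹ = exp γ`, so that
  -- the `d` variables cost at most `n ^ (ε / 4)`. Then `z⁻¹ = exp α` is a constant, and `η` makes
  -- the degree so small that `z⁻¹ ^ g` is at most a constant times `n ^ (ε / 4)`.
  set γ : ℝ := ε / (4 * (|C| + 1)) with hγ
  have hγ0 : 0 < γ := by positivity
  set z : ℝ := 1 - Real.exp (-γ) with hz
  have hz1 : z < 1 := by have := Real.exp_pos (-γ); linarith
  have hz0 : 0 < z := by
    have : Real.exp (-γ) < Real.exp 0 := Real.exp_lt_exp.2 (by linarith)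
    rw [Real.exp_zero] at this
    linarith
  set α : ℝ := -Real.log z with hα
  have hα0 : 0 < α := by have := Real.log_neg hz0 hz1; linarith
  set η : ℝ := ε / (4 * α) with hη
  have hη0 : 0 < η := by positivity
  filter_upwards [eventually_mul_sq_le_log hR (Real.exp_pos ((K + 1) / η)), eventually_gt_atTop 1,
    eventually_log_le_rpow (2 * η) hε, eventually_const_le_rpow 4 hε,
    eventually_const_le_rpow (2 * Real.exp α) (half_pos hε)]
    with n h1 hn h2 h3 h4 d g L r hr hr' hdeg hd hL
  have hn' : (1 : ℝ) < n := by exact_mod_cast hn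
  have hlog : 0 < Real.log n := Real.log_pos hn'
  have hg := hdeg.le_log hr hn hη0 ((mul_le_mul_of_nonneg_left hr' (Real.exp_pos _).le).trans h1)
  refine ⟨by linarith, ?_⟩
  have e1 : z⁻¹ = Real.exp α := by rw [hα, Real.exp_neg, Real.exp_log hz0]
  have e2 : (1 - z)⁻¹ = Real.exp γ := by rw [hz, sub_sub_cancel, Real.exp_neg, inv_inv]
  have h5 := hL z hz0 hz1
  rw [e1, e2, ← Real.exp_nat_mul, ← Real.exp_nat_mul, ← Real.exp_add] at h5
  have h6 : (g : ℝ) * α ≤ α + ε / 4 * Real.log n := by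
    calc (g : ℝ) * α ≤ (η * Real.log n + 1) * α := by gcongr
      _ = _ := by rw [hη]; field_simp; ring
  have h7 : (d : ℝ) * γ ≤ ε / 4 * Real.log n := by
    have : (d : ℝ) ≤ (|C| + 1) * Real.log n :=
      hd.trans (by gcongr; linarith [le_abs_self C])
    calc (d : ℝ) * γ ≤ (|C| + 1) * Real.log n * γ := by gcongr
      _ = _ := by
        have : |C| + 1 ≠ 0 := by positivity
        rw [hγ]; field_simp
  have h8 : (L : ℝ) ≤ Real.exp α * (n : ℝ) ^ (ε / 2) := by
    refine h5.trans ?_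
    rw [Real.rpow_def_of_pos (by linarith), ← Real.exp_add, Real.exp_le_exp]
    linarith
  have h9 : (n : ℝ) ^ ε = (n : ℝ) ^ (ε / 2) * (n : ℝ) ^ (ε / 2) := by
    rw [← Real.rpow_add (by linarith), add_halves]
  have h10 : (0 : ℝ) < (n : ℝ) ^ (ε / 2) := by positivity
  have h11 : 2 * (L : ℝ) ≤ (n : ℝ) ^ ε := by
    rw [h9]
    calc 2 * (L : ℝ) ≤ 2 * Real.exp α * (n : ℝ) ^ (ε / 2) := by linarith
      _ ≤ _ := by gcongr
  linarith

/-! ### The theorem for the transformer -/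

theorem floor_le_of_le {a b : ℝ} (h : a ≤ b) (hb : 0 ≤ b) : (⌊a⌋₊ : ℝ) ≤ b :=
  le_trans (by exact_mod_cast Nat.floor_mono h) (Nat.floor_le hb)

theorem eventually_large {R M : ℕ → ℝ} (C : ℝ)
    (hR : Asymptotics.IsLittleO atTop R fun n : ℕ => Real.sqrt (Real.log n))
    (hM : SubPolynomial M) :
    ∀ᶠ n : ℕ in atTop, ∀ x : Transformer, x.n = n → (x.d : ℝ) ≤ C * Real.log x.n →
      (x.m : ℝ) ≤ M x.n → x.Large (R x.n) := by
  filter_upwards [eventually_ge_atTop 36, eventually_log_le_rpow C one_pos, hM 1 one_pos,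
    eventually_mul_sq_le_log hR two_pos] with n hn h1 h2 h3 x hx hd hm
  subst hx
  rw [Real.rpow_one] at h1 h2
  have hn' : (36 : ℝ) ≤ x.n := by exact_mod_cast hn
  have hlog : Real.log x.n ≤ x.n - 1 := Real.log_le_sub_one_of_pos (by linarith)
  refine ⟨hn, by exact_mod_cast hd.trans h1, by exact_mod_cast hm.trans h2, ?_, ?_⟩
  -- If `R > n`, then `2 R ^ 2 > n`, contrary to `2 R ^ 2 ≤ log n ≤ n - 1`.
  · by_contra! h
    nlinarith
  · calc Real.exp (2 * (R x.n * R x.n)) ≤ Real.exp (Real.log x.n) := Real.exp_le_exp.2 h3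
      _ = x.n := Real.exp_log (by linarith)

/-- The running time of the backward pass is almost linear. -/
theorem eventually_time_le {M Tg Tl : ℕ → ℝ} (hM : SubPolynomial M) (hTg : AlmostLinear Tg)
    (hTl : AlmostLinear Tl) {ε : ℝ} (hε : 0 < ε) :
    ∀ᶠ n : ℕ in atTop, ∀ m Q : ℕ, (m : ℝ) ≤ M n → (Q : ℝ) ≤ (n : ℝ) ^ (ε / 32) →
      ((⌊Tl n⌋₊ + (m + 1) * (⌊Tg n⌋₊ + 12000 * ((n + 1) * Q ^ 4)) : ℕ) : ℝ) ≤
        (n : ℝ) ^ (1 + ε) := by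
  have hε8 : 0 < ε / 8 := by positivity
  filter_upwards [hTl (ε / 2) (half_pos hε), hTg (ε / 8) hε8, (hM.add (.const 1)) (ε / 8) hε8,
    eventually_const_le_rpow 24001 hε8, eventually_const_le_rpow 2 (half_pos hε),
    eventually_ge_atTop 1] with n h1 h2 h3 h4 h5 hn m Q hm hQ
  have hn' : (1 : ℝ) ≤ n := by exact_mod_cast hn
  have hn0 : (0 : ℝ) < n := by linarith
  -- The unit of the estimate: `Q ^ 4` and `m + 1` are at most `y`, and `Tg` is at most `n y`. The
  -- constant `24001 = 1 + 2 · 12000` is absorbed by another `y`.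
  set y : ℝ := (n : ℝ) ^ (ε / 8) with hy
  have hy0 : 0 < y := by positivity
  have e1 : (n : ℝ) ^ (1 + ε / 8) = n * y := by rw [Real.rpow_add hn0, Real.rpow_one]
  have e2 : (n : ℝ) ^ (ε / 2) = y * y * y * y := by
    rw [hy, ← Real.rpow_add hn0, ← Real.rpow_add hn0, ← Real.rpow_add hn0]; ring_nf
  have e3 : (n : ℝ) ^ (1 + ε / 2) = n * (y * y * y * y) := by
    rw [Real.rpow_add hn0, Real.rpow_one, e2]
  have e4 : (n : ℝ) ^ (1 + ε) = n * (y * y * y * y) * (n : ℝ) ^ (ε / 2) := by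
    rw [← e3, ← Real.rpow_add hn0]; ring_nf
  have hQ4 : (Q : ℝ) ^ 4 ≤ y := by
    calc (Q : ℝ) ^ 4 ≤ ((n : ℝ) ^ (ε / 32)) ^ 4 := by gcongr
      _ = y := by rw [hy, ← Real.rpow_mul_natCast hn0.le]; congr 1; push_cast; ring
  have h6 : (⌊Tl n⌋₊ : ℝ) ≤ n * (y * y * y * y) := by
    rw [← e3]; exact floor_le_of_le h1 (by positivity)
  have h7 : (⌊Tg n⌋₊ : ℝ) ≤ n * y := by
    rw [← e1]; exact floor_le_of_le h2 (by positivity)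
  push_cast
  calc (⌊Tl n⌋₊ : ℝ) + (m + 1) * (⌊Tg n⌋₊ + 12000 * ((n + 1) * (Q : ℝ) ^ 4))
      ≤ n * (y * y * y * y) + y * (n * y + 12000 * ((n + n) * y)) := by
        gcongr
        linarith
    _ = n * (y * y * y * y) + n * (y * y) * 24001 := by ring
    _ ≤ n * (y * y * y * y) + n * (y * y) * (y * y) := by
        gcongr
        nlinarith
    _ = n * (y * y * y * y) * 2 := by ring
    _ ≤ _ := by rw [e4]; gcongr

theorem transformer_backward (prim : ℕ → ℝ → ℝ) (Pg Pl : Prog) (C : ℝ) (c m₀ k : ℕ) :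
      ∃ P : Prog,
      ∀ (F : Set Transformer) (R M Tg Tl : ℕ → ℝ),
        Asymptotics.IsLittleO Filter.atTop R (fun n : ℕ => Real.sqrt (Real.log n)) →
        SubPolynomial M →
        AlmostLinear Tg → AlmostLinear Tl →
        (∀ x ∈ F, (x.d : ℝ) ≤ C * Real.log x.n ∧ (x.m : ℝ) ≤ M x.n ∧
          x.Encoded ∧ x.Smooth ∧ x.Bounded ((x.n : ℝ) ^ c) (R x.n) ∧
          x.BackwardRuns prim Pg (Tg x.n) ∧ x.LossGradientRuns prim Pl (Tl x.n) ∧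
          (x.m ≤ m₀ ∨ x.CrossLayerBound ((x.n : ℝ) ^ c))) →
        ∃ (T : ℕ → ℝ) (N : ℕ), AlmostLinear T ∧
          ∀ x ∈ F, N ≤ x.n → DifferentiableAt ℝ x.totalLoss x.X ∧
            ∀ σ : Store,
              RunsIn prim x.input P σ (T x.n) fun σ' =>
                ∃ O : Mat x.n x.d, σ'.HoldsMat 1 O ∧
                  ‖O - grad x.totalLoss x.X‖ ≤ 1 / (x.n : ℝ) ^ k := by
  -- The sum dominates the exponents of both alternatives, a bounded number of layers and bounded
  -- Jacobians across layers, so one precision serves both.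
  set q : ℕ := c + 2 + (11 * c + 19) * m₀ with hq
  set K := Transformer.precision c q k with hK
  -- At least `1`, so that register `0`, the argument of `Pg`, stays outside the view.
  set b := max (max Pg.bound Pl.bound) 1 with hb
  refine ⟨Transformer.backwardProg b K Pg Pl, fun F R M Tg Tl hR hM hTg hTl hF => ?_⟩
  -- The statement for size `n` covers all members of the family of that size, so that the time
  -- bound and the threshold are uniform.
  obtain ⟨T, N, hT, hN⟩ := exists_almostLinear (Q := fun n τ => ∀ x ∈ F, x.n = n →
    ∀ σ : Store, RunsIn prim x.input (Transformer.backwardProg b K Pg Pl) σ τ fun σ' =>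
      ∃ O : Mat x.n x.d, σ'.HoldsMat 1 O ∧
        ‖O - grad x.totalLoss x.X‖ ≤ 1 / (x.n : ℝ) ^ k) (by
    intro ε hε
    have hε' : 0 < ε / 32 := by positivity
    -- The degree estimate is used twice: with exponent `ε / 32` for the running time, and with `1 /
    -- 2` to ensure `g + 1 < n`, so that the first omitted term was among those tested by the
    -- search.
    filter_upwards [eventually_large C hR hM, eventually_time_le hM hTg hTl hε,
      eventually_degree_length_le C K hR hε', eventually_degree_length_le C K hR one_half_pos,
      ((SubPolynomial.log C).add (.const 1)) (ε / 32) hε', eventually_const_le_rpow K hε']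
      with n h1 h2 h3 h4 h5 h6 x hx hxn σ
    subst hxn
    obtain ⟨hd, hm, hE, hS, hB, hg, hl, hcases⟩ := hF x hx
    have hL := h1 x rfl hd hm
    have hn1 : (36 : ℝ) ≤ x.n := by exact_mod_cast hL.n_ge
    have hV : x.VJPBound ((x.n : ℝ) ^ q) := by
      have mono : ∀ p, p ≤ q → x.VJPBound ((x.n : ℝ) ^ p) → x.VJPBound ((x.n : ℝ) ^ q) := by
        intro p hp h i s hi G
        refine (h i s hi G).trans ?_
        have : (x.n : ℝ) ^ p ≤ (x.n : ℝ) ^ q := pow_le_pow_right₀ (by linarith) hp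
        gcongr
      rcases hcases with h | h
      · exact mono _ (by omega) (hB.vjpBound hS (by linarith [hL.n_ge]) hL.d_le hL.R_le h)
      · exact mono _ (by omega) (h.vjpBound hL.d_le)
    have hr : ∀ {i g L r}, i < x.m → x.Choice K i g L r → r ≤ R x.n * R x.n := fun hi hch =>
      hch.le_norm.trans (mul_le_mul (hB.T_le _ hi) (hB.TW_le _ hi) (norm_nonneg _)
        ((norm_nonneg _).trans (hB.T_le _ hi)))
    set Q := ⌊(x.n : ℝ) ^ (ε / 32)⌋₊ with hQ
    have hQle : (Q : ℝ) ≤ (x.n : ℝ) ^ (ε / 32) := Nat.floor_le (by positivity)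
    have hleQ : ∀ a : ℕ, (a : ℝ) ≤ (x.n : ℝ) ^ (ε / 32) → a ≤ Q := fun a ha => Nat.le_floor ha
    refine (Transformer.backwardProg_runs (Q := Q) hE hg hl
      ((le_max_left _ _).trans (le_max_left _ _)) ((le_max_right _ _).trans (le_max_left _ _))
      (lt_of_lt_of_le one_pos (le_max_right _ _)) (hleQ _ (by push_cast; linarith)) (hleQ _ h6) ?_
      (P := x.SmallError (Transformer.layerError x.n c k)) (x.smallError_last _) ?_ σ).runsIn
      (h2 x.m Q hm hQle) ?_
    · intro i hi g L r hch
      have := h3 x.d g L r hch.nonneg (hr hi hch) hch.isDegree hd hch.length_le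
      exact ⟨hleQ _ (by push_cast; linarith), hleQ _ (by push_cast; linarith)⟩
    · intro i hi G hG g L r hch
      have h7 := (h4 x.d g L r hch.nonneg (hr hi hch) hch.isDegree hd hch.length_le).1
      have h8 : (x.n : ℝ) ^ (1 / 2 : ℝ) < x.n := by
        conv_rhs => rw [← Real.rpow_one (x.n : ℝ)]
        exact Real.rpow_lt_rpow_of_exponent_lt (by linarith) (by norm_num)
      exact hG.layerBack hS hB hL hV hi hch (by exact_mod_cast h7.trans_lt h8)
    · rintro σ' ⟨G, hG, hO⟩
      exact ⟨_, hO, hG.norm_grad_sub_le hS hB hL⟩)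
  exact ⟨T, N, hT, fun x hx hn =>
    ⟨(hF x hx).2.2.2.1.differentiableAt_totalLoss, hN x.n hn x hx rfl⟩⟩

end ResidualTransformer

end

theorem lemmaJ3 (prim : ℕ → ℝ → ℝ) :
    -- one residual block
    (∀ PH : ResidualTransformer.Prog, ∃ PR : ResidualTransformer.Prog,
      ∀ (C : ℝ) (F : Set ResidualTransformer.Block) (TH δ : ℕ → ℝ),
        ResidualTransformer.AlmostLinear TH →
        (∀ x ∈ F, x.Admissible C ∧ x.VJPRuns prim PH (TH x.n) (δ x.n)) →
        ∃ T : ℕ → ℝ, ResidualTransformer.AlmostLinear T ∧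
          (∀ x ∈ F, DifferentiableAt ℝ x.lossX x.X ∧
            ∀ σ : ResidualTransformer.Store, σ.HoldsMat 0 x.gradY →
              ResidualTransformer.RunsIn prim x.input PR σ (T x.n) fun σ' =>
                ∃ O : ResidualTransformer.Mat x.n x.d,
                  σ'.HoldsMat 1 O ∧ ‖O - x.gradX‖ ≤ δ x.n) ∧
          (∀ c : ℕ, (∀ x ∈ F, ResidualTransformer.JacobianBound x.H x.X ((x.n : ℝ) ^ c)) →
            ∃ K : ℕ, ∀ k : ℕ, ∀ x ∈ F, ∀ (G : ResidualTransformer.Mat x.n x.d)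
              (σ : ResidualTransformer.Store),
              ‖G - x.gradY‖ ≤ 1 / (x.n : ℝ) ^ (k + K) → σ.HoldsMat 0 G →
              ResidualTransformer.RunsIn prim x.input PR σ (T x.n) fun σ' =>
                ∃ O : ResidualTransformer.Mat x.n x.d,
                  σ'.HoldsMat 1 O ∧ ‖O - x.gradX‖ ≤ 1 / (x.n : ℝ) ^ k + δ x.n)) ∧
    -- the multi-layer transformer
    (∀ (Pg Pl : ResidualTransformer.Prog) (C : ℝ) (c m₀ k : ℕ),
      ∃ P : ResidualTransformer.Prog,
      ∀ (F : Set ResidualTransformer.Transformer) (R M Tg Tl : ℕ → ℝ),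
        Asymptotics.IsLittleO Filter.atTop R (fun n : ℕ => Real.sqrt (Real.log n)) →
        ResidualTransformer.SubPolynomial M →
        ResidualTransformer.AlmostLinear Tg → ResidualTransformer.AlmostLinear Tl →
        (∀ x ∈ F, (x.d : ℝ) ≤ C * Real.log x.n ∧ (x.m : ℝ) ≤ M x.n ∧
          x.Encoded ∧ x.Smooth ∧ x.Bounded ((x.n : ℝ) ^ c) (R x.n) ∧
          x.BackwardRuns prim Pg (Tg x.n) ∧ x.LossGradientRuns prim Pl (Tl x.n) ∧
          (x.m ≤ m₀ ∨ x.CrossLayerBound ((x.n : ℝ) ^ c))) →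
        ∃ (T : ℕ → ℝ) (N : ℕ), ResidualTransformer.AlmostLinear T ∧
          ∀ x ∈ F, N ≤ x.n → DifferentiableAt ℝ x.totalLoss x.X ∧
            ∀ σ : ResidualTransformer.Store,
              ResidualTransformer.RunsIn prim x.input P σ (T x.n) fun σ' =>
                ∃ O : ResidualTransformer.Mat x.n x.d, σ'.HoldsMat 1 O ∧
                  ‖O - ResidualTransformer.grad x.totalLoss x.X‖ ≤ 1 / (x.n : ℝ) ^ k) := by
  exact ⟨ResidualTransformer.residual_block prim, ResidualTransformer.transformer_backward prim⟩
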